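/- Let $\mathbb{T}^\infty$ be the countably infinite product of the circle $\mathbb{T}=\{z\in\mathbb{C}:|z|=1\}$ with its normalized Haar measure $\mu_\infty$, and write $\widehat{f}(\alpha)=\int_{\mathbb{T}^\infty} f(z)\overline{z^\alpha}\,d\mu_\infty(z)$ for the Fourier coefficients of $f\in L^1(\mathbb{T}^\infty)$, where $\alpha$ runs over the integer multi-indices with finitely many non-zero components. For $1\le p<\infty$ let $H^p(\mathbb{T}^\infty)$ be the subspace of those $f\in L^p(\mathbb{T}^\infty)$ such that $\widehat f(\alpha)=0$ whenever $\alpha$ has a negative component. A linear function is a series $\varphi(z)=\sum_{j\ge1}c_jz_j$, and it is viewed as an element of the dual space $(H^p(\mathbb{T}^\infty))^*$, if it defines a bounded functional there, through \[\langle f,\varphi\rangle=\sum_{j\ge1}\widehat f(e_j)\overline{c_j},\qquad \|\varphi\|_{(H^p(\mathbb{T}^\infty))^*}=\sup_{0\ne f\in H^p(\mathbb{T}^\infty)}\frac{|\langle f,\varphi\rangle|}{\|f\|_{H^p(\mathbb{T}^\infty)}},\] where $e_j$ is the $j$-th unit multi-index. Set \[a_p=\min\left(1,\Gamma\left(1+\tfrac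 p2\right)^{1/p}\right),\qquad b_p=\max\left(1,\Gamma\left(1+\tfrac p2\right)^{1/p}\right).\] Let $1\le p<\infty$. A linear function $\varphi$ belongs to $(H^p(\mathbb{T}^\infty))^*$ if and only if it belongs to $H^2(\mathbb{T}^\infty)$. In this case the series $\langle f,\varphi\rangle$ converges absolutely for every $f\in H^p(\mathbb{T}^\infty)$ and equals $\int_{\mathbb{T}^\infty} f\,\overline{\varphi}\,d\mu_\infty$ whenever $f\in H^p(\mathbb{T}^\infty)\cap L^2(\mathbb{T}^\infty)$, and \[b_p^{-1}\|\varphi\|_{H^2(\mathbb{T}^\infty)}\le\|\varphi\|_{(H^p(\mathbb{T}^\infty))^*}\le a_p^{-1}\|\varphi\|_{H^2(\mathbb{T}^\infty)}.\] For each $p$ the constants are optimal: if $A,B$ are real numbers such that $A\|\varphi\|_{H^2(\mathbb{T}^\infty)}\le\|\varphi\|_{(H^p(\mathbb{T}^\infty))^*}$ for all linear functions $\varphi\in H^2(\mathbb{T}^\infty)$, then $A\le b_p^{-1}$, and if $\|\varphi\|_{(H^p(\mathbb{T}^\infty))^*}\le B\|\varphi\|_{H^2(\mathbb{T}^\infty)}$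 for all such $\varphi$, then $a_p^{-1}\le B$. -/

import Mathlib

open MeasureTheory
open scoped ENNReal ComplexConjugate

noncomputable section

namespace Polytorus

/-- The infinite polytorus `𝕋^∞`. A point `x` is given by its angles `x j ∈ ℝ/ℤ`; the
corresponding point of the product of unit circles has coordinates
`z_j = exp (2πi x_j) = fourier 1 (x j)`. -/
abbrev InfTorus : Type := ℕ → UnitAddCircle

/-- The Haar measure on `𝕋^∞`: the infinite product of the normalized arc length measures. -/
def haar : Measure InfTorus :=
  Measure.infinitePi fun _ : ℕ => (AddCircle.haarAddCircle : Measure UnitAddCircle)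

instance : IsProbabilityMeasure haar := by
  unfold haar; infer_instance

/-- The monomial `z^α = ∏_j z_j^{α_j}`, for a multi-index `α` with finitely many non-zero
components (recall that `fourier k (x j) = exp (2πi k x_j) = z_j^k`). -/
def monomial (α : ℕ →₀ ℤ) (x : InfTorus) : ℂ :=
  ∏ j ∈ α.support, fourier (α j) (x j)

/-- The Fourier coefficient `c_α = ∫ f(z) conj(z^α) dμ_∞(z)`. -/
def coeff (f : InfTorus → ℂ) (α : ℕ →₀ ℤ) : ℂ :=
  ∫ x, f x * conj (monomial α x) ∂haar

theorem continuous_monomial (α : ℕ →₀ ℤ) : Continuous (monomial α) :=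
  continuous_finsetProd _ fun j _ => (fourier (α j)).continuous.comp (continuous_apply j)

theorem norm_monomial (α : ℕ →₀ ℤ) (x : InfTorus) : ‖monomial α x‖ = 1 := by
  simp only [monomial, norm_prod]
  exact Finset.prod_eq_one fun j _ => by rw [fourier_apply]; exact Circle.norm_coe _

theorem integrable_mul_conj_monomial {p : ℝ≥0∞} [Fact (1 ≤ p)] (f : Lp ℂ p haar)
    (α : ℕ →₀ ℤ) : Integrable (fun x => f x * conj (monomial α x)) haar := by
  refine ((Lp.memLp f).integrable Fact.out).mul_bdd (c := 1) ?_ ?_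
  · exact (Complex.continuous_conj.comp (continuous_monomial α)).aestronglyMeasurable
  · exact Filter.Eventually.of_forall fun x => by simp [norm_monomial]

/-- The Hardy space `H^p(𝕋^∞)`: the subspace of `L^p(𝕋^∞)` of all `f` with `P f = f`, that is,
whose Fourier coefficients vanish outside of `ℕ_0^∞`. It carries the norm of `L^p(𝕋^∞)`. -/
def Hardy (p : ℝ≥0∞) [Fact (1 ≤ p)] : Submodule ℂ (Lp ℂ p haar) where
  carrier := {f | ∀ α : ℕ →₀ ℤ, (∃ j, α j < 0) → coeff f α = 0}
  zero_mem' := by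
    intro α _
    have h : coeff (0 : Lp ℂ p haar) α = ∫ x, (0 : ℂ) ∂haar := by
      refine integral_congr_ae ?_
      filter_upwards [Lp.coeFn_zero ℂ p haar] with x hx
      simp only [hx, Pi.zero_apply, zero_mul]
    simpa using h
  add_mem' := by
    intro f g hf hg α hα
    have h : coeff (f + g : Lp ℂ p haar) α = coeff f α + coeff g α := by
      unfold coeff
      rw [← integral_add (integrable_mul_conj_monomial f α) (integrable_mul_conj_monomial g α)]
      refine integral_congr_ae ?_
      filter_upwards [Lp.coeFn_add f g] with x hx
      simp only [hx, Pi.add_apply, add_mul]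
    rw [h, hf α hα, hg α hα, add_zero]
  smul_mem' := by
    intro c f hf α hα
    have h : coeff (c • f : Lp ℂ p haar) α = c * coeff f α := by
      unfold coeff
      rw [← integral_const_mul]
      refine integral_congr_ae ?_
      filter_upwards [Lp.coeFn_smul c f] with x hx
      simp [hx, mul_assoc]
    rw [h, hf α hα, mul_zero]

/-- The Fourier series `∑_α a_α z^α` has the form `∑_j c_j z_j` (with `c_j` the coefficient at
the multi-index `e_j`); no summability of the coefficients is required. -/
def IsLinearSeries (a : (ℕ →₀ ℤ) → ℂ) : Prop :=
  ∀ α : ℕ →₀ ℤ, (∀ j : ℕ, α ≠ Finsupp.single j 1) → a α = 0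

/-- The Fourier series `φ = ∑_α a_α z^α`, viewed as an element of the dual space of
`H^p(𝕋^∞)`, is the bounded functional `Λ f = ⟨f, φ⟩ = ∑_α f̂(α) conj(a_α)`. Its norm in
`(H^p(𝕋^∞))^*` is the operator norm of `Λ`. -/
def Represents {p : ℝ≥0∞} [Fact (1 ≤ p)] (a : (ℕ →₀ ℤ) → ℂ)
    (Λ : StrongDual ℂ (Hardy p)) : Prop :=
  ∀ f : Hardy p, HasSum (fun α : ℕ →₀ ℤ => coeff f.1 α * conj (a α)) (Λ f)

/-- `a_p = min (1, Γ(1 + p/2)^{1/p})`. -/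
def lowerConst (p : ℝ) : ℝ := min 1 (Real.Gamma (1 + p / 2) ^ (1 / p))

/-- `b_p = max (1, Γ(1 + p/2)^{1/p})`. -/
def upperConst (p : ℝ) : ℝ := max 1 (Real.Gamma (1 + p / 2) ^ (1 / p))

end Polytorus

end

open MeasureTheory
open scoped ENNReal ComplexConjugate

noncomputable section

namespace Polytorus

section

open AddCircle

/-! ### Taylor bounds for sine and cosine -/

/-! Two facts carry the theorem. The map f ↦ ∑_{j∈s} f̂(e_j) z_j is a contraction from H^p to L^p
(`integral_norm_rpow_lin_le`), and the Steinhaus sums S = ∑ a_j z_j with σ² = ∑ |a_j|² satisfy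
Khinchine's inequality with sharp constants, a_p σ ≤ ‖S‖_p ≤ b_p σ (`khinchine`). Together they
bound the ℓ² norm of the coefficients f̂(e_j) by a_p⁻¹ ‖f‖_p, and Cauchy–Schwarz gives the upper
estimate. For the lower estimate the functional is tested on truncations of φ itself; the same test
shows that a bounded functional has square-summable coefficients.

The constants are attained by z_0, which has norm 1 in every space involved, or approached by (z_0 +
⋯ + z_n)/√(n+1). For the latter, averaging over cyclic shifts shows that the norm of the functional
is the reciprocal of the H^p norm (`norm_mul_norm_eq_one_of_represents_const`), and the central
limit theorem brings in Γ(1+p/2)^{1/p}.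

The contraction is convexity plus orthogonality: if g is the linear part of f in the variables of s,
then f − g is orthogonal to g h(|g|²) for every continuous real h, because conj(g) h(|g|²) is a
limit of trigonometric polynomials of degree −1 in those variables. Hence the first-order term of
|·|^p at g integrates to zero.

In Khinchine's inequality the constant 1 is Jensen's inequality. The other constant compares S, for
σ = 1, with the standard complex Gaussian, whose p-th absolute moment is Γ(1+p/2). Moments are
written as integrals against t^{-1-p} of the radial characteristic functions ∏ J₀(|a_j| t) and
exp(-t²/4) (`kernel_moment`). For p = 1 there are two cases. If all |a_j|² ≤ 1/2, the weighted AM–GM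
inequality reduces the claim to a one-variable integral inequality for powers of J₀
(`exp_rpow_sub_bessel_rpow`). If some |a_j|² ≥ 1/2, one conditions on the other variables and uses a
polynomial lower bound for the mean of |1 + ρz|. Adding an independent Gaussian component to S and
integrating over its size turns the case p = 1 into ∫ (exp(-t²/4) − ∏ J₀(|a_j| t)) t^{-1-p} dt ≥ 0
for 1 < p < 4. This is a lower bound for moments when p < 2 and an upper bound when p > 2. Orders p
≥ 4 follow from the recursion `moment_add_two_le`, which mirrors the functional equation of Γ. -/

theorem nonneg_of_hasDerivAt_nonneg {f f' : ℝ → ℝ} (h : ∀ x, HasDerivAt f (f' x) x)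
    (h0 : f 0 = 0) (h' : ∀ x, 0 ≤ x → 0 ≤ f' x) : ∀ x, 0 ≤ x → 0 ≤ f x := by
  intro x hx
  have hm : MonotoneOn f (Set.Ici 0) := by
    refine monotoneOn_of_deriv_nonneg (convex_Ici 0)
      (fun y _ => (h y).continuousAt.continuousWithinAt)
      (fun y _ => (h y).differentiableAt.differentiableWithinAt) fun y hy => ?_
    rw [(h y).deriv]
    exact h' y (by simpa using (interior_subset hy : y ∈ Set.Ici (0 : ℝ)))
  simpa [h0] using hm Set.self_mem_Ici hx hx

/-- Each difference vanishes at 0 and has the preceding one as its derivative, so the chain starts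
from cos x ≥ 1 − x²/2 and is integrated step by step. Only the degrees needed in the numerical
estimates of J₀ and J₁ are returned. -/
theorem sin_cos_taylor_nonneg :
    (∀ x : ℝ, 0 ≤ x → 0 ≤ 1 - x ^ 2 / 2 + x ^ 4 / 24 - x ^ 6 / 720 + x ^ 8 / 40320 - Real.cos x) ∧
    (∀ x : ℝ, 0 ≤ x → 0 ≤ x - x ^ 3 / 6 + x ^ 5 / 120 - x ^ 7 / 5040 + x ^ 9 / 362880
      - Real.sin x) ∧
    (∀ x : ℝ, 0 ≤ x → 0 ≤ Real.cos x - (1 - x ^ 2 / 2 + x ^ 4 / 24 - x ^ 6 / 720 + x ^ 8 / 40320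
      - x ^ 10 / 3628800)) ∧
    (∀ x : ℝ, 0 ≤ x → 0 ≤ Real.sin x - (x - x ^ 3 / 6 + x ^ 5 / 120 - x ^ 7 / 5040
      + x ^ 9 / 362880 - x ^ 11 / 39916800)) ∧
    (∀ x : ℝ, 0 ≤ x → 0 ≤ 1 - x ^ 2 / 2 + x ^ 4 / 24 - Real.cos x) := by
  have c2 : ∀ x : ℝ, 0 ≤ x → 0 ≤ Real.cos x - (1 - x ^ 2 / 2) := fun x _ => by
    linarith [Real.one_sub_sq_div_two_le_cos (x := x)]
  have s3 : ∀ x : ℝ, 0 ≤ x → 0 ≤ Real.sin x - (x - x ^ 3 / 6) :=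
    nonneg_of_hasDerivAt_nonneg (fun x => by
      refine ((Real.hasDerivAt_sin x).sub ((hasDerivAt_id x).sub
        ((hasDerivAt_pow 3 x).div_const 6))).congr_deriv ?_
      norm_num; ring) (by simp) c2
  have c4 : ∀ x : ℝ, 0 ≤ x → 0 ≤ 1 - x ^ 2 / 2 + x ^ 4 / 24 - Real.cos x :=
    nonneg_of_hasDerivAt_nonneg (fun x => by
      refine ((((hasDerivAt_const x (1 : ℝ)).sub ((hasDerivAt_pow 2 x).div_const 2)).add
        ((hasDerivAt_pow 4 x).div_const 24)).sub (Real.hasDerivAt_cos x)).congr_deriv ?_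
      norm_num; ring) (by simp) s3
  have s5 : ∀ x : ℝ, 0 ≤ x → 0 ≤ x - x ^ 3 / 6 + x ^ 5 / 120 - Real.sin x :=
    nonneg_of_hasDerivAt_nonneg (fun x => by
      refine ((((hasDerivAt_id x).sub ((hasDerivAt_pow 3 x).div_const 6)).add
        ((hasDerivAt_pow 5 x).div_const 120)).sub (Real.hasDerivAt_sin x)).congr_deriv ?_
      norm_num; ring) (by simp) c4
  have c6 : ∀ x : ℝ, 0 ≤ x →
      0 ≤ Real.cos x - (1 - x ^ 2 / 2 + x ^ 4 / 24 - x ^ 6 / 720) :=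
    nonneg_of_hasDerivAt_nonneg (fun x => by
      refine ((Real.hasDerivAt_cos x).sub
        ((((hasDerivAt_const x (1 : ℝ)).sub ((hasDerivAt_pow 2 x).div_const 2)).add
        ((hasDerivAt_pow 4 x).div_const 24)).sub
        ((hasDerivAt_pow 6 x).div_const 720))).congr_deriv ?_
      norm_num; ring) (by simp) s5
  have s7 : ∀ x : ℝ, 0 ≤ x →
      0 ≤ Real.sin x - (x - x ^ 3 / 6 + x ^ 5 / 120 - x ^ 7 / 5040) :=
    nonneg_of_hasDerivAt_nonneg (fun x => by
      refine ((Real.hasDerivAt_sin x).sub ((((hasDerivAt_id x).sub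
        ((hasDerivAt_pow 3 x).div_const 6)).add ((hasDerivAt_pow 5 x).div_const 120)).sub
        ((hasDerivAt_pow 7 x).div_const 5040))).congr_deriv ?_
      norm_num; ring) (by simp) c6
  have c8 : ∀ x : ℝ, 0 ≤ x →
      0 ≤ 1 - x ^ 2 / 2 + x ^ 4 / 24 - x ^ 6 / 720 + x ^ 8 / 40320 - Real.cos x :=
    nonneg_of_hasDerivAt_nonneg (fun x => by
      refine ((((((hasDerivAt_const x (1 : ℝ)).sub ((hasDerivAt_pow 2 x).div_const 2)).add
        ((hasDerivAt_pow 4 x).div_const 24)).sub ((hasDerivAt_pow 6 x).div_const 720)).add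
        ((hasDerivAt_pow 8 x).div_const 40320)).sub (Real.hasDerivAt_cos x)).congr_deriv ?_
      norm_num; ring) (by simp) s7
  have s9 : ∀ x : ℝ, 0 ≤ x → 0 ≤ x - x ^ 3 / 6 + x ^ 5 / 120 - x ^ 7 / 5040 + x ^ 9 / 362880
      - Real.sin x :=
    nonneg_of_hasDerivAt_nonneg (fun x => by
      refine ((((((hasDerivAt_id x).sub ((hasDerivAt_pow 3 x).div_const 6)).add
        ((hasDerivAt_pow 5 x).div_const 120)).sub ((hasDerivAt_pow 7 x).div_const 5040)).add
        ((hasDerivAt_pow 9 x).div_const 362880)).sub (Real.hasDerivAt_sin x)).congr_deriv ?_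
      norm_num; ring) (by simp) c8
  have c10 : ∀ x : ℝ, 0 ≤ x → 0 ≤ Real.cos x - (1 - x ^ 2 / 2 + x ^ 4 / 24 - x ^ 6 / 720
      + x ^ 8 / 40320 - x ^ 10 / 3628800) :=
    nonneg_of_hasDerivAt_nonneg (fun x => by
      refine ((Real.hasDerivAt_cos x).sub
        ((((((hasDerivAt_const x (1 : ℝ)).sub ((hasDerivAt_pow 2 x).div_const 2)).add
        ((hasDerivAt_pow 4 x).div_const 24)).sub ((hasDerivAt_pow 6 x).div_const 720)).add
        ((hasDerivAt_pow 8 x).div_const 40320)).sub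
        ((hasDerivAt_pow 10 x).div_const 3628800))).congr_deriv ?_
      norm_num; ring) (by simp) s9
  have s11 : ∀ x : ℝ, 0 ≤ x → 0 ≤ Real.sin x - (x - x ^ 3 / 6 + x ^ 5 / 120 - x ^ 7 / 5040
      + x ^ 9 / 362880 - x ^ 11 / 39916800) :=
    nonneg_of_hasDerivAt_nonneg (fun x => by
      refine ((Real.hasDerivAt_sin x).sub ((((((hasDerivAt_id x).sub
        ((hasDerivAt_pow 3 x).div_const 6)).add ((hasDerivAt_pow 5 x).div_const 120)).sub
        ((hasDerivAt_pow 7 x).div_const 5040)).add ((hasDerivAt_pow 9 x).div_const 362880)).sub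
        ((hasDerivAt_pow 11 x).div_const 39916800))).congr_deriv ?_
      norm_num; ring) (by simp) c10
  exact ⟨c8, s9, c10, s11, c4⟩

theorem cos_le_taylor_four (x : ℝ) : Real.cos x ≤ 1 - x ^ 2 / 2 + x ^ 4 / 24 := by
  have := sin_cos_taylor_nonneg.2.2.2.2 |x| (abs_nonneg x)
  rw [Real.cos_abs, Even.pow_abs (by decide), Even.pow_abs (by decide)] at this
  linarith

theorem cos_le_taylor_eight (x : ℝ) :
    Real.cos x ≤ 1 - x ^ 2 / 2 + x ^ 4 / 24 - x ^ 6 / 720 + x ^ 8 / 40320 := by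
  have := sin_cos_taylor_nonneg.1 |x| (abs_nonneg x)
  simp only [Real.cos_abs, Even.pow_abs (show Even 2 by decide),
    Even.pow_abs (show Even 4 by decide), Even.pow_abs (show Even 6 by decide),
    Even.pow_abs (show Even 8 by decide)] at this
  linarith

theorem taylor_ten_le_cos (x : ℝ) :
    1 - x ^ 2 / 2 + x ^ 4 / 24 - x ^ 6 / 720 + x ^ 8 / 40320 - x ^ 10 / 3628800 ≤ Real.cos x := by
  have := sin_cos_taylor_nonneg.2.2.1 |x| (abs_nonneg x)
  simp only [Real.cos_abs, Even.pow_abs (show Even 2 by decide),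
    Even.pow_abs (show Even 4 by decide), Even.pow_abs (show Even 6 by decide),
    Even.pow_abs (show Even 8 by decide), Even.pow_abs (show Even 10 by decide)] at this
  linarith

theorem abs_mul_sin_abs (x : ℝ) : |x| * Real.sin |x| = x * Real.sin x := by
  rcases abs_cases x with ⟨h, _⟩ | ⟨h, _⟩ <;> rw [h]
  rw [Real.sin_neg]; ring

/-- The factor x makes both sides even, so that the bound for x ≥ 0 extends to all real x. This is
needed because t cos θ changes sign over a period. -/
theorem mul_sin_le_taylor (x : ℝ) :
    x * Real.sin x ≤ x ^ 2 - x ^ 4 / 6 + x ^ 6 / 120 - x ^ 8 / 5040 + x ^ 10 / 362880 := by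
  have := mul_nonneg (abs_nonneg x) (sin_cos_taylor_nonneg.2.1 |x| (abs_nonneg x))
  have h : |x| * (|x| - |x| ^ 3 / 6 + |x| ^ 5 / 120 - |x| ^ 7 / 5040 + |x| ^ 9 / 362880
      - Real.sin |x|) = |x| ^ 2 - |x| ^ 4 / 6 + |x| ^ 6 / 120 - |x| ^ 8 / 5040
      + |x| ^ 10 / 362880 - |x| * Real.sin |x| := by ring
  rw [h, abs_mul_sin_abs] at this
  simp only [Even.pow_abs (show Even 2 by decide),
    Even.pow_abs (show Even 4 by decide), Even.pow_abs (show Even 6 by decide),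
    Even.pow_abs (show Even 8 by decide), Even.pow_abs (show Even 10 by decide)] at this
  linarith

theorem taylor_le_mul_sin (x : ℝ) :
    x ^ 2 - x ^ 4 / 6 + x ^ 6 / 120 - x ^ 8 / 5040 + x ^ 10 / 362880 - x ^ 12 / 39916800
      ≤ x * Real.sin x := by
  have := mul_nonneg (abs_nonneg x) (sin_cos_taylor_nonneg.2.2.2.1 |x| (abs_nonneg x))
  have h : |x| * (Real.sin |x| - (|x| - |x| ^ 3 / 6 + |x| ^ 5 / 120 - |x| ^ 7 / 5040
      + |x| ^ 9 / 362880 - |x| ^ 11 / 39916800)) = |x| * Real.sin |x| - (|x| ^ 2 - |x| ^ 4 / 6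
      + |x| ^ 6 / 120 - |x| ^ 8 / 5040 + |x| ^ 10 / 362880 - |x| ^ 12 / 39916800) := by ring
  rw [h, abs_mul_sin_abs] at this
  simp only [Even.pow_abs (show Even 2 by decide),
    Even.pow_abs (show Even 4 by decide), Even.pow_abs (show Even 6 by decide),
    Even.pow_abs (show Even 8 by decide), Even.pow_abs (show Even 10 by decide),
    Even.pow_abs (show Even 12 by decide)] at this
  linarith

/-! ### The Bessel function `J₀` -/

/-- The mean of a function over the period `[0, 2π]`. -/
def mean (f : ℝ → ℝ) : ℝ := (2 * Real.pi)⁻¹ * ∫ θ in (0 : ℝ)..(2 * Real.pi), f θ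

theorem mean_mono {f g : ℝ → ℝ} (hf : Continuous f) (hg : Continuous g) (h : ∀ θ, f θ ≤ g θ) :
    mean f ≤ mean g := by
  unfold mean
  gcongr
  exact intervalIntegral.integral_mono (by positivity) (hf.intervalIntegrable _ _)
    (hg.intervalIntegrable _ _) h

theorem mean_add {f g : ℝ → ℝ} (hf : Continuous f) (hg : Continuous g) :
    mean (fun θ => f θ + g θ) = mean f + mean g := by
  unfold mean
  rw [intervalIntegral.integral_add (hf.intervalIntegrable _ _) (hg.intervalIntegrable _ _)]
  ring

theorem mean_sub {f g : ℝ → ℝ} (hf : Continuous f) (hg : Continuous g) :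
    mean (fun θ => f θ - g θ) = mean f - mean g := by
  unfold mean
  rw [intervalIntegral.integral_sub (hf.intervalIntegrable _ _) (hg.intervalIntegrable _ _)]
  ring

theorem mean_const_mul (c : ℝ) (f : ℝ → ℝ) : mean (fun θ => c * f θ) = c * mean f := by
  unfold mean
  rw [intervalIntegral.integral_const_mul]; ring

theorem mean_const (c : ℝ) : mean (fun _ => c) = c := by
  unfold mean
  rw [intervalIntegral.integral_const, smul_eq_mul]
  field_simp
  ring

theorem mean_cos_pow_add_two (n : ℕ) :
    mean (fun θ => Real.cos θ ^ (n + 2)) = (n + 1) / (n + 2) * mean (fun θ => Real.cos θ ^ n) := by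
  unfold mean
  rw [integral_cos_pow]
  simp only [Real.sin_two_pi, Real.sin_zero, mul_zero, sub_zero, zero_div, zero_add]
  ring

theorem mean_cos_pow_even : mean (fun θ => Real.cos θ ^ 2) = 1 / 2 ∧
    mean (fun θ => Real.cos θ ^ 4) = 3 / 8 ∧ mean (fun θ => Real.cos θ ^ 6) = 5 / 16 ∧
    mean (fun θ => Real.cos θ ^ 8) = 35 / 128 ∧ mean (fun θ => Real.cos θ ^ 10) = 63 / 256 ∧
    mean (fun θ => Real.cos θ ^ 12) = 231 / 1024 := by
  have h0 : mean (fun θ => Real.cos θ ^ 0) = 1 := by simpa using mean_const 1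
  have h2 := mean_cos_pow_add_two 0
  have h4 := mean_cos_pow_add_two 2
  have h6 := mean_cos_pow_add_two 4
  have h8 := mean_cos_pow_add_two 6
  have h10 := mean_cos_pow_add_two 8
  have h12 := mean_cos_pow_add_two 10
  norm_num only at h0 h2 h4 h6 h8 h10 h12
  rw [h0] at h2
  rw [h2] at h4
  rw [h4] at h6
  rw [h6] at h8
  rw [h8] at h10
  rw [h10] at h12
  norm_num at h2 h4 h6 h8 h10 h12
  exact ⟨by linarith, by linarith, by linarith, by linarith, by linarith, by linarith⟩

/-- The Bessel function of the first kind of order zero. -/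
def bessel (t : ℝ) : ℝ := mean fun θ => Real.cos (t * Real.cos θ)

/-- The Bessel function of the first kind of order one. -/
def besselOne (t : ℝ) : ℝ := mean fun θ => Real.cos θ * Real.sin (t * Real.cos θ)

/-- Averaging over θ turns Taylor polynomials in t cos θ into partial sums of the Bessel series. A
single polynomial of degree 12 serves all the bounds below, with superfluous coefficients set to 0.
-/
theorem mean_poly_cos (t a b c d f g h : ℝ) :
    mean (fun θ => a + b * (t * Real.cos θ) ^ 2 + c * (t * Real.cos θ) ^ 4
      + d * (t * Real.cos θ) ^ 6 + f * (t * Real.cos θ) ^ 8 + g * (t * Real.cos θ) ^ 10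
      + h * (t * Real.cos θ) ^ 12) =
    a + b * t ^ 2 / 2 + c * t ^ 4 * 3 / 8 + d * t ^ 6 * 5 / 16 + f * t ^ 8 * 35 / 128
      + g * t ^ 10 * 63 / 256 + h * t ^ 12 * 231 / 1024 := by
  obtain ⟨h2, h4, h6, h8, h10, h12⟩ := mean_cos_pow_even
  have e (k : ℝ) (n : ℕ) : mean (fun θ => k * (t * Real.cos θ) ^ n)
      = k * t ^ n * mean (fun θ => Real.cos θ ^ n) := by
    rw [← mean_const_mul]; congr 1; ext θ; ring
  rw [mean_add (by fun_prop) (by fun_prop), mean_add (by fun_prop) (by fun_prop),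
    mean_add (by fun_prop) (by fun_prop), mean_add (by fun_prop) (by fun_prop),
    mean_add (by fun_prop) (by fun_prop), mean_add (by fun_prop) (by fun_prop), mean_const,
    e, e, e, e, e, e, h2, h4, h6, h8, h10, h12]
  ring

theorem bessel_le_four (t : ℝ) : bessel t ≤ 1 - t ^ 2 / 4 + t ^ 4 / 64 := by
  have := mean_mono (f := fun θ => Real.cos (t * Real.cos θ)) (by fun_prop) (by fun_prop)
    (fun θ => (cos_le_taylor_four (t * Real.cos θ)).trans_eq
    (show _ = 1 + (-1/2) * (t * Real.cos θ) ^ 2 + (1/24) * (t * Real.cos θ) ^ 4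
      + 0 * (t * Real.cos θ) ^ 6 + 0 * (t * Real.cos θ) ^ 8 + 0 * (t * Real.cos θ) ^ 10
      + 0 * (t * Real.cos θ) ^ 12 by ring))
  rw [mean_poly_cos] at this
  exact this.trans_eq (by ring)

theorem bessel_le_eight (t : ℝ) :
    bessel t ≤ 1 - t ^ 2 / 4 + t ^ 4 / 64 - t ^ 6 / 2304 + t ^ 8 / 147456 := by
  have := mean_mono (f := fun θ => Real.cos (t * Real.cos θ)) (by fun_prop) (by fun_prop)
    (fun θ => (cos_le_taylor_eight (t * Real.cos θ)).trans_eq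
    (show _ = 1 + (-1/2) * (t * Real.cos θ) ^ 2 + (1/24) * (t * Real.cos θ) ^ 4
      + (-1/720) * (t * Real.cos θ) ^ 6 + (1/40320) * (t * Real.cos θ) ^ 8
      + 0 * (t * Real.cos θ) ^ 10 + 0 * (t * Real.cos θ) ^ 12 by ring))
  rw [mean_poly_cos] at this
  exact this.trans_eq (by ring)

theorem le_bessel_two (t : ℝ) : 1 - t ^ 2 / 4 ≤ bessel t := by
  have := mean_mono (g := fun θ => Real.cos (t * Real.cos θ)) (by fun_prop) (by fun_prop)
    (fun θ => (show 1 + (-1/2) * (t * Real.cos θ) ^ 2 + 0 * (t * Real.cos θ) ^ 4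
      + 0 * (t * Real.cos θ) ^ 6 + 0 * (t * Real.cos θ) ^ 8
      + 0 * (t * Real.cos θ) ^ 10 + 0 * (t * Real.cos θ) ^ 12 = 1 - (t * Real.cos θ) ^ 2 / 2
      by ring).trans_le
      (Real.one_sub_sq_div_two_le_cos (x := t * Real.cos θ)))
  rw [mean_poly_cos] at this
  exact (show _ = _ by ring).trans_le this

theorem le_bessel_ten (t : ℝ) :
    1 - t ^ 2 / 4 + t ^ 4 / 64 - t ^ 6 / 2304 + t ^ 8 / 147456 - t ^ 10 / 14745600
      ≤ bessel t := by
  have := mean_mono (g := fun θ => Real.cos (t * Real.cos θ)) (by fun_prop) (by fun_prop)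
    (fun θ => (show 1 + (-1/2) * (t * Real.cos θ) ^ 2 + (1/24) * (t * Real.cos θ) ^ 4
      + (-1/720) * (t * Real.cos θ) ^ 6 + (1/40320) * (t * Real.cos θ) ^ 8
      + (-1/3628800) * (t * Real.cos θ) ^ 10 + 0 * (t * Real.cos θ) ^ 12
      = 1 - (t * Real.cos θ) ^ 2 / 2 + (t * Real.cos θ) ^ 4 / 24 - (t * Real.cos θ) ^ 6 / 720
        + (t * Real.cos θ) ^ 8 / 40320 - (t * Real.cos θ) ^ 10 / 3628800 by ring).trans_le
      (taylor_ten_le_cos (t * Real.cos θ)))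
  rw [mean_poly_cos] at this
  exact (show _ = _ by ring).trans_le this

theorem mul_besselOne (t : ℝ) :
    t * besselOne t = mean fun θ => (t * Real.cos θ) * Real.sin (t * Real.cos θ) := by
  unfold besselOne
  rw [← mean_const_mul]; congr 1; ext θ; ring

theorem mul_besselOne_le (t : ℝ) :
    t * besselOne t ≤ t ^ 2 / 2 - t ^ 4 / 16 + t ^ 6 / 384 - t ^ 8 / 18432
      + t ^ 10 / 1474560 := by
  have := mean_mono (f := fun θ => (t * Real.cos θ) * Real.sin (t * Real.cos θ))
    (by fun_prop) (by fun_prop)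
    (fun θ => (mul_sin_le_taylor (t * Real.cos θ)).trans_eq
    (show _ = 0 + 1 * (t * Real.cos θ) ^ 2 + (-1/6) * (t * Real.cos θ) ^ 4
      + (1/120) * (t * Real.cos θ) ^ 6 + (-1/5040) * (t * Real.cos θ) ^ 8
      + (1/362880) * (t * Real.cos θ) ^ 10 + 0 * (t * Real.cos θ) ^ 12 by ring))
  rw [mean_poly_cos, ← mul_besselOne] at this
  exact this.trans_eq (by ring)

theorem le_mul_besselOne (t : ℝ) :
    t ^ 2 / 2 - t ^ 4 / 16 + t ^ 6 / 384 - t ^ 8 / 18432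
      + t ^ 10 / 1474560 - t ^ 12 / 176947200 ≤ t * besselOne t := by
  have := mean_mono (g := fun θ => (t * Real.cos θ) * Real.sin (t * Real.cos θ))
    (by fun_prop) (by fun_prop)
    (fun θ => (show 0 + 1 * (t * Real.cos θ) ^ 2 + (-1/6) * (t * Real.cos θ) ^ 4
      + (1/120) * (t * Real.cos θ) ^ 6 + (-1/5040) * (t * Real.cos θ) ^ 8
      + (1/362880) * (t * Real.cos θ) ^ 10 + (-1/39916800) * (t * Real.cos θ) ^ 12
      = (t * Real.cos θ) ^ 2 - (t * Real.cos θ) ^ 4 / 6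
      + (t * Real.cos θ) ^ 6 / 120 - (t * Real.cos θ) ^ 8 / 5040
      + (t * Real.cos θ) ^ 10 / 362880 - (t * Real.cos θ) ^ 12 / 39916800 by ring).trans_le
    (taylor_le_mul_sin (t * Real.cos θ)))
  rw [mean_poly_cos, ← mul_besselOne] at this
  exact (show _ = _ by ring).trans_le this

theorem abs_bessel_le_one (t : ℝ) : |bessel t| ≤ 1 := by
  rw [abs_le]
  constructor
  · exact (mean_const (-1)).symm.trans_le (mean_mono (by fun_prop) (by fun_prop)
      (fun θ => Real.neg_one_le_cos (t * Real.cos θ)))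
  · exact (mean_mono (by fun_prop) (by fun_prop)
      (fun θ => Real.cos_le_one (t * Real.cos θ))).trans_eq (mean_const 1)

/-! ### Differential relations and decay of `J₀` -/

theorem hasDerivAt_mean {f f' : ℝ → ℝ → ℝ} (hf : Continuous (Function.uncurry f))
    (hf' : Continuous (Function.uncurry f')) (h : ∀ t θ, HasDerivAt (fun s => f s θ) (f' t θ) t)
    (t : ℝ) : HasDerivAt (fun s => mean (f s)) (mean (f' t)) t := by
  unfold mean
  refine HasDerivAt.const_mul _ ?_
  obtain ⟨M, hM⟩ := ((isCompact_closedBall t 1).prod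
    (isCompact_uIcc (a := (0 : ℝ)) (b := 2 * Real.pi))).exists_bound_of_continuousOn hf'.continuousOn
  refine (intervalIntegral.hasDerivAt_integral_of_dominated_loc_of_deriv_le
    (bound := fun _ => M) (Metric.closedBall_mem_nhds t one_pos)
    (.of_forall fun s => ?_) ?_ ?_ (.of_forall fun θ hθ s hs => ?_) ?_
    (.of_forall fun θ _ s _ => h s θ)).2
  · exact (hf.comp (by fun_prop : Continuous fun θ => (s, θ))).aestronglyMeasurable
  · exact (hf.comp (by fun_prop : Continuous fun θ => (t, θ))).intervalIntegrable _ _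
  · exact (hf'.comp (by fun_prop : Continuous fun θ => (t, θ))).aestronglyMeasurable
  · exact hM (s, θ) ⟨hs, Set.uIoc_subset_uIcc hθ⟩
  · exact intervalIntegrable_const

theorem hasDerivAt_bessel (t : ℝ) : HasDerivAt bessel (-besselOne t) t := by
  have := hasDerivAt_mean (f := fun t θ => Real.cos (t * Real.cos θ))
    (f' := fun t θ => (-1) * (Real.cos θ * Real.sin (t * Real.cos θ))) (by fun_prop) (by fun_prop)
    (fun t θ => by
      refine ((Real.hasDerivAt_cos _).comp t ((hasDerivAt_id t).mul_const _)).congr_deriv ?_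
      simp; ring) t
  rw [mean_const_mul] at this
  exact this.congr_deriv (by rw [besselOne]; ring)

theorem continuous_bessel : Continuous bessel :=
  continuous_iff_continuousAt.2 fun t => (hasDerivAt_bessel t).continuousAt

/-- Differentiation under the integral gives the mean of cos²θ cos(t cos θ). The function sin θ
sin(t cos θ) is periodic, so its θ-derivative has mean 0; this identifies J₁(t)/t with the mean of
sin²θ cos(t cos θ), and cos² = 1 − sin² finishes. -/
theorem hasDerivAt_besselOne {t : ℝ} (ht : t ≠ 0) :
    HasDerivAt besselOne (bessel t - besselOne t / t) t := by
  have := hasDerivAt_mean (f := fun t θ => Real.cos θ * Real.sin (t * Real.cos θ))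
    (f' := fun t θ => Real.cos θ ^ 2 * Real.cos (t * Real.cos θ)) (by fun_prop) (by fun_prop)
    (fun t θ => by
      refine (((Real.hasDerivAt_sin _).comp t ((hasDerivAt_id t).mul_const _)).const_mul
        (Real.cos θ)).congr_deriv ?_
      simp; ring) t
  refine this.congr_deriv ?_
  have hI : mean (fun θ => Real.cos θ * Real.sin (t * Real.cos θ)
      - t * (Real.sin θ ^ 2 * Real.cos (t * Real.cos θ))) = 0 := by
    unfold mean
    rw [intervalIntegral.integral_eq_sub_of_hasDerivAt
      (f := fun θ => Real.sin θ * Real.sin (t * Real.cos θ))]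
    · simp
    · intro θ _
      refine ((Real.hasDerivAt_sin θ).mul ((Real.hasDerivAt_sin _).comp θ
        ((Real.hasDerivAt_cos θ).const_mul t))).congr_deriv ?_
      simp; ring
    · exact Continuous.intervalIntegrable (by fun_prop) _ _
  rw [mean_sub (by fun_prop) (by fun_prop), mean_const_mul] at hI
  have hs : mean (fun θ => Real.sin θ ^ 2 * Real.cos (t * Real.cos θ))
      = bessel t - mean (fun θ => Real.cos θ ^ 2 * Real.cos (t * Real.cos θ)) := by
    unfold bessel
    rw [← mean_sub (by fun_prop) (by fun_prop)]
    congr 1; ext θ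
    rw [Real.sin_sq]; ring
  rw [hs] at hI
  have hI' : besselOne t - t * (bessel t - mean (fun θ => Real.cos θ ^ 2
    * Real.cos (t * Real.cos θ))) = 0 := hI
  rw [eq_sub_iff_add_eq, ← eq_sub_iff_add_eq', div_eq_iff ht]
  linarith

/-- The system J₀' = −J₁, J₁' = J₀ − J₁/t makes the derivative of the energy equal to −2J₁²/t.
Values at a single point then control |J₀| on the whole half-line to its right. -/
theorem antitoneOn_bessel_energy :
    AntitoneOn (fun t => bessel t ^ 2 + besselOne t ^ 2) (Set.Ioi 0) := by
  have hd : ∀ t ∈ Set.Ioi (0 : ℝ), HasDerivAt (fun t => bessel t ^ 2 + besselOne t ^ 2)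
      (-2 * besselOne t ^ 2 / t) t := fun t ht => by
    have ht' : t ≠ 0 := (Set.mem_Ioi.1 ht).ne'
    refine (((hasDerivAt_bessel t).pow 2).add ((hasDerivAt_besselOne ht').pow 2)).congr_deriv ?_
    field_simp
    ring
  refine antitoneOn_of_deriv_nonpos (convex_Ioi 0)
    (fun t ht => (hd t ht).continuousAt.continuousWithinAt)
    (fun t ht => (hd t (interior_subset ht)).differentiableAt.differentiableWithinAt)
    fun t ht => ?_
  have ht' := interior_subset ht
  rw [(hd t ht').deriv]
  have : 0 < t := ht'
  rw [neg_mul, neg_div]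
  have : 0 ≤ 2 * besselOne t ^ 2 / t := by positivity
  linarith

/-- The constant 0.415 lies just below exp(-(15/8)²/4), the value of the Gaussian at the cutoff
15/8. Up to 7/2 the Bessel partial sums in y = t²/4 are accurate enough; beyond that point the
energy takes over. -/
theorem abs_bessel_le_of_ge {t : ℝ} (ht : 15 / 8 ≤ t) : |bessel t| ≤ 415 / 1000 := by
  rcases le_total t (7 / 2) with h | h
  · have hu := bessel_le_eight t
    have hl := le_bessel_ten t
    set y := t ^ 2 / 4 with hy
    have hy1 : 87 / 100 ≤ y := by rw [hy]; nlinarith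
    have hy2 : y ≤ 49 / 16 := by rw [hy]; nlinarith
    have hu' : bessel t ≤ 1 - y + y ^ 2 / 4 - y ^ 3 / 36 + y ^ 4 / 576 :=
      hu.trans_eq (by rw [hy]; ring)
    have hl' : 1 - y + y ^ 2 / 4 - y ^ 3 / 36 + y ^ 4 / 576 - y ^ 5 / 14400 ≤ bessel t :=
      (show _ = _ by rw [hy]; ring).trans_le hl
    rw [abs_le]
    constructor
    · nlinarith [mul_nonneg (sub_nonneg.2 hy1) (sub_nonneg.2 hy2), sq_nonneg (y * (y - 3)),
        mul_nonneg (mul_nonneg (sub_nonneg.2 hy1) (sub_nonneg.2 hy2)) (sq_nonneg y),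
        mul_nonneg (sub_nonneg.2 hy2) (sq_nonneg (y - 3)), sq_nonneg (y - 3),
        mul_nonneg (sub_nonneg.2 hy2) (sq_nonneg (y * (y - 3)))]
    · nlinarith [mul_nonneg (sub_nonneg.2 hy1) (sub_nonneg.2 hy2), sq_nonneg (y * (y - 3)),
        mul_nonneg (mul_nonneg (sub_nonneg.2 hy1) (sub_nonneg.2 hy2)) (sq_nonneg y),
        mul_nonneg (sub_nonneg.2 hy1) (sq_nonneg (y - 3)), sq_nonneg (y - 3)]
  -- At 7/2 the energy is at most 0.382² + 0.143², which is below 0.415².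
  · have hE := antitoneOn_bessel_energy (show (7 / 2 : ℝ) ∈ Set.Ioi 0 by norm_num)
      (show t ∈ Set.Ioi (0 : ℝ) by simp; linarith) h
    have hu := bessel_le_eight (7 / 2)
    have hl := le_bessel_ten (7 / 2)
    have hu1 := mul_besselOne_le (7 / 2)
    have hl1 := le_mul_besselOne (7 / 2)
    norm_num at hu hl hu1 hl1
    simp only at hE
    have b0 : bessel (7 / 2) ^ 2 ≤ (382 / 1000) ^ 2 := sq_le_sq' (by linarith) (by linarith)
    have b1 : besselOne (7 / 2) ^ 2 ≤ (143 / 1000) ^ 2 := sq_le_sq' (by linarith) (by linarith)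
    refine abs_le_of_sq_le_sq ?_ (by norm_num)
    nlinarith [sq_nonneg (besselOne t)]

end

section

open AddCircle

/-! ### Means over the unit circle -/

/-- The point of the unit circle with a given angle. -/
def pt (x : UnitAddCircle) : ℂ := fourier 1 x

@[fun_prop]
theorem continuous_pt : Continuous pt := (fourier 1).continuous

@[simp]
theorem norm_pt (x : UnitAddCircle) : ‖pt x‖ = 1 := by
  rw [pt, fourier_apply]; exact Circle.norm_coe _

theorem pt_add (x y : UnitAddCircle) : pt (x + y) = pt x * pt y := by
  simp [pt, fourier_apply, AddCircle.toCircle_add]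

theorem pt_coe (θ : ℝ) : pt (θ : UnitAddCircle) = Complex.exp (2 * Real.pi * θ * Complex.I) := by
  rw [pt, fourier_coe_apply]; congr 1; simp; ring

theorem exists_pt_eq {c : ℂ} (hc : ‖c‖ = 1) : ∃ s, pt s = c := by
  refine ⟨((Complex.arg c / (2 * Real.pi) : ℝ) : UnitAddCircle), ?_⟩
  rw [pt_coe]
  conv_rhs => rw [← Complex.norm_mul_exp_arg_mul_I c, hc]
  push_cast
  rw [one_mul]; congr 1
  field_simp

variable {E : Type*} [NormedAddCommGroup E] [NormedSpace ℝ E]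

/-- The mean of a function over the unit circle. -/
def circ (f : ℂ → E) : E := ∫ x, f (pt x) ∂haarAddCircle

theorem circ_mul_left {c : ℂ} (hc : ‖c‖ = 1) (f : ℂ → E) : circ (fun z => f (c * z)) = circ f := by
  obtain ⟨s, rfl⟩ := exists_pt_eq hc
  unfold circ
  simp_rw [← pt_add]
  exact integral_add_left_eq_self (fun x => f (pt x)) s

theorem circ_eq_interval (f : ℂ → E) :
    circ f = (2 * Real.pi)⁻¹ • ∫ θ in (0 : ℝ)..(2 * Real.pi), f (Complex.exp (θ * Complex.I)) := by
  unfold circ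
  rw [AddCircle.integral_haarAddCircle, ← AddCircle.intervalIntegral_preimage 1 0]
  simp only [pt_coe, inv_one, one_smul, zero_add]
  have := intervalIntegral.integral_comp_mul_left
    (fun θ : ℝ => f (Complex.exp (θ * Complex.I))) (a := 0) (b := 1)
    (c := 2 * Real.pi) (by positivity)
  simp only [mul_zero, mul_one] at this
  rw [← this]
  congr 1; ext θ
  push_cast
  rfl

theorem circ_eq_circleAverage (f : ℂ → E) : circ f = Real.circleAverage f 0 1 := by
  rw [circ_eq_interval, Real.circleAverage]
  congr 2
  simp [circleMap]

theorem integrable_comp_pt {F : Type*} [NormedAddCommGroup F] {f : ℂ → F} (hf : Continuous f) :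
    Integrable (fun x => f (pt x)) haarAddCircle :=
  (hf.comp continuous_pt).integrable_of_hasCompactSupport (HasCompactSupport.of_compactSpace _)

theorem circ_eq_mean {f : ℂ → ℝ} :
    circ f = mean fun θ => f (Complex.exp (θ * Complex.I)) := by
  rw [circ_eq_interval]; rfl

theorem exists_norm_one_mul (w : ℂ) : ∃ c : ℂ, ‖c‖ = 1 ∧ w = c * ‖w‖ := by
  rcases eq_or_ne w 0 with rfl | hw
  · exact ⟨1, by simp, by simp⟩
  · have : (‖w‖ : ℂ) ≠ 0 := by simpa using hw
    exact ⟨w / ‖w‖, by simp [hw], by field_simp⟩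

theorem circ_cos_re (w : ℂ) : circ (fun z => Real.cos (w * z).re) = bessel ‖w‖ := by
  obtain ⟨c, hc, h⟩ := exists_norm_one_mul w
  have h1 : circ (fun z => Real.cos (w * z).re)
      = circ (fun z => (fun z => Real.cos ((‖w‖ : ℂ) * z).re) (c * z)) := by
    congr 1; ext z; beta_reduce; conv_lhs => rw [h]
    ring_nf
  rw [h1, circ_mul_left hc (fun z => Real.cos ((‖w‖ : ℂ) * z).re), circ_eq_mean]
  unfold bessel
  congr 1; ext θ
  rw [Complex.re_ofReal_mul, Complex.exp_ofReal_mul_I_re]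

/-- The rotation z ↦ −z replaces the exponential by its conjugate, so only the mean of the cosine
survives. -/
theorem circ_exp_re (w : ℂ) :
    circ (fun z => Complex.exp ((w * z).re * Complex.I)) = bessel ‖w‖ := by
  have h1 := circ_mul_left (c := -1) (by simp) (fun z => Complex.exp ((w * z).re * Complex.I))
  have h2 : circ (fun z => Complex.exp ((w * z).re * Complex.I))
      + circ (fun z => Complex.exp ((w * z).re * Complex.I)) = 2 * bessel ‖w‖ := by
    conv_lhs => enter [2]; rw [← h1]
    rw [← circ_cos_re]
    unfold circ
    rw [← integral_add, ← integral_complex_ofReal, ← integral_const_mul]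
    · congr 1; ext x
      push_cast
      rw [Complex.two_cos]
      simp only [mul_neg, neg_mul, one_mul, Complex.neg_re]
      push_cast
      ring_nf
    · exact integrable_comp_pt (f := fun z => Complex.exp ((w * z).re * Complex.I)) (by fun_prop)
    · exact integrable_comp_pt
        (f := fun z => Complex.exp ((w * (-1 * z)).re * Complex.I)) (by fun_prop)
  linear_combination h2 / 2

/-! ### Integration over a single coordinate of the polytorus -/

theorem integrable_of_continuous {F : Type*} [NormedAddCommGroup F] {f : InfTorus → F} (hf : Continuous f) : Integrable f haar :=
  hf.integrable_of_hasCompactSupport (HasCompactSupport.of_compactSpace _)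

theorem measurePreserving_add_left (y : InfTorus) :
    MeasurePreserving (fun x => y + x) haar haar := by
  refine ⟨by fun_prop, ?_⟩
  unfold haar
  have := Measure.infinitePi_map_pi (μ := fun _ : ℕ => (haarAddCircle : Measure UnitAddCircle))
    (f := fun i x => y i + x) (fun i => by fun_prop)
  simp only [map_add_left_eq_self] at this
  exact this

theorem integral_add_left (y : InfTorus) (F : InfTorus → E) :
    ∫ x, F (y + x) ∂haar = ∫ x, F x ∂haar := by
  have hm : MeasurableEmbedding (fun x : InfTorus => y + x) := measurableEmbedding_addLeft y
  exact (measurePreserving_add_left y).integral_comp hm F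

/-- Translating one coordinate preserves the measure; averaging over the translation plays the role
of Fubini's theorem in that coordinate, with no need to split the infinite product. -/
theorem integral_coord [CompleteSpace E] (j : ℕ) {F : InfTorus → E} (hF : Continuous F) :
    ∫ x, F x ∂haar = ∫ x, ∫ t, F (x + Pi.single j t) ∂haarAddCircle ∂haar := by
  have hc : Continuous fun p : InfTorus × UnitAddCircle => F (p.1 + Pi.single j p.2) :=
    hF.comp (continuous_fst.add ((continuous_single j).comp continuous_snd))
  rw [integral_integral_swap]
  · simp_rw [add_comm _ (Pi.single j _), integral_add_left]
    simp
  · exact hc.integrable_of_hasCompactSupport (HasCompactSupport.of_compactSpace _)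

/-- The linear polynomial `∑_{j ∈ s} a_j z_j`. -/
def lin (a : ℕ → ℂ) (s : Finset ℕ) (x : InfTorus) : ℂ := ∑ j ∈ s, a j * pt (x j)

@[fun_prop]
theorem continuous_lin (a : ℕ → ℂ) (s : Finset ℕ) : Continuous (lin a s) := by
  unfold lin; fun_prop

theorem lin_add_single (a : ℕ → ℂ) (s : Finset ℕ) {j : ℕ} (hj : j ∉ s) (x : InfTorus)
    (t : UnitAddCircle) : lin a s (x + Pi.single j t) = lin a s x := by
  refine Finset.sum_congr rfl fun i hi => ?_
  have : i ≠ j := fun h => hj (h ▸ hi)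
  simp [this]

theorem lin_insert (a : ℕ → ℂ) {s : Finset ℕ} {j : ℕ} (hj : j ∉ s) (x : InfTorus) :
    lin a (insert j s) x = lin a s x + a j * pt (x j) := by
  rw [lin, Finset.sum_insert hj, add_comm, lin]

theorem lin_mul_left (c : ℂ) (a : ℕ → ℂ) (s : Finset ℕ) (x : InfTorus) :
    lin (fun j => c * a j) s x = c * lin a s x := by
  simp [lin, Finset.mul_sum, mul_assoc]

/-- Conditioning a function of `∑_{i ∈ s} a_i z_i + a_j z_j` on the variables in `s`. -/
theorem integral_lin_insert [CompleteSpace E] (a : ℕ → ℂ) {s : Finset ℕ} {j : ℕ} (hj : j ∉ s)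
    {f : ℂ → E} (hf : Continuous f) :
    ∫ x, f (lin a (insert j s) x) ∂haar
      = ∫ x, circ (fun z => f (lin a s x + a j * z)) ∂haar := by
  rw [integral_coord j (by fun_prop)]
  congr 1; ext x
  rw [← circ_mul_left (norm_pt (x j)) (fun z => f (lin a s x + a j * z))]
  unfold circ
  congr 1; ext t
  simp only [lin_insert a hj, lin_add_single a s hj, Pi.add_apply, Pi.single_eq_same, pt_add]

/-- Independence of the coordinates, in the form of conditioning on all but one of them: each
coordinate contributes one factor J₀. -/
theorem integral_exp_lin (a : ℕ → ℂ) (s : Finset ℕ) :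
    ∫ x, Complex.exp ((lin a s x).re * Complex.I) ∂haar = ∏ j ∈ s, (bessel ‖a j‖ : ℂ) := by
  induction s using Finset.induction_on with
  | empty => simp [lin]
  | insert j s hj ih =>
    rw [integral_lin_insert a hj (f := fun w => Complex.exp (w.re * Complex.I)) (by fun_prop),
      Finset.prod_insert hj, ← ih, ← integral_const_mul]
    congr 1; ext x
    rw [← circ_exp_re, circ, circ, ← integral_mul_const]
    congr 1; ext t
    rw [← Complex.exp_add]
    congr 1
    simp only [Complex.add_re, Complex.ofReal_add]; ring

/-- The product of Bessel functions that is the characteristic function of `∑ a_j z_j`. -/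
def besselProd (a : ℕ → ℂ) (s : Finset ℕ) (t : ℝ) : ℝ := ∏ j ∈ s, bessel (‖a j‖ * t)

theorem continuous_besselProd (a : ℕ → ℂ) (s : Finset ℕ) : Continuous (besselProd a s) :=
  continuous_finsetProd _ fun j _ => continuous_bessel.comp (by fun_prop)

theorem integral_exp_lin_mul (a : ℕ → ℂ) (s : Finset ℕ) (w : ℂ) :
    ∫ x, Complex.exp ((w * lin a s x).re * Complex.I) ∂haar = besselProd a s ‖w‖ := by
  simp_rw [← lin_mul_left]
  rw [integral_exp_lin]
  simp [besselProd, mul_comm]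

/-- J₀(t|w|) is the mean of exp(i Re(t z w)) over |z| = 1. After the order of integration is
exchanged, every z gives the same product, since |tz| = t. -/
theorem integral_bessel_norm_lin (a : ℕ → ℂ) (s : Finset ℕ) {t : ℝ} (ht : 0 ≤ t) :
    ∫ x, bessel (t * ‖lin a s x‖) ∂haar = besselProd a s t := by
  have h1 : ∀ x, (bessel (t * ‖lin a s x‖) : ℂ)
      = ∫ y, Complex.exp ((t * pt y * lin a s x).re * Complex.I) ∂haarAddCircle := fun x => by
    have := circ_exp_re (t * lin a s x)
    rw [norm_mul, Complex.norm_real, Real.norm_of_nonneg ht] at this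
    rw [← this, circ]
    congr 1; ext y; ring_nf
  have : ((∫ x, bessel (t * ‖lin a s x‖) ∂haar : ℝ) : ℂ) = besselProd a s t := by
    rw [← integral_complex_ofReal]
    simp_rw [h1]
    rw [integral_integral_swap]
    · simp_rw [integral_exp_lin_mul]
      simp [abs_of_nonneg ht]
    · refine Continuous.integrable_of_hasCompactSupport (f := Function.uncurry fun x y =>
        Complex.exp ((t * pt y * lin a s x).re * Complex.I)) ?_ (HasCompactSupport.of_compactSpace _)
      fun_prop
  exact_mod_cast this

end

section

open AddCircle

/-! ### Moments as integrals against a kernel -/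

theorem integrableOn_Ioi_mul_rpow {k : ℝ → ℝ} (hk : Measurable k) {α β p C : ℝ}
    (hα : p < α) (hβ : β < p) (h0 : ∀ t, 0 < t → t ≤ 1 → |k t| ≤ C * t ^ α)
    (h1 : ∀ t, 1 ≤ t → |k t| ≤ C * t ^ β) :
    IntegrableOn (fun t => k t * t ^ (-1 - p)) (Set.Ioi 0) := by
  rw [← Set.Ioc_union_Ioi_eq_Ioi (zero_le_one' ℝ)]
  refine IntegrableOn.union ?_ ?_
  · have hi : IntegrableOn (fun t : ℝ => C * t ^ (α - 1 - p)) (Set.Ioc 0 1) := by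
      rw [integrableOn_Ioc_iff_integrableOn_Ioo]
      exact ((intervalIntegral.integrableOn_Ioo_rpow_iff one_pos).2 (by linarith)).const_mul C
    refine hi.mono' (by fun_prop) ((ae_restrict_mem measurableSet_Ioc).mono fun t ht => ?_)
    rw [norm_mul, Real.norm_eq_abs, Real.norm_of_nonneg (Real.rpow_nonneg ht.1.le _)]
    calc _ ≤ C * t ^ α * t ^ (-1 - p) :=
          mul_le_mul_of_nonneg_right (h0 t ht.1 ht.2) (Real.rpow_nonneg ht.1.le _)
      _ = _ := by rw [mul_assoc, ← Real.rpow_add ht.1]; ring_nf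
  · have hi : IntegrableOn (fun t : ℝ => C * t ^ (β - 1 - p)) (Set.Ioi 1) :=
      (integrableOn_Ioi_rpow_of_lt (by linarith) one_pos).const_mul C
    refine hi.mono' (by fun_prop) ((ae_restrict_mem measurableSet_Ioi).mono fun t ht => ?_)
    have ht0 : (0 : ℝ) < t := zero_lt_one.trans ht
    rw [norm_mul, Real.norm_eq_abs, Real.norm_of_nonneg (Real.rpow_nonneg ht0.le _)]
    calc _ ≤ C * t ^ β * t ^ (-1 - p) :=
          mul_le_mul_of_nonneg_right (h1 t (Set.mem_Ioi.1 ht).le) (Real.rpow_nonneg ht0.le _)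
      _ = _ := by rw [mul_assoc, ← Real.rpow_add ht0]; ring_nf

theorem integral_kernel_scale {k : ℝ → ℝ} (hk0 : k 0 = 0) {p : ℝ} (hp : 0 < p) {r : ℝ}
    (hr : 0 ≤ r) : ∫ t in Set.Ioi (0 : ℝ), k (t * r) * t ^ (-1 - p)
      = (∫ t in Set.Ioi (0 : ℝ), k t * t ^ (-1 - p)) * r ^ p := by
  rcases hr.eq_or_lt with rfl | hr
  · simp [hk0, Real.zero_rpow hp.ne']
  · have h := integral_comp_mul_right_Ioi (fun t => k t * t ^ (-1 - p)) 0 hr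
    rw [zero_mul, smul_eq_mul] at h
    rw [eq_comm, inv_mul_eq_iff_eq_mul₀ hr.ne'] at h
    rw [h, mul_comm r, mul_assoc, ← Real.rpow_one_add' hr.le (by linarith), ← integral_mul_const]
    refine setIntegral_congr_fun measurableSet_Ioi fun t ht => ?_
    have ht : 0 < t := ht
    rw [Real.mul_rpow ht.le hr.le, mul_assoc, mul_assoc, ← Real.rpow_add hr]
    simp

theorem integrableOn_kernel_scale {k : ℝ → ℝ} (hk0 : k 0 = 0) {p : ℝ}
    (hk : IntegrableOn (fun t => k t * t ^ (-1 - p)) (Set.Ioi 0)) {r : ℝ}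
    (hr : 0 ≤ r) : IntegrableOn (fun t => k (t * r) * t ^ (-1 - p)) (Set.Ioi 0) := by
  rcases hr.eq_or_lt with rfl | hr
  · simp [hk0]
  · have h := (integrableOn_Ioi_comp_mul_right_iff (fun t => k t * t ^ (-1 - p)) 0 hr).2
      (by simpa using hk)
    have h2 : IntegrableOn (fun t => k (t * r) * (t * r) ^ (-1 - p) * r ^ (1 + p)) (Set.Ioi 0) :=
      h.mul_const _
    refine h2.congr_fun (fun t ht => ?_) measurableSet_Ioi
    have ht : 0 < t := ht
    simp only
    rw [Real.mul_rpow ht.le hr.le, mul_assoc, mul_assoc, ← Real.rpow_add hr]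
    simp

/-- Tonelli's theorem and the substitution u = t R(ω) pull out the factor R(ω)^p. Moments of R are
thus encoded in the transform κ alone, which is explicit both for Steinhaus sums (a product of
Bessel functions) and for the Gaussian. -/
theorem kernel_moment {Ω : Type*} [MeasurableSpace Ω] {μ : Measure Ω} [SFinite μ] {R : Ω → ℝ}
    (hR : Measurable R) (hR0 : ∀ ω, 0 ≤ R ω) {k κ : ℝ → ℝ} (hkm : Measurable k)
    (hkn : ∀ t, 0 ≤ t → 0 ≤ k t) (hk0 : k 0 = 0) {p : ℝ} (hp : 0 < p)
    (hk : IntegrableOn (fun t => k t * t ^ (-1 - p)) (Set.Ioi 0)) (hκm : Measurable κ)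
    (hint : ∀ t, 0 < t → Integrable (fun ω => k (t * R ω)) μ)
    (hκ : ∀ t, 0 < t → ∫ ω, k (t * R ω) ∂μ = κ t) (hRp : Integrable (fun ω => R ω ^ p) μ) :
    IntegrableOn (fun t => κ t * t ^ (-1 - p)) (Set.Ioi 0) ∧
    ∫ t in Set.Ioi (0 : ℝ), κ t * t ^ (-1 - p)
      = (∫ t in Set.Ioi (0 : ℝ), k t * t ^ (-1 - p)) * ∫ ω, R ω ^ p ∂μ := by
  set K := ∫ t in Set.Ioi (0 : ℝ), k t * t ^ (-1 - p) with hK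
  have hK0 : 0 ≤ K := setIntegral_nonneg measurableSet_Ioi fun t ht =>
    mul_nonneg (hkn t (Set.mem_Ioi.1 ht).le) (Real.rpow_nonneg (Set.mem_Ioi.1 ht).le _)
  have hκ0 : ∀ t ∈ Set.Ioi (0 : ℝ), 0 ≤ κ t * t ^ (-1 - p) := fun t ht => by
    rw [← hκ t ht]
    exact mul_nonneg (integral_nonneg fun ω => hkn _ (mul_nonneg (Set.mem_Ioi.1 ht).le (hR0 ω)))
      (Real.rpow_nonneg (Set.mem_Ioi.1 ht).le _)
  -- The computation is made with extended nonnegative integrals; the finite value at the end also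
  -- yields the integrability of κ(t) t^{-1-p}.
  have hL : ∫⁻ t in Set.Ioi (0 : ℝ), ENNReal.ofReal (κ t * t ^ (-1 - p))
      = ENNReal.ofReal (K * ∫ ω, R ω ^ p ∂μ) := by
    calc _ = ∫⁻ t in Set.Ioi (0 : ℝ), ∫⁻ ω, ENNReal.ofReal (k (t * R ω) * t ^ (-1 - p)) ∂μ := by
          refine setLIntegral_congr_fun measurableSet_Ioi fun t ht => ?_
          have ht : 0 < t := ht
          rw [← ofReal_integral_eq_lintegral_ofReal ((hint t ht).mul_const _)
            (.of_forall fun ω => mul_nonneg (hkn _ (mul_nonneg ht.le (hR0 ω)))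
              (Real.rpow_nonneg ht.le _)), integral_mul_const, hκ t ht]
      _ = ∫⁻ ω, (∫⁻ t in Set.Ioi (0 : ℝ), ENNReal.ofReal (k (t * R ω) * t ^ (-1 - p))) ∂μ := by
          rw [lintegral_lintegral_swap]
          refine (Measurable.ennreal_ofReal ?_).aemeasurable
          exact (hkm.comp (measurable_fst.mul (hR.comp measurable_snd))).mul
            (measurable_fst.pow_const _)
      _ = ∫⁻ ω, ENNReal.ofReal (K * R ω ^ p) ∂μ := by
          refine lintegral_congr fun ω => ?_
          rw [← ofReal_integral_eq_lintegral_ofReal (integrableOn_kernel_scale hk0 hk (hR0 ω))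
            ((ae_restrict_mem measurableSet_Ioi).mono fun t ht =>
              mul_nonneg (hkn _ (mul_nonneg (Set.mem_Ioi.1 ht).le (hR0 ω)))
              (Real.rpow_nonneg (Set.mem_Ioi.1 ht).le _)), integral_kernel_scale hk0 hp (hR0 ω)]
      _ = _ := by
          rw [← ofReal_integral_eq_lintegral_ofReal (hRp.const_mul K)
            (.of_forall fun ω => mul_nonneg hK0 (Real.rpow_nonneg (hR0 ω) _)), integral_const_mul]
  have hm : AEStronglyMeasurable (fun t => κ t * t ^ (-1 - p))
      (volume.restrict (Set.Ioi (0 : ℝ))) := by fun_prop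
  have hae : 0 ≤ᵐ[volume.restrict (Set.Ioi (0 : ℝ))] fun t => κ t * t ^ (-1 - p) :=
    (ae_restrict_mem measurableSet_Ioi).mono hκ0
  refine ⟨⟨hm, ?_⟩, ?_⟩
  · rw [hasFiniteIntegral_iff_ofReal hae, hL]
    exact ENNReal.ofReal_lt_top
  · rw [integral_eq_lintegral_of_nonneg_ae hae hm, hL, ENNReal.toReal_ofReal]
    exact mul_nonneg hK0 (integral_nonneg fun ω => Real.rpow_nonneg (hR0 ω) _)

theorem bessel_zero : bessel 0 = 1 := by simp [bessel, mean_const]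

theorem measurable_bessel : Measurable bessel := continuous_bessel.measurable

/-- The constant `∫ (1 - J₀(t)) t^{-1-p} dt`. -/
def kernelConst (p : ℝ) : ℝ := ∫ t in Set.Ioi (0 : ℝ), (1 - bessel t) * t ^ (-1 - p)

/-- The constant `∫ (J₀(t) - 1 + t²/4) t^{-1-p} dt`. -/
def kernelConst' (p : ℝ) : ℝ := ∫ t in Set.Ioi (0 : ℝ), (bessel t - 1 + t ^ 2 / 4) * t ^ (-1 - p)

theorem integrableOn_kernel {p : ℝ} (hp : 0 < p) (hp2 : p < 2) :
    IntegrableOn (fun t => (1 - bessel t) * t ^ (-1 - p)) (Set.Ioi 0) := by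
  refine integrableOn_Ioi_mul_rpow (α := 2) (β := 0) (C := 2) (by have := measurable_bessel; fun_prop) hp2 hp
    (fun t h0 h1 => ?_) fun t h1 => ?_
  · have := le_bessel_two t
    have h := abs_le.1 (abs_bessel_le_one t)
    rw [abs_of_nonneg (by linarith), Real.rpow_two]
    nlinarith
  · have h := abs_le.1 (abs_bessel_le_one t)
    rw [abs_of_nonneg (by linarith), Real.rpow_zero]
    linarith

/-- The kernel 1 − J₀ is O(t²) at 0 and bounded, hence usable for 0 < p < 2. Removing the quadratic
term as well gives a kernel that is O(t⁴) at 0 and O(t²) at infinity, hence usable for 2 < p < 4. -/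
theorem integrableOn_kernel' {p : ℝ} (hp : 2 < p) (hp4 : p < 4) :
    IntegrableOn (fun t => (bessel t - 1 + t ^ 2 / 4) * t ^ (-1 - p)) (Set.Ioi 0) := by
  refine integrableOn_Ioi_mul_rpow (α := 4) (β := 2) (C := 2) (by have := measurable_bessel; fun_prop) hp4 hp
    (fun t h0 h1 => ?_) fun t h1 => ?_
  · have h2 := le_bessel_two t
    have h4 := bessel_le_four t
    rw [abs_of_nonneg (by linarith)]
    have : t ^ (4 : ℝ) = t ^ 4 := by exact_mod_cast Real.rpow_natCast t 4
    rw [this]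
    nlinarith [pow_nonneg h0.le 4]
  · have h2 := le_bessel_two t
    have h := abs_le.1 (abs_bessel_le_one t)
    rw [abs_of_nonneg (by linarith), Real.rpow_two]
    nlinarith

theorem integral_pos_of_pos_Ioo {f : ℝ → ℝ} (hf : IntegrableOn f (Set.Ioi 0))
    (h0 : ∀ t, 0 < t → 0 ≤ f t) (h1 : ∀ t, 0 < t → t < 1 → 0 < f t) :
    0 < ∫ t in Set.Ioi (0 : ℝ), f t := by
  rw [setIntegral_pos_iff_support_of_nonneg_ae ((ae_restrict_mem measurableSet_Ioi).mono h0) hf]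
  refine lt_of_lt_of_le ?_ (measure_mono (show Set.Ioo (0 : ℝ) 1 ⊆ _ from fun t ht =>
    ⟨(h1 t ht.1 ht.2).ne', ht.1⟩))
  simp

theorem kernelConst_pos {p : ℝ} (hp : 0 < p) (hp2 : p < 2) : 0 < kernelConst p := by
  refine integral_pos_of_pos_Ioo (integrableOn_kernel hp hp2) (fun t ht => ?_) fun t ht ht1 => ?_
  · have h := abs_le.1 (abs_bessel_le_one t)
    exact mul_nonneg (by linarith) (Real.rpow_nonneg ht.le _)
  · have h := bessel_le_four t
    exact mul_pos (by nlinarith [pow_pos ht 2, pow_lt_one₀ ht.le ht1 two_ne_zero]) (Real.rpow_pos_of_pos ht _)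

theorem kernelConst'_pos {p : ℝ} (hp : 2 < p) (hp4 : p < 4) : 0 < kernelConst' p := by
  refine integral_pos_of_pos_Ioo (integrableOn_kernel' hp hp4) (fun t ht => ?_) fun t ht ht1 => ?_
  · have h := le_bessel_two t
    exact mul_nonneg (by linarith) (Real.rpow_nonneg ht.le _)
  · have h := le_bessel_ten t
    refine mul_pos ?_ (Real.rpow_pos_of_pos ht _)
    have h2 : t ^ 2 < 1 := by nlinarith
    have h6 : t ^ 6 ≤ t ^ 4 := by nlinarith [pow_pos ht 4]
    have h10 : t ^ 10 ≤ t ^ 8 := by nlinarith [pow_pos ht 8]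
    nlinarith [pow_pos ht 4, pow_pos ht 8]

/-! ### The complex Gaussian measure -/

/-- The standard complex Gaussian measure, with density `exp (-|w|²) / π`. -/
def gauss : Measure ℂ :=
  volume.withDensity fun w => ENNReal.ofReal (Real.pi⁻¹ * Real.exp (-‖w‖ ^ 2))

theorem integral_gauss {E : Type*} [NormedAddCommGroup E] [NormedSpace ℝ E] (f : ℂ → E) :
    ∫ w, f w ∂gauss = Real.pi⁻¹ • ∫ w, Real.exp (-‖w‖ ^ 2) • f w := by
  rw [gauss, integral_withDensity_eq_integral_toReal_smul (by fun_prop)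
    (.of_forall fun _ => ENNReal.ofReal_lt_top), ← integral_smul]
  congr 1; ext w
  rw [ENNReal.toReal_ofReal (by positivity), smul_smul]

theorem integral_norm_rpow_gauss {p : ℝ} (hp : 0 ≤ p) :
    ∫ w, ‖w‖ ^ p ∂gauss = Real.Gamma (1 + p / 2) := by
  have h := Complex.integral_rpow_mul_exp_neg_rpow (p := 2) (q := p) (by norm_num) (by linarith)
  simp only [Real.rpow_two] at h
  rw [integral_gauss]
  simp only [smul_eq_mul, mul_comm (Real.exp _)]
  rw [h]
  field_simp
  ring_nf

theorem integrable_exp_neg_sq_mul_rpow {p : ℝ} (hp : 0 ≤ p) :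
    Integrable (fun w : ℂ => ‖w‖ ^ p * Real.exp (-‖w‖ ^ 2)) := by
  -- A non-integrable function has Bochner integral 0 by convention, which contradicts the positive
  -- value Γ(1+p/2).
  by_contra h
  have h1 := integral_norm_rpow_gauss hp
  rw [integral_gauss] at h1
  simp only [smul_eq_mul, mul_comm (Real.exp _)] at h1
  rw [integral_undef h, mul_zero] at h1
  exact (Real.Gamma_pos_of_pos (by linarith)).ne h1

theorem integrable_gauss_iff {E : Type*} [NormedAddCommGroup E] [NormedSpace ℝ E] (f : ℂ → E) :
    Integrable f gauss ↔ Integrable (fun w => Real.exp (-‖w‖ ^ 2) • f w) := by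
  rw [gauss, integrable_withDensity_iff_integrable_smul' (by fun_prop)
    (.of_forall fun _ => ENNReal.ofReal_lt_top)]
  have : (fun w => (ENNReal.ofReal (Real.pi⁻¹ * Real.exp (-‖w‖ ^ 2))).toReal • f w)
      = fun w => Real.pi⁻¹ • (Real.exp (-‖w‖ ^ 2) • f w) := by
    ext w; rw [ENNReal.toReal_ofReal (by positivity), smul_smul]
  rw [this]
  exact integrable_smul_iff (by positivity) _

theorem integrable_norm_rpow_gauss {p : ℝ} (hp : 0 ≤ p) :
    Integrable (fun w : ℂ => ‖w‖ ^ p) gauss := by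
  rw [integrable_gauss_iff]
  simpa only [smul_eq_mul, mul_comm (Real.exp _)] using integrable_exp_neg_sq_mul_rpow hp

instance : IsProbabilityMeasure gauss := by
  -- The moment of order 0 is the total mass, and Γ(1) = 1.
  have h := integral_norm_rpow_gauss le_rfl
  have hi := integrable_norm_rpow_gauss le_rfl
  simp only [Real.rpow_zero, zero_div, add_zero, Real.Gamma_one] at h hi
  have hf : IsFiniteMeasure gauss := by
    simpa [integrable_const_iff] using hi
  refine ⟨?_⟩
  simp only [integral_const, smul_eq_mul, mul_one, Measure.real] at h
  rwa [ENNReal.toReal_eq_one_iff] at h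

theorem integral_exp_re_gauss (c : ℂ) :
    ∫ w, Complex.exp ((c * w).re * Complex.I) ∂gauss = Real.exp (-‖c‖ ^ 2 / 4) := by
  have h := GaussianFourier.integral_cexp_neg_mul_sq_norm_add (b := 1) (by simp) Complex.I (conj c)
  rw [integral_gauss]
  have : ∀ w : ℂ, Real.exp (-‖w‖ ^ 2) • Complex.exp ((c * w).re * Complex.I)
      = Complex.exp (-1 * ‖w‖ ^ 2 + Complex.I * (inner ℝ (conj c) w : ℝ)) := fun w => by
    rw [Complex.real_smul, Complex.ofReal_exp, ← Complex.exp_add, Complex.inner]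
    simp only [Complex.conj_conj]
    push_cast
    ring_nf
  simp_rw [this]
  rw [h]
  simp

theorem integral_bessel_gauss {t : ℝ} (ht : 0 ≤ t) :
    ∫ w, bessel (t * ‖w‖) ∂gauss = Real.exp (-t ^ 2 / 4) := by
  have h1 : ∀ w : ℂ, (bessel (t * ‖w‖) : ℂ)
      = ∫ y, Complex.exp ((t * pt y * w).re * Complex.I) ∂haarAddCircle := fun w => by
    have := circ_exp_re (t * w)
    rw [norm_mul, Complex.norm_real, Real.norm_of_nonneg ht] at this
    rw [← this, circ]
    congr 1; ext y; ring_nf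
  have : ((∫ w, bessel (t * ‖w‖) ∂gauss : ℝ) : ℂ) = Real.exp (-t ^ 2 / 4) := by
    rw [← integral_complex_ofReal]
    simp_rw [h1]
    rw [integral_integral_swap]
    · simp_rw [integral_exp_re_gauss]
      simp
    · refine Integrable.of_bound (C := 1) ?_ (.of_forall fun z => ?_)
      · exact Continuous.aestronglyMeasurable (by fun_prop)
      · simp only [Function.uncurry]
        rw [Complex.norm_exp_ofReal_mul_I]
  exact_mod_cast this

/-! ### Moments of linear polynomials -/

theorem integrable_bessel_gauss (t : ℝ) : Integrable (fun w : ℂ => bessel (t * ‖w‖)) gauss :=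
  Integrable.of_bound (C := 1)
    (continuous_bessel.comp (by fun_prop)).aestronglyMeasurable
    (.of_forall fun w => abs_bessel_le_one _)

theorem circ_pow_eq_zero {n : ℕ} (hn : n ≠ 0) : circ (fun z => z ^ n) = 0 := by
  rw [circ_eq_circleAverage, DiffContOnCl.circleAverage]
  · simp [hn]
  · exact Differentiable.diffContOnCl (by fun_prop)

theorem circ_id : circ (fun z => z) = 0 := by simpa using circ_pow_eq_zero one_ne_zero

theorem circ_re_mul (c : ℂ) : circ (fun z => (c * z).re) = 0 := by
  have h := integral_re (𝕜 := ℂ) (μ := haarAddCircle) (f := fun x => c * pt x)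
    (integrable_comp_pt (f := fun z => c * z) (by fun_prop))
  simp only [RCLike.re_to_complex, integral_const_mul] at h
  have h2 := circ_id
  rw [circ] at h2 ⊢
  rw [h, h2]
  simp

theorem circ_norm_sq (y a : ℂ) :
    circ (fun z => ‖y + a * z‖ ^ 2) = ‖y‖ ^ 2 + ‖a‖ ^ 2 := by
  have : ∀ x, ‖y + a * pt x‖ ^ 2 = ‖y‖ ^ 2 + ‖a‖ ^ 2 + 2 * ((conj y * a) * pt x).re := fun x => by
    have h1 := norm_add_sq_real y (a * pt x)
    rw [h1, norm_mul, norm_pt, Complex.inner]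
    ring_nf
  have h2 := circ_re_mul (conj y * a)
  rw [circ] at h2 ⊢
  simp_rw [this]
  rw [integral_add (integrable_const _), integral_const_mul, h2]
  · simp
  · exact (integrable_comp_pt (f := fun z => ((conj y * a) * z).re) (by fun_prop)).const_mul _

theorem integral_norm_lin_sq (a : ℕ → ℂ) (s : Finset ℕ) :
    ∫ x, ‖lin a s x‖ ^ 2 ∂haar = ∑ j ∈ s, ‖a j‖ ^ 2 := by
  induction s using Finset.induction_on with
  | empty => simp [lin]
  | insert j s hj ih =>
    rw [integral_lin_insert a hj (f := fun w => ‖w‖ ^ 2) (by fun_prop), Finset.sum_insert hj, ← ih]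
    simp_rw [circ_norm_sq]
    rw [integral_add (integrable_of_continuous (by fun_prop)) (integrable_const _)]
    simp [add_comm]

theorem integrable_norm_lin_rpow (a : ℕ → ℂ) (s : Finset ℕ) {p : ℝ} (hp : 0 ≤ p) :
    Integrable (fun x => ‖lin a s x‖ ^ p) haar :=
  integrable_of_continuous ((Real.continuous_rpow_const hp).comp (by fun_prop))

theorem measurable_lin (a : ℕ → ℂ) (s : Finset ℕ) : Measurable (lin a s) :=
  (continuous_lin a s).measurable

theorem kernel_moment_lin (a : ℕ → ℂ) (s : Finset ℕ) {p : ℝ} (hp : 0 < p) (hp2 : p < 2) :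
    IntegrableOn (fun t => (1 - besselProd a s t) * t ^ (-1 - p)) (Set.Ioi 0) ∧
    ∫ t in Set.Ioi (0 : ℝ), (1 - besselProd a s t) * t ^ (-1 - p)
      = kernelConst p * ∫ x, ‖lin a s x‖ ^ p ∂haar := by
  have hi (t : ℝ) : Integrable (fun x => bessel (t * ‖lin a s x‖)) haar :=
    integrable_of_continuous (continuous_bessel.comp (by fun_prop))
  refine kernel_moment (k := fun t => 1 - bessel t) (measurable_lin a s).norm
    (fun _ => norm_nonneg _) (measurable_const.sub measurable_bessel)
    (fun t _ => by linarith [(abs_le.1 (abs_bessel_le_one t)).2]) (by simp [bessel_zero]) hp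
    (integrableOn_kernel hp hp2) (measurable_const.sub (continuous_besselProd a s).measurable)
    (fun t ht => (integrable_const _).sub (hi t)) (fun t ht => ?_)
    (integrable_norm_lin_rpow a s hp.le)
  rw [integral_sub (integrable_const _) (hi t), integral_bessel_norm_lin a s ht.le]
  simp

theorem kernel_moment_gauss {p : ℝ} (hp : 0 < p) (hp2 : p < 2) :
    IntegrableOn (fun t => (1 - Real.exp (-t ^ 2 / 4)) * t ^ (-1 - p)) (Set.Ioi 0) ∧
    ∫ t in Set.Ioi (0 : ℝ), (1 - Real.exp (-t ^ 2 / 4)) * t ^ (-1 - p)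
      = kernelConst p * Real.Gamma (1 + p / 2) := by
  rw [← integral_norm_rpow_gauss hp.le]
  refine kernel_moment (k := fun t => 1 - bessel t) measurable_norm
    (fun _ => norm_nonneg _) (measurable_const.sub measurable_bessel)
    (fun t _ => by linarith [(abs_le.1 (abs_bessel_le_one t)).2]) (by simp [bessel_zero]) hp
    (integrableOn_kernel hp hp2) (by fun_prop)
    (fun t ht => (integrable_const _).sub (integrable_bessel_gauss t)) (fun t ht => ?_)
    (integrable_norm_rpow_gauss hp.le)
  rw [integral_sub (integrable_const _) (integrable_bessel_gauss t), integral_bessel_gauss ht.le]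
  simp

/-- The normalization σ = 1 makes the quadratic correction average to t²/4, exactly as for the
Gaussian; the two corrections will cancel in the comparison. -/
theorem kernel_moment_lin' (a : ℕ → ℂ) (s : Finset ℕ) (ha : ∑ j ∈ s, ‖a j‖ ^ 2 = 1) {p : ℝ}
    (hp : 2 < p) (hp4 : p < 4) :
    IntegrableOn (fun t => (besselProd a s t - 1 + t ^ 2 / 4) * t ^ (-1 - p)) (Set.Ioi 0) ∧
    ∫ t in Set.Ioi (0 : ℝ), (besselProd a s t - 1 + t ^ 2 / 4) * t ^ (-1 - p)
      = kernelConst' p * ∫ x, ‖lin a s x‖ ^ p ∂haar := by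
  have hi (t : ℝ) : Integrable (fun x => bessel (t * ‖lin a s x‖)) haar :=
    integrable_of_continuous (continuous_bessel.comp (by fun_prop))
  have hi2 (t : ℝ) : Integrable (fun x => (t * ‖lin a s x‖) ^ 2 / 4) haar :=
    integrable_of_continuous (by fun_prop)
  refine kernel_moment (k := fun t => bessel t - 1 + t ^ 2 / 4) (measurable_lin a s).norm
    (fun _ => norm_nonneg _) (by have := measurable_bessel; fun_prop)
    (fun t _ => by linarith [le_bessel_two t]) (by simp [bessel_zero]) (by linarith)
    (integrableOn_kernel' hp hp4) (by have := (continuous_besselProd a s).measurable; fun_prop)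
    (fun t ht => ((hi t).sub (integrable_const _)).add (hi2 t)) (fun t ht => ?_)
    (integrable_norm_lin_rpow a s (by linarith))
  rw [integral_add (f := fun x => bessel (t * ‖lin a s x‖) - 1)
    ((hi t).sub (integrable_const _)) (hi2 t),
    integral_sub (hi t) (integrable_const _), integral_bessel_norm_lin a s ht.le]
  simp_rw [mul_pow]
  rw [integral_div, integral_const_mul, integral_norm_lin_sq, ha]
  simp

theorem kernel_moment_gauss' {p : ℝ} (hp : 2 < p) (hp4 : p < 4) :
    IntegrableOn (fun t => (Real.exp (-t ^ 2 / 4) - 1 + t ^ 2 / 4) * t ^ (-1 - p)) (Set.Ioi 0) ∧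
    ∫ t in Set.Ioi (0 : ℝ), (Real.exp (-t ^ 2 / 4) - 1 + t ^ 2 / 4) * t ^ (-1 - p)
      = kernelConst' p * Real.Gamma (1 + p / 2) := by
  rw [← integral_norm_rpow_gauss (by linarith)]
  have hs : Integrable (fun w : ℂ => ‖w‖ ^ 2) gauss := by
    simpa using integrable_norm_rpow_gauss (p := 2) (by norm_num)
  have hs1 : ∫ w : ℂ, ‖w‖ ^ 2 ∂gauss = 1 := by
    have := integral_norm_rpow_gauss (p := 2) (by norm_num)
    norm_num at this
    exact this
  have hi2 (t : ℝ) : Integrable (fun w : ℂ => (t * ‖w‖) ^ 2 / 4) gauss := by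
    simp_rw [mul_pow]
    exact (hs.const_mul _).div_const _
  have hi := integrable_bessel_gauss
  refine kernel_moment (k := fun t => bessel t - 1 + t ^ 2 / 4) measurable_norm
    (fun _ => norm_nonneg _) (by have := measurable_bessel; fun_prop)
    (fun t _ => by linarith [le_bessel_two t]) (by simp [bessel_zero]) (by linarith)
    (integrableOn_kernel' hp hp4) (by fun_prop)
    (fun t ht => ((hi t).sub (integrable_const _)).add (hi2 t)) (fun t ht => ?_)
    (integrable_norm_rpow_gauss (by linarith))
  rw [integral_add (f := fun w : ℂ => bessel (t * ‖w‖) - 1)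
    ((hi t).sub (integrable_const _)) (hi2 t),
    integral_sub (hi t) (integrable_const _), integral_bessel_gauss ht.le]
  simp_rw [mul_pow]
  rw [integral_div, integral_const_mul, hs1]
  simp

end

section

open AddCircle

/-! ### The first moment when no coefficient dominates -/

/-- Integration by parts: the boundary term −(1 − exp(−bt²))/t vanishes at 0 and at infinity, which
leaves the Gaussian integral of 2b exp(−bt²). The exponent is written −1 − 1 to match −1 − p at p =
1. -/
theorem integral_one_sub_exp_mul_rpow {b : ℝ} (hb : 0 < b) :
    IntegrableOn (fun t => (1 - Real.exp (-b * t ^ 2)) * t ^ (-1 - 1 : ℝ)) (Set.Ioi 0) ∧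
    ∫ t in Set.Ioi (0 : ℝ), (1 - Real.exp (-b * t ^ 2)) * t ^ (-1 - 1 : ℝ)
      = Real.sqrt (Real.pi * b) := by
  have hi : IntegrableOn (fun t => (1 - Real.exp (-b * t ^ 2)) * t ^ (-1 - 1 : ℝ))
      (Set.Ioi 0) := by
    refine integrableOn_Ioi_mul_rpow (α := 2) (β := 0) (C := 1 + b) (by fun_prop) (by norm_num)
      (by norm_num) (fun t h0 h1 => ?_) fun t h1 => ?_
    · have h2 := Real.add_one_le_exp (-b * t ^ 2)
      have h3 : Real.exp (-b * t ^ 2) ≤ 1 := Real.exp_le_one_iff.2 (by nlinarith [sq_nonneg t])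
      rw [abs_of_nonneg (by linarith), Real.rpow_two]
      nlinarith [sq_nonneg t]
    · have h3 : Real.exp (-b * t ^ 2) ≤ 1 := Real.exp_le_one_iff.2 (by nlinarith [sq_nonneg t])
      rw [abs_of_nonneg (by linarith), Real.rpow_zero]
      have := Real.exp_pos (-b * t ^ 2)
      linarith
  refine ⟨hi, ?_⟩
  have hg : IntegrableOn (fun t : ℝ => 2 * b * Real.exp (-b * t ^ 2)) (Set.Ioi 0) :=
    ((integrable_exp_neg_mul_sq hb).const_mul (2 * b)).integrableOn
  -- Division by zero gives f 0 = 0, which agrees with the limit from the right, so f is continuous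
  -- at 0.
  set f : ℝ → ℝ := fun t => -(1 - Real.exp (-b * t ^ 2)) / t with hf
  have h01 : ∀ t : ℝ, 0 ≤ 1 - Real.exp (-b * t ^ 2) ∧ 1 - Real.exp (-b * t ^ 2) ≤ b * t ^ 2 ∧
      1 - Real.exp (-b * t ^ 2) ≤ 1 := fun t =>
    ⟨sub_nonneg.2 (Real.exp_le_one_iff.2 (by nlinarith [sq_nonneg t])),
      by linarith [Real.add_one_le_exp (-b * t ^ 2)], by linarith [Real.exp_pos (-b * t ^ 2)]⟩
  have hz : ∫ t in Set.Ioi (0 : ℝ), ((1 - Real.exp (-b * t ^ 2)) * t ^ (-1 - 1 : ℝ)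
      - 2 * b * Real.exp (-b * t ^ 2)) = 0 - f 0 := by
    refine integral_Ioi_of_hasDerivAt_of_tendsto (f := f) ?_ (fun t ht => ?_) (hi.sub hg) ?_
    · have h0 : f 0 = 0 := by simp [hf]
      rw [ContinuousWithinAt, h0]
      have hl : Filter.Tendsto (fun t : ℝ => b * t) (nhdsWithin 0 (Set.Ici 0)) (nhds 0) := by
        have : Continuous fun t : ℝ => b * t := by fun_prop
        simpa using (this.tendsto 0).mono_left nhdsWithin_le_nhds
      refine squeeze_zero_norm' ?_ hl
      filter_upwards [self_mem_nhdsWithin] with t ht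
      rcases (Set.mem_Ici.1 ht).eq_or_lt with h | h
      · simp [← h, h0]
      · rw [hf, norm_div, norm_neg, Real.norm_of_nonneg (h01 t).1, Real.norm_of_nonneg h.le,
          div_le_iff₀ h]
        nlinarith [(h01 t).2.1]
    · have ht0 : (0 : ℝ) < t := ht
      have h1 : HasDerivAt (fun t : ℝ => Real.exp (-b * t ^ 2))
          (Real.exp (-b * t ^ 2) * (-2 * b * t)) t := by
        refine (((hasDerivAt_pow 2 t).const_mul (-b)).exp).congr_deriv ?_
        norm_num
        ring
      refine ((h1.const_sub 1).neg.div (hasDerivAt_id t) ht0.ne').congr_deriv ?_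
      rw [show (-1 - 1 : ℝ) = -(2 : ℝ) by norm_num, Real.rpow_neg ht0.le, Real.rpow_two]
      simp only [id, Pi.neg_apply]
      field_simp
      ring
    · refine squeeze_zero_norm' ?_ tendsto_inv_atTop_zero
      filter_upwards [Filter.eventually_gt_atTop 0] with t ht
      rw [hf, norm_div, norm_neg, Real.norm_of_nonneg (h01 t).1, Real.norm_of_nonneg ht.le,
        ← one_div]
      exact div_le_div_of_nonneg_right (h01 t).2.2 ht.le
  rw [integral_sub hi hg, integral_const_mul, integral_gaussian_Ioi,
    show f 0 = 0 by simp [hf], sub_zero, sub_eq_zero] at hz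
  rw [hz, Real.sqrt_div Real.pi_pos.le, Real.sqrt_mul Real.pi_pos.le]
  have : b = Real.sqrt b * Real.sqrt b := (Real.mul_self_sqrt hb.le).symm
  have h0 : Real.sqrt b ≠ 0 := (Real.sqrt_pos.2 hb).ne'
  field_simp
  nlinarith

/-- The Gaussian first moment is computed in two ways: through the kernel formula, and directly with
b = 1/4. -/
theorem kernelConst_one : kernelConst 1 = 1 := by
  have h1 := (kernel_moment_gauss (p := 1) one_pos one_lt_two).2
  have h2 := (integral_one_sub_exp_mul_rpow (b := 1 / 4) (by norm_num)).2
  have : ∀ t : ℝ, -t ^ 2 / 4 = -(1 / 4) * t ^ 2 := fun t => by ring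
  simp_rw [this] at h1
  rw [h2, show (1 : ℝ) + 1 / 2 = 1 / 2 + 1 by norm_num, Real.Gamma_add_one (by norm_num),
    Real.Gamma_one_half_eq, Real.sqrt_mul Real.pi_pos.le,
    show Real.sqrt (1 / 4) = 1 / 2 by
      rw [show (1 / 4 : ℝ) = (1 / 2) ^ 2 by norm_num, Real.sqrt_sq (by norm_num)]] at h1
  have := Real.sqrt_pos.2 Real.pi_pos
  field_simp at h1
  linarith

theorem circ_norm_one_add : circ (fun z => ‖1 + z‖) = 4 / Real.pi := by
  have h := circ_mul_left (c := -1) (by simp) (fun z => ‖1 + z‖)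
  rw [← h, circ_eq_interval]
  have : ∫ θ in (0 : ℝ)..(2 * Real.pi), ‖1 + -1 * Complex.exp (θ * Complex.I)‖
      = ∫ θ in (0 : ℝ)..(2 * Real.pi), 2 * Real.sin (θ / 2) := by
    refine intervalIntegral.integral_congr fun θ hθ => ?_
    rw [Set.uIcc_of_le (by positivity)] at hθ
    have hs : 0 ≤ Real.sin (θ / 2) :=
      Real.sin_nonneg_of_nonneg_of_le_pi (by linarith [hθ.1]) (by linarith [hθ.2])
    rw [Complex.norm_eq_sqrt_sq_add_sq]
    rw [Real.sqrt_eq_iff_eq_sq (by positivity) (by positivity)]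
    simp only [neg_mul, one_mul, Complex.add_re, Complex.one_re, Complex.neg_re,
      Complex.exp_ofReal_mul_I_re, Complex.add_im, Complex.one_im, Complex.neg_im,
      Complex.exp_ofReal_mul_I_im]
    have h1 := Real.sin_sq_add_cos_sq θ
    have h2 : Real.cos θ = 1 - 2 * Real.sin (θ / 2) ^ 2 := by
      have := Real.cos_two_mul (θ / 2)
      rw [mul_div_cancel₀ _ (two_ne_zero)] at this
      rw [this, Real.cos_sq']; ring
    nlinarith
  rw [this, intervalIntegral.integral_const_mul, intervalIntegral.integral_comp_div _ two_ne_zero]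
  simp
  field_simp
  norm_num

theorem integral_norm_lin_pair : ∫ x, ‖lin 1 {0, 1} x‖ ∂haar = 4 / Real.pi := by
  rw [show ({0, 1} : Finset ℕ) = insert 0 {1} from rfl,
    integral_lin_insert 1 (by simp) (f := fun w => ‖w‖) (by fun_prop)]
  have : ∀ x, circ (fun z => ‖lin 1 {1} x + (1 : ℕ → ℂ) 0 * z‖) = 4 / Real.pi := fun x => by
    rw [← circ_norm_one_add, ← circ_mul_left (norm_pt (x 1))]
    congr 1; ext z
    simp only [lin, Finset.sum_singleton, Pi.one_apply, one_mul]
    rw [show pt (x 1) + pt (x 1) * z = pt (x 1) * (1 + z) by ring, norm_mul, norm_pt, one_mul]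
  simp_rw [this]
  simp

/-- This is the kernel formula for z_0 + z_1, whose first moment is 4/π. It supplies the exact value
for the extremal exponent s = 2 in `exp_rpow_sub_bessel_rpow`. -/
theorem integral_one_sub_bessel_sq :
    IntegrableOn (fun t => (1 - bessel t ^ 2) * t ^ (-1 - 1 : ℝ)) (Set.Ioi 0) ∧
    ∫ t in Set.Ioi (0 : ℝ), (1 - bessel t ^ 2) * t ^ (-1 - 1 : ℝ) = 4 / Real.pi := by
  have h := kernel_moment_lin 1 {0, 1} one_pos one_lt_two
  have h2 : ∀ t, besselProd 1 {0, 1} t = bessel t ^ 2 := fun t => by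
    simp [besselProd]
  simp only [h2, Real.rpow_one, integral_norm_lin_pair, kernelConst_one, one_mul] at h
  exact h

/-- The function −exp(−t²/2)/(t(t²+2)) tends to 0 at infinity, and its derivative dominates the
integrand as soon as t² ≥ 2. The bound is minus its value at 15/8, estimated with exp(225/128) ≥ 5.
-/
theorem integral_gauss_tail_le :
    IntegrableOn (fun t => Real.exp (-(1 / 2) * t ^ 2) * t ^ (-1 - 1 : ℝ)) (Set.Ioi (15 / 8)) ∧
    ∫ t in Set.Ioi (15 / 8 : ℝ), Real.exp (-(1 / 2) * t ^ 2) * t ^ (-1 - 1 : ℝ) ≤ 198 / 10000 := by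
  set A : ℝ → ℝ := fun t => -(Real.exp (-(1 / 2) * t ^ 2) / (t * (t ^ 2 + 2))) with hA
  set A' : ℝ → ℝ := fun t => Real.exp (-(1 / 2) * t ^ 2) *
    (1 / (t ^ 2 + 2) + (3 * t ^ 2 + 2) / (t * (t ^ 2 + 2)) ^ 2) with hA'
  have hd : ∀ t ∈ Set.Ici (15 / 8 : ℝ), HasDerivAt A (A' t) t := fun t ht => by
    have ht0 : t ≠ 0 := by have := Set.mem_Ici.1 ht; intro h; rw [h] at this; norm_num at this
    have hp : t ^ 2 + 2 ≠ 0 := by positivity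
    have h1 : HasDerivAt (fun t : ℝ => Real.exp (-(1 / 2) * t ^ 2))
        (Real.exp (-(1 / 2) * t ^ 2) * (-t)) t := by
      refine (((hasDerivAt_pow 2 t).const_mul (-(1 / 2 : ℝ))).exp).congr_deriv ?_
      norm_num
      ring
    have h2 : HasDerivAt (fun t : ℝ => t * (t ^ 2 + 2)) (3 * t ^ 2 + 2) t := by
      refine ((hasDerivAt_id t).mul ((hasDerivAt_pow 2 t).add_const 2)).congr_deriv ?_
      norm_num
      ring
    refine (h1.div h2 (mul_ne_zero ht0 hp)).neg.congr_deriv ?_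
    rw [hA']
    field_simp
    ring
  have hpos : ∀ t ∈ Set.Ioi (15 / 8 : ℝ), 0 ≤ A' t := fun t ht => by
    have ht0 : 0 < t := by have := Set.mem_Ioi.1 ht; linarith
    positivity
  have hlim : Filter.Tendsto A Filter.atTop (nhds 0) := by
    refine squeeze_zero_norm' ?_ tendsto_inv_atTop_zero
    filter_upwards [Filter.eventually_gt_atTop 0] with t ht
    rw [hA, norm_neg, Real.norm_of_nonneg (by positivity), ← one_div]
    refine div_le_div₀ zero_le_one (Real.exp_le_one_iff.2 (by nlinarith [sq_nonneg t])) ht ?_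
    nlinarith [sq_nonneg t]
  have hi := integrableOn_Ioi_deriv_of_nonneg' hd hpos hlim
  have hI := integral_Ioi_of_hasDerivAt_of_nonneg' hd hpos hlim
  have hle : ∀ t ∈ Set.Ioi (15 / 8 : ℝ),
      Real.exp (-(1 / 2) * t ^ 2) * t ^ (-1 - 1 : ℝ) ≤ A' t := fun t ht => by
    have ht0 : 0 < t := by have := Set.mem_Ioi.1 ht; linarith
    have ht1 : 15 / 8 < t := ht
    rw [hA', show (-1 - 1 : ℝ) = -(2 : ℝ) by norm_num, Real.rpow_neg ht0.le, Real.rpow_two]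
    simp only
    refine mul_le_mul_of_nonneg_left ?_ (Real.exp_pos _).le
    rw [div_add_div _ _ (by positivity) (by positivity), inv_eq_one_div, div_le_div_iff₀ (by positivity) (by positivity)]
    have : 2 ≤ t ^ 2 := by nlinarith
    nlinarith [mul_nonneg (by positivity : 0 ≤ t ^ 2 * (t ^ 2 + 2)) (sub_nonneg.2 this)]
  have hi2 : IntegrableOn (fun t => Real.exp (-(1 / 2) * t ^ 2) * t ^ (-1 - 1 : ℝ))
      (Set.Ioi (15 / 8)) := by
    refine hi.mono' (by fun_prop) ((ae_restrict_mem measurableSet_Ioi).mono fun t ht => ?_)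
    have ht0 : (0 : ℝ) < t := by have := Set.mem_Ioi.1 ht; linarith
    rw [Real.norm_of_nonneg (by positivity)]
    exact hle t ht
  refine ⟨hi2, (setIntegral_mono_on hi2 hi measurableSet_Ioi hle).trans ?_⟩
  rw [hI, hA]
  simp only [zero_sub, neg_neg]
  have he : (5 : ℝ) ≤ Real.exp (225 / 128) := by
    refine le_trans ?_ (Real.sum_le_exp_of_nonneg (by norm_num) 6)
    norm_num [Finset.sum_range_succ, Nat.factorial]
  have : Real.exp (-(1 / 2) * (15 / 8) ^ 2) ≤ 1 / 5 := by
    rw [show (-(1 / 2) * (15 / 8) ^ 2 : ℝ) = -(225 / 128) by norm_num, Real.exp_neg, inv_eq_one_div]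
    exact one_div_le_one_div_of_le (by norm_num) he
  rw [div_le_iff₀ (by norm_num)]
  norm_num at this ⊢
  linarith

theorem bessel_le_exp {t : ℝ} (ht : 0 ≤ t) (ht2 : t ≤ 15 / 8) :
    0 ≤ bessel t ∧ bessel t ≤ Real.exp (-t ^ 2 / 4) := by
  have hy : t ^ 2 / 4 ≤ 1 := by nlinarith
  refine ⟨by linarith [le_bessel_two t], (bessel_le_four t).trans ?_⟩
  set y := t ^ 2 / 4 with hy'
  have hy0 : 0 ≤ y := by positivity
  have h1 : 1 - t ^ 2 / 4 + t ^ 4 / 64 = 1 - y + y ^ 2 / 4 := by rw [hy']; ring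
  rw [h1, neg_div, ← hy', Real.exp_neg, ← one_div, le_div_iff₀ (Real.exp_pos _)]
  have h2 := Real.exp_bound' hy0 hy (n := 3) (by norm_num)
  norm_num [Finset.sum_range_succ, Nat.factorial] at h2
  have h3 : 0 ≤ 1 - y + y ^ 2 / 4 := by nlinarith
  refine (mul_le_mul_of_nonneg_left h2 h3).trans ?_
  nlinarith [pow_nonneg hy0 2, pow_nonneg hy0 3, pow_nonneg hy0 4, pow_nonneg hy0 5]

/-- Reduction to s = 2. Write G = exp(−t²/4) and let m be its value at the cutoff 15/8. Before the
cutoff 0 ≤ J₀ ≤ G and m ≤ G, so G^s − |J₀|^s ≥ m^{s−2}(G² − J₀²). After it |J₀| ≤ m, so the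
difference is at least −m^{s−2} J₀². The claim thus follows from the case s = 2 with the Gaussian
tail discarded. -/
theorem exp_rpow_sub_bessel_rpow {s : ℝ} (hs : 2 ≤ s) :
    IntegrableOn (fun t => (Real.exp (-t ^ 2 / 4) ^ s - |bessel t| ^ s) * t ^ (-1 - 1 : ℝ))
      (Set.Ioi 0) ∧
    0 ≤ ∫ t in Set.Ioi (0 : ℝ),
      (Real.exp (-t ^ 2 / 4) ^ s - |bessel t| ^ s) * t ^ (-1 - 1 : ℝ) := by
  have hi : IntegrableOn (fun t => (Real.exp (-t ^ 2 / 4) ^ s - |bessel t| ^ s)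
      * t ^ (-1 - 1 : ℝ)) (Set.Ioi 0) := by
    have hb : ∀ t, 0 ≤ |bessel t| ^ s ∧ |bessel t| ^ s ≤ 1 := fun t =>
      ⟨by positivity, Real.rpow_le_one (abs_nonneg _) (abs_bessel_le_one t) (by linarith)⟩
    have he : ∀ t : ℝ, 0 ≤ Real.exp (-t ^ 2 / 4) ^ s ∧ Real.exp (-t ^ 2 / 4) ^ s ≤ 1 := fun t =>
      ⟨by positivity, Real.rpow_le_one (by positivity)
        (Real.exp_le_one_iff.2 (by nlinarith [sq_nonneg t])) (by linarith)⟩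
    refine integrableOn_Ioi_mul_rpow (α := 2) (β := 0) (C := s) ?_ (by norm_num)
      (by norm_num) (fun t h0 h1 => ?_) fun t h1 => ?_
    · have := measurable_bessel
      exact ((by fun_prop : Measurable fun t : ℝ => Real.exp (-t ^ 2 / 4)).pow_const s).sub
        (this.abs.pow_const s)
    -- Bernoulli's inequality keeps both s-th powers within O(t²) of 1 near the origin.
    · have h2 := one_add_mul_self_le_rpow_one_add
        (s := |bessel t| - 1) (by linarith [abs_nonneg (bessel t)]) (p := s) (by linarith)
      have h3 := one_add_mul_self_le_rpow_one_add (s := Real.exp (-t ^ 2 / 4) - 1)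
        (by linarith [Real.exp_pos (-t ^ 2 / 4)]) (p := s) (by linarith)
      rw [add_sub_cancel] at h2 h3
      have h4 := Real.add_one_le_exp (-t ^ 2 / 4)
      have h5 := (le_bessel_two t).trans (le_abs_self _)
      rw [abs_le, Real.rpow_two]
      constructor <;> nlinarith [hb t, he t, sq_nonneg t]
    · rw [abs_le, Real.rpow_zero]
      constructor <;> nlinarith [hb t, he t]
  refine ⟨hi, ?_⟩
  set m : ℝ := Real.exp (-(15 / 8) ^ 2 / 4) with hm
  have hm0 : 0 < m := Real.exp_pos _
  have hm1 : 415 / 1000 ≤ m := by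
    rw [hm, show (-(15 / 8) ^ 2 / 4 : ℝ) = -(225 / 256) by norm_num, Real.exp_neg,
      ← one_div, le_div_iff₀ (Real.exp_pos _)]
    have := Real.exp_bound' (x := 225 / 256) (by norm_num) (by norm_num) (n := 6) (by norm_num)
    norm_num [Finset.sum_range_succ, Nat.factorial] at this
    linarith
  set w : ℝ → ℝ := fun t => t ^ (-1 - 1 : ℝ) with hw
  obtain ⟨hfi, hf⟩ := integral_one_sub_bessel_sq
  obtain ⟨hgi, hg⟩ := integral_one_sub_exp_mul_rpow (b := 1 / 2) (by norm_num)
  obtain ⟨hti, ht⟩ := integral_gauss_tail_le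
  -- H is (G² − J₀²) t^{-2} before the cutoff and −J₀² t^{-2} after it, written so that each piece
  -- has a known integral.
  set H : ℝ → ℝ := fun t => ((1 - bessel t ^ 2) * w t - (1 - Real.exp (-(1 / 2) * t ^ 2)) * w t)
      - (Set.Ioi (15 / 8 : ℝ)).indicator (fun t => Real.exp (-(1 / 2) * t ^ 2) * w t) t with hH
  have hti' : IntegrableOn ((Set.Ioi (15 / 8 : ℝ)).indicator
      (fun t => Real.exp (-(1 / 2) * t ^ 2) * w t)) (Set.Ioi 0) :=
    ((integrable_indicator_iff measurableSet_Ioi).2 hti).integrableOn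
  have hHi : IntegrableOn H (Set.Ioi 0) := (hfi.sub hgi).sub hti'
  have hHI : 0 ≤ ∫ t in Set.Ioi (0 : ℝ), H t := by
    simp only [hH]
    have hsub : Integrable (fun t => (1 - bessel t ^ 2) * w t
      - (1 - Real.exp (-(1 / 2) * t ^ 2)) * w t) (volume.restrict (Set.Ioi 0)) := hfi.sub hgi
    rw [integral_sub hsub hti', integral_sub hfi hgi, hf, hg,
      setIntegral_indicator measurableSet_Ioi, Set.inter_eq_right.2 (Set.Ioi_subset_Ioi (by norm_num))]
    -- The integral of H is 4/π − √(π/2) minus the Gaussian tail; the rounded values leave 1.2732 −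
    -- 1.2534 − 0.0198 = 0.
    have h1 : 12732 / 10000 ≤ 4 / Real.pi := by
      rw [le_div_iff₀ Real.pi_pos]
      linarith [Real.pi_lt_d4]
    have h2 : Real.sqrt (Real.pi * (1 / 2)) ≤ 12534 / 10000 := by
      rw [Real.sqrt_le_left (by norm_num)]
      linarith [Real.pi_lt_d4]
    have : ∫ t in Set.Ioi (15 / 8 : ℝ), Real.exp (-(1 / 2) * t ^ 2) * w t ≤ 198 / 10000 := ht
    linarith
  have hle : ∀ t ∈ Set.Ioi (0 : ℝ), m ^ (s - 2) * H t
      ≤ (Real.exp (-t ^ 2 / 4) ^ s - |bessel t| ^ s) * w t := fun t ht => by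
    have ht0 : 0 < t := ht
    have hw0 : 0 ≤ w t := Real.rpow_nonneg ht0.le _
    have hsplit : ∀ x : ℝ, 0 ≤ x → x ^ s = x ^ (s - 2) * x ^ 2 := fun x hx => by
      rw [← Real.rpow_two, ← Real.rpow_add_of_nonneg hx (by linarith) (by norm_num)]
      ring_nf
    have hsq : Real.exp (-(1 / 2) * t ^ 2) = Real.exp (-t ^ 2 / 4) ^ 2 := by
      rw [← Real.exp_nat_mul]; congr 1; push_cast; ring
    have hF : |bessel t| ^ s = |bessel t| ^ (s - 2) * bessel t ^ 2 := by
      rw [hsplit _ (abs_nonneg _), sq_abs]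
    have hG := hsplit (Real.exp (-t ^ 2 / 4)) (Real.exp_pos _).le
    rw [hF, hG]
    rcases le_or_gt t (15 / 8) with h | h
    · have hHt : H t = (Real.exp (-t ^ 2 / 4) ^ 2 - bessel t ^ 2) * w t := by
        rw [hH]
        simp only
        rw [Set.indicator_of_notMem (by simpa using h), hsq]; ring
      obtain ⟨hb0, hb1⟩ := bessel_le_exp ht0.le h
      rw [hHt, ← mul_assoc]
      refine mul_le_mul_of_nonneg_right ?_ hw0
      have hmg : m ≤ Real.exp (-t ^ 2 / 4) := by
        rw [hm]; apply Real.exp_le_exp.2; nlinarith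
      have h1 : m ^ (s - 2) ≤ Real.exp (-t ^ 2 / 4) ^ (s - 2) :=
        Real.rpow_le_rpow hm0.le hmg (by linarith)
      have h2 : |bessel t| ^ (s - 2) ≤ Real.exp (-t ^ 2 / 4) ^ (s - 2) :=
        Real.rpow_le_rpow (abs_nonneg _) (by rwa [abs_of_nonneg hb0]) (by linarith)
      have h3 : bessel t ^ 2 ≤ Real.exp (-t ^ 2 / 4) ^ 2 := pow_le_pow_left₀ hb0 hb1 2
      nlinarith [mul_le_mul_of_nonneg_right h1 (sub_nonneg.2 h3),
        mul_le_mul_of_nonneg_right h2 (sq_nonneg (bessel t))]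
    · have hHt : H t = - bessel t ^ 2 * w t := by
        rw [hH]
        simp only
        rw [Set.indicator_of_mem (by simpa using h)]; ring
      rw [hHt, ← mul_assoc]
      refine mul_le_mul_of_nonneg_right ?_ hw0
      have h2 : |bessel t| ^ (s - 2) ≤ m ^ (s - 2) :=
        Real.rpow_le_rpow (abs_nonneg _) ((abs_bessel_le_of_ge h.le).trans hm1) (by linarith)
      have h3 : 0 ≤ Real.exp (-t ^ 2 / 4) ^ (s - 2) * Real.exp (-t ^ 2 / 4) ^ 2 := by positivity
      nlinarith [mul_le_mul_of_nonneg_right h2 (sq_nonneg (bessel t))]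
  calc 0 ≤ m ^ (s - 2) * ∫ t in Set.Ioi (0 : ℝ), H t :=
        mul_nonneg (Real.rpow_nonneg hm0.le _) hHI
    _ = ∫ t in Set.Ioi (0 : ℝ), m ^ (s - 2) * H t := (integral_const_mul _ _).symm
    _ ≤ _ := setIntegral_mono_on (hHi.const_mul _) hi measurableSet_Ioi hle

/-- Weighted AM–GM inequality with weights |a_j|²: it decouples the coefficients, so that each index
can be rescaled separately. -/
theorem besselProd_le_sum (a : ℕ → ℂ) (s : Finset ℕ) (ha : ∑ j ∈ s, ‖a j‖ ^ 2 = 1) (t : ℝ) :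
    besselProd a s t ≤ ∑ j ∈ s, ‖a j‖ ^ 2 * |bessel (t * ‖a j‖)| ^ (1 / ‖a j‖ ^ 2) := by
  refine le_trans (le_of_eq_of_le ?_ (le_refl (∏ j ∈ s, |bessel (t * ‖a j‖)|))
    |>.trans' (le_abs_self _)) (le_of_eq_of_le ?_ (Real.geom_mean_le_arith_mean_weighted s
    (fun j => ‖a j‖ ^ 2) (fun j => |bessel (t * ‖a j‖)| ^ (1 / ‖a j‖ ^ 2))
    (fun j _ => by positivity) ha (fun j _ => by positivity)))
  · simp only [besselProd, Finset.abs_prod, mul_comm]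
  · refine Finset.prod_congr rfl fun j _ => ?_
    -- A zero coefficient has weight 0, and its factor is 1 on both sides because J₀(0) = 1.
    rcases eq_or_ne (a j) 0 with h | h
    · simp [h, bessel_zero]
    · have : ‖a j‖ ^ 2 ≠ 0 := by simpa using h
      rw [← Real.rpow_mul (abs_nonneg _), one_div, inv_mul_cancel₀ this, Real.rpow_one]

/-- The Gaussian is split with the same weights |a_j|² as the AM–GM bound. Rescaling t by |a_j|
turns the j-th term into the one-variable inequality with s = 1/|a_j|², and |a_j|² ≤ 1/2 is
precisely s ≥ 2. -/
theorem gamma_le_first_moment_of_small (a : ℕ → ℂ) (s : Finset ℕ) (ha : ∑ j ∈ s, ‖a j‖ ^ 2 = 1)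
    (h : ∀ j ∈ s, ‖a j‖ ^ 2 ≤ 1 / 2) :
    Real.Gamma (1 + 1 / 2) ≤ ∫ x, ‖lin a s x‖ ∂haar := by
  have h1 := kernel_moment_lin a s one_pos one_lt_two
  have h2 := kernel_moment_gauss one_pos one_lt_two
  simp only [kernelConst_one, one_mul, Real.rpow_one] at h1 h2
  rw [← h1.2, ← h2.2, ← sub_nonneg, ← integral_sub h1.1 h2.1]
  have hj : ∀ j ∈ s, IntegrableOn (fun t => ‖a j‖ ^ 2 * ((Real.exp (-t ^ 2 / 4)
      - |bessel (t * ‖a j‖)| ^ (1 / ‖a j‖ ^ 2)) * t ^ (-1 - 1 : ℝ))) (Set.Ioi 0) ∧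
      0 ≤ ∫ t in Set.Ioi (0 : ℝ), ‖a j‖ ^ 2 * ((Real.exp (-t ^ 2 / 4)
      - |bessel (t * ‖a j‖)| ^ (1 / ‖a j‖ ^ 2)) * t ^ (-1 - 1 : ℝ)) := fun j hj => by
    rcases eq_or_ne (a j) 0 with h0 | h0
    · simp [h0]
    · have hn : 0 < ‖a j‖ := norm_pos_iff.2 h0
      have hs : 2 ≤ 1 / ‖a j‖ ^ 2 := by
        rw [le_div_iff₀ (by positivity)]; linarith [h j hj]
      obtain ⟨hi, hI⟩ := exp_rpow_sub_bessel_rpow hs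
      set k : ℝ → ℝ := fun t => Real.exp (-t ^ 2 / 4) ^ (1 / ‖a j‖ ^ 2)
          - |bessel t| ^ (1 / ‖a j‖ ^ 2) with hk
      have hk0 : k 0 = 0 := by simp [hk, bessel_zero]
      have hi' := integrableOn_kernel_scale (k := k) hk0 hi hn.le
      have hI' := integral_kernel_scale (k := k) hk0 one_pos hn.le
      have he : ∀ t : ℝ, Real.exp (-(t * ‖a j‖) ^ 2 / 4) ^ (1 / ‖a j‖ ^ 2)
          = Real.exp (-t ^ 2 / 4) := fun t => by
        rw [← Real.exp_mul]; congr 1; field_simp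
      simp only [hk, he] at hi' hI'
      refine ⟨hi'.const_mul _, ?_⟩
      rw [integral_const_mul, hI']
      positivity
  calc 0 ≤ ∑ j ∈ s, ∫ t in Set.Ioi (0 : ℝ), ‖a j‖ ^ 2 * ((Real.exp (-t ^ 2 / 4)
      - |bessel (t * ‖a j‖)| ^ (1 / ‖a j‖ ^ 2)) * t ^ (-1 - 1 : ℝ)) :=
        Finset.sum_nonneg fun j hjs => (hj j hjs).2
    _ = ∫ t in Set.Ioi (0 : ℝ), ∑ j ∈ s, ‖a j‖ ^ 2 * ((Real.exp (-t ^ 2 / 4)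
      - |bessel (t * ‖a j‖)| ^ (1 / ‖a j‖ ^ 2)) * t ^ (-1 - 1 : ℝ)) :=
        (integral_finsetSum _ fun j hjs => (hj j hjs).1).symm
    _ ≤ _ := by
        refine setIntegral_mono_on (integrable_finsetSum _ fun j hjs => (hj j hjs).1)
          (h1.1.sub h2.1) measurableSet_Ioi fun t ht => ?_
        have hw0 : 0 ≤ t ^ (-1 - 1 : ℝ) := Real.rpow_nonneg (Set.mem_Ioi.1 ht).le _
        have := besselProd_le_sum a s ha t
        have h3 : ∑ j ∈ s, ‖a j‖ ^ 2 * ((Real.exp (-t ^ 2 / 4)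
          - |bessel (t * ‖a j‖)| ^ (1 / ‖a j‖ ^ 2)) * t ^ (-1 - 1 : ℝ))
          = (Real.exp (-t ^ 2 / 4) - ∑ j ∈ s, ‖a j‖ ^ 2 * |bessel (t * ‖a j‖)| ^ (1 / ‖a j‖ ^ 2))
            * t ^ (-1 - 1 : ℝ) := by
          have h4 : ∑ j ∈ s, ‖a j‖ ^ 2 * Real.exp (-t ^ 2 / 4) = Real.exp (-t ^ 2 / 4) := by
            rw [← Finset.sum_mul, ha, one_mul]
          conv_rhs => rw [← h4]
          rw [← Finset.sum_sub_distrib, Finset.sum_mul]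
          exact Finset.sum_congr rfl fun j _ => by ring
        rw [h3, ← sub_mul]
        exact mul_le_mul_of_nonneg_right (by linarith) hw0

end

section

open AddCircle

/-! ### The first moment when one coefficient dominates -/

theorem circ_comp_re (g : ℝ → ℝ) (c : ℂ) :
    circ (fun z => g (c * z).re) = mean fun θ => g (‖c‖ * Real.cos θ) := by
  obtain ⟨d, hd, h⟩ := exists_norm_one_mul c
  have h1 : circ (fun z => g (c * z).re)
      = circ (fun z => (fun z => g ((‖c‖ : ℂ) * z).re) (d * z)) := by
    congr 1; ext z; beta_reduce; conv_lhs => rw [h]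
    ring_nf
  rw [h1, circ_mul_left hd (fun z => g ((‖c‖ : ℂ) * z).re), circ_eq_mean]
  congr 1; ext θ
  rw [Complex.re_ofReal_mul, Complex.exp_ofReal_mul_I_re]

theorem norm_add_mul_sq (y a z : ℂ) (hz : ‖z‖ = 1) :
    ‖y + a * z‖ ^ 2 = ‖y‖ ^ 2 + ‖a‖ ^ 2 + 2 * ((conj y * a) * z).re := by
  have h1 := norm_add_sq_real y (a * z)
  rw [h1, norm_mul, hz, Complex.inner]
  ring_nf

theorem circ_comp_norm_sq (g : ℝ → ℝ) (y a : ℂ) :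
    circ (fun z => g (‖y + a * z‖ ^ 2))
      = mean fun θ => g (‖y‖ ^ 2 + ‖a‖ ^ 2 + 2 * (‖y‖ * ‖a‖ * Real.cos θ)) := by
  have := circ_comp_re (fun r => g (‖y‖ ^ 2 + ‖a‖ ^ 2 + 2 * r)) (conj y * a)
  simp only [norm_mul, RCLike.norm_conj] at this
  rw [← this]
  unfold circ
  congr 1; ext x
  beta_reduce
  rw [norm_add_mul_sq _ _ _ (norm_pt x)]

theorem mean_cos_pow_odd : mean (fun θ => Real.cos θ) = 0 ∧
    mean (fun θ => Real.cos θ ^ 3) = 0 := by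
  have h1 : mean (fun θ => Real.cos θ) = 0 := by simp [mean]
  have h3 := mean_cos_pow_add_two 1
  norm_num [h1] at h3
  exact ⟨h1, h3⟩

theorem mean_cubic_cos (a b c d : ℝ) :
    mean (fun θ => a + b * Real.cos θ + c * Real.cos θ ^ 2 + d * Real.cos θ ^ 3)
      = a + c / 2 := by
  rw [mean_add (by fun_prop) (by fun_prop), mean_add (by fun_prop) (by fun_prop),
    mean_add (by fun_prop) (by fun_prop), mean_const, mean_const_mul, mean_const_mul,
    mean_const_mul, mean_cos_pow_odd.1, mean_cos_pow_odd.2, mean_cos_pow_even.1]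
  ring

theorem circ_norm_pow_four (y a : ℂ) :
    circ (fun z => ‖y + a * z‖ ^ 4) = ‖y‖ ^ 4 + 4 * ‖a‖ ^ 2 * ‖y‖ ^ 2 + ‖a‖ ^ 4 := by
  have h := circ_comp_norm_sq (fun r => r ^ 2) y a
  simp only [← pow_mul] at h
  norm_num at h
  rw [h]
  set S := ‖y‖ ^ 2 + ‖a‖ ^ 2
  have : (fun θ => (S + 2 * (‖y‖ * ‖a‖ * Real.cos θ)) ^ 2) = fun θ => S ^ 2
      + 4 * S * (‖y‖ * ‖a‖) * Real.cos θ + 4 * (‖y‖ * ‖a‖) ^ 2 * Real.cos θ ^ 2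
      + 0 * Real.cos θ ^ 3 := by
    ext θ; ring
  rw [this, mean_cubic_cos]
  ring

theorem circ_norm_pow_six (y a : ℂ) :
    circ (fun z => ‖y + a * z‖ ^ 6)
      = ‖y‖ ^ 6 + 9 * ‖a‖ ^ 2 * ‖y‖ ^ 4 + 9 * ‖a‖ ^ 4 * ‖y‖ ^ 2 + ‖a‖ ^ 6 := by
  have h := circ_comp_norm_sq (fun r => r ^ 3) y a
  simp only [← pow_mul] at h
  norm_num at h
  rw [h]
  set S := ‖y‖ ^ 2 + ‖a‖ ^ 2 with hS
  have : (fun θ => (S + 2 * (‖y‖ * ‖a‖ * Real.cos θ)) ^ 3) = fun θ => S ^ 3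
      + 6 * S ^ 2 * (‖y‖ * ‖a‖) * Real.cos θ + 12 * S * (‖y‖ * ‖a‖) ^ 2 * Real.cos θ ^ 2
      + 8 * (‖y‖ * ‖a‖) ^ 3 * Real.cos θ ^ 3 := by
    ext θ; ring
  rw [this, mean_cubic_cos, hS]
  ring

theorem integral_norm_lin_pow_four (a : ℕ → ℂ) (s : Finset ℕ) :
    ∫ x, ‖lin a s x‖ ^ 4 ∂haar = 2 * (∑ j ∈ s, ‖a j‖ ^ 2) ^ 2 - ∑ j ∈ s, ‖a j‖ ^ 4 := by
  induction s using Finset.induction_on with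
  | empty => simp [lin]
  | insert j s hj ih =>
    rw [integral_lin_insert a hj (f := fun w => ‖w‖ ^ 4) (by fun_prop), Finset.sum_insert hj,
      Finset.sum_insert hj]
    simp_rw [circ_norm_pow_four]
    have h4 : Integrable (fun x => ‖lin a s x‖ ^ 4) haar := integrable_of_continuous (by fun_prop)
    have h2 : Integrable (fun x => 4 * ‖a j‖ ^ 2 * ‖lin a s x‖ ^ 2) haar :=
      integrable_of_continuous (by fun_prop)
    rw [integral_add (f := fun x => ‖lin a s x‖ ^ 4 + 4 * ‖a j‖ ^ 2 * ‖lin a s x‖ ^ 2)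
      (h4.add h2) (integrable_const _), integral_add h4 h2, ih, integral_const_mul,
      integral_norm_lin_sq]
    simp only [integral_const, probReal_univ, smul_eq_mul, one_mul]
    ring

/-- With x = ∑|a_j|² and A = ∑|a_j|⁴ the exact value is 6x³ − 9xA + 4∑|a_j|⁶; replacing the last sum
by xA keeps only the two quantities x and A. Adding a coefficient of modulus b leaves slack 4xb⁴ +
4b²A in the induction. -/
theorem integral_norm_lin_pow_six_le (a : ℕ → ℂ) (s : Finset ℕ) :
    ∫ x, ‖lin a s x‖ ^ 6 ∂haar ≤ 6 * (∑ j ∈ s, ‖a j‖ ^ 2) ^ 3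
      - 5 * (∑ j ∈ s, ‖a j‖ ^ 2) * ∑ j ∈ s, ‖a j‖ ^ 4 := by
  induction s using Finset.induction_on with
  | empty => simp [lin]
  | insert j s hj ih =>
    rw [integral_lin_insert a hj (f := fun w => ‖w‖ ^ 6) (by fun_prop), Finset.sum_insert hj,
      Finset.sum_insert hj]
    simp_rw [circ_norm_pow_six]
    have h6 : Integrable (fun x => ‖lin a s x‖ ^ 6) haar := integrable_of_continuous (by fun_prop)
    have h4 : Integrable (fun x => 9 * ‖a j‖ ^ 2 * ‖lin a s x‖ ^ 4) haar :=
      integrable_of_continuous (by fun_prop)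
    have h2 : Integrable (fun x => 9 * ‖a j‖ ^ 4 * ‖lin a s x‖ ^ 2) haar :=
      integrable_of_continuous (by fun_prop)
    rw [integral_add (f := fun x => ‖lin a s x‖ ^ 6 + 9 * ‖a j‖ ^ 2 * ‖lin a s x‖ ^ 4
      + 9 * ‖a j‖ ^ 4 * ‖lin a s x‖ ^ 2)
      ((h6.add h4).add h2) (integrable_const _),
      integral_add (f := fun x => ‖lin a s x‖ ^ 6 + 9 * ‖a j‖ ^ 2 * ‖lin a s x‖ ^ 4)
      (h6.add h4) h2, integral_add h6 h4, integral_const_mul, integral_const_mul,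
      integral_norm_lin_sq, integral_norm_lin_pow_four]
    simp only [integral_const, probReal_univ, smul_eq_mul, one_mul]
    set x := ∑ j ∈ s, ‖a j‖ ^ 2 with hx
    set A := ∑ j ∈ s, ‖a j‖ ^ 4
    have hx0 : 0 ≤ x := Finset.sum_nonneg fun j _ => by positivity
    have hA0 : 0 ≤ A := Finset.sum_nonneg fun j _ => by positivity
    set b := ‖a j‖
    have h1 : 0 ≤ x * b ^ 4 := by positivity
    have h2 : 0 ≤ b ^ 2 * A := by positivity
    nlinarith

theorem sum_norm_pow_four_le (a : ℕ → ℂ) (s : Finset ℕ) :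
    ∑ j ∈ s, ‖a j‖ ^ 4 ≤ (∑ j ∈ s, ‖a j‖ ^ 2) ^ 2 := by
  have := Finset.sum_sq_le_sq_sum_of_nonneg (s := s) (f := fun j => ‖a j‖ ^ 2)
    (fun j _ => by positivity)
  simpa only [← pow_mul] using this

theorem circ_re_eq_zero {h : ℂ → ℂ} (hc : Continuous fun x => h (pt x))
    (hd : DiffContOnCl ℂ h (Metric.ball 0 1)) (h0 : h 0 = 0) :
    circ (fun z => (h z).re) = 0 := by
  have hz : circ h = 0 := by
    rw [circ_eq_circleAverage, DiffContOnCl.circleAverage, h0]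
    simpa using hd
  have hr := integral_re (𝕜 := ℂ) (μ := haarAddCircle) (f := fun x => h (pt x))
    (hc.integrable_of_hasCompactSupport (HasCompactSupport.of_compactSpace _))
  simp only [RCLike.re_to_complex] at hr
  rw [circ] at hz ⊢
  rw [hr, hz, Complex.zero_re]

/-- Duality against the unimodular function conj(P)/P, where P = 1 + w/2 − w²/8 is the Taylor
polynomial of √(1+w) and w = ρz. Since 1 + w = P² + w³(1/8 − w/64), on the circle the product (1+w)
conj(P)/P is |P|² plus q/P, where q is a polynomial without constant term. The mean of |P|² is 1 +
ρ²/4 + ρ⁴/64, and q/P is holomorphic and vanishes at 0, so it has mean 0. -/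
theorem le_circ_norm_one_add {ρ : ℝ} (h0 : 0 ≤ ρ) (h1 : ρ ≤ 1) :
    1 + ρ ^ 2 / 4 + ρ ^ 4 / 64 ≤ circ (fun z => ‖1 + ρ * z‖) := by
  set P : ℂ → ℂ := fun z => 1 + ρ * z / 2 - (ρ * z) ^ 2 / 8 with hP
  set h : ℂ → ℂ := fun z => (ρ - ρ ^ 3 / 8) * z - ρ ^ 2 / 4 * z ^ 2
    + (ρ ^ 3 * z ^ 3 + ρ ^ 4 * z ^ 2 / 2 - ρ ^ 5 * z / 8) * (1 / 8 - ρ * z / 64) / P z with hh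
  -- On the closed disc |w| ≤ 1, so a zero of P would force 1 ≤ 1/2 + 1/8.
  have hP0 : ∀ z ∈ Metric.closedBall (0 : ℂ) 1, P z ≠ 0 := fun z hz hz0 => by
    have hz1 : ‖z‖ ≤ 1 := by simpa using hz
    have hw : ‖(ρ : ℂ) * z‖ ≤ 1 := by
      rw [norm_mul, Complex.norm_real, Real.norm_of_nonneg h0]
      nlinarith [norm_nonneg z]
    have e : (1 : ℂ) = (ρ * z) ^ 2 / 8 - ρ * z / 2 := by
      simp only [hP] at hz0
      linear_combination hz0
    have : (1 : ℝ) ≤ 1 / 8 + 1 / 2 := by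
      calc (1 : ℝ) = ‖(ρ * z) ^ 2 / 8 - ρ * z / 2‖ := by rw [← e, norm_one]
        _ ≤ ‖((ρ : ℂ) * z) ^ 2 / 8‖ + ‖(ρ : ℂ) * z / 2‖ := norm_sub_le _ _
        _ ≤ _ := by
          rw [norm_div, norm_div, norm_pow]
          norm_num only [RCLike.norm_ofNat]
          nlinarith [norm_nonneg ((ρ : ℂ) * z)]
    norm_num at this
  have hd : DiffContOnCl ℂ h (Metric.ball 0 1) := by
    refine DifferentiableOn.diffContOnCl_ball (U := {z | P z ≠ 0}) (fun z hz => ?_) hP0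
    have : DifferentiableAt ℂ P z := by fun_prop
    exact (((by fun_prop : DifferentiableAt ℂ (fun z : ℂ => ((ρ : ℂ) - ρ ^ 3 / 8) * z
      - ρ ^ 2 / 4 * z ^ 2) z)).add ((by fun_prop : DifferentiableAt ℂ (fun z : ℂ =>
      ((ρ : ℂ) ^ 3 * z ^ 3 + ρ ^ 4 * z ^ 2 / 2 - ρ ^ 5 * z / 8) * (1 / 8 - ρ * z / 64)) z).div
      this hz)).differentiableWithinAt
  have hpt : ∀ x, pt x ∈ Metric.closedBall (0 : ℂ) 1 := fun x => by simp
  have hPc : Continuous fun x => P (pt x) := by fun_prop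
  have hc : Continuous fun x => h (pt x) := by
    simp only [hh]
    exact (by fun_prop : Continuous fun x : UnitAddCircle => ((ρ : ℂ) - ρ ^ 3 / 8) * pt x
      - ρ ^ 2 / 4 * pt x ^ 2).add ((by fun_prop : Continuous fun x : UnitAddCircle =>
      ((ρ : ℂ) ^ 3 * pt x ^ 3 + ρ ^ 4 * pt x ^ 2 / 2 - ρ ^ 5 * pt x / 8)
        * (1 / 8 - ρ * pt x / 64)).div hPc fun x => hP0 _ (hpt x))
  have hz := circ_re_eq_zero hc hd (by simp [hh])
  have hle : ∀ x, (1 + ρ ^ 2 / 4 + ρ ^ 4 / 64) + (h (pt x)).re ≤ ‖1 + (ρ : ℂ) * pt x‖ := fun x => by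
    set z := pt x
    have hPz := hP0 z (hpt x)
    have hzz : z * conj z = 1 := by
      rw [Complex.mul_conj, Complex.normSq_eq_norm_sq, norm_pt]; simp
    have hPb : conj (P z) = 1 + ρ * conj z / 2 - (ρ * conj z) ^ 2 / 8 := by simp [hP, Complex.conj_ofNat]
    set G : ℂ := (ρ - ρ ^ 3 / 8) * z - ρ ^ 2 / 4 * z ^ 2 with hG
    have hGb : conj G = (ρ - ρ ^ 3 / 8) * conj z - ρ ^ 2 / 4 * conj z ^ 2 := by simp [hG, Complex.conj_ofNat]
    set q : ℂ := (ρ ^ 3 * z ^ 3 + ρ ^ 4 * z ^ 2 / 2 - ρ ^ 5 * z / 8) * (1 / 8 - ρ * z / 64)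
      with hq
    have hnum : conj (P z) * ((ρ * z) ^ 3 * (1 / 8 - ρ * z / 64)) = q := by
      rw [hPb, hq]
      linear_combination (ρ ^ 4 * z ^ 2 / 2 - ρ ^ 5 * z * (z * conj z + 1) / 8)
        * (1 / 8 - ρ * z / 64) * hzz
    have hPP : P z * conj (P z) = ((1 + ρ ^ 2 / 4 + ρ ^ 4 / 64 : ℝ) : ℂ) + (G + conj G) / 2 := by
      rw [hPb, hGb, hG]
      simp only [hP]
      push_cast
      linear_combination (ρ ^ 2 / 4 + ρ ^ 4 / 64 * (z * conj z + 1)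
        - ρ ^ 3 / 16 * (z + conj z)) * hzz
    have hsq : 1 + ρ * z = P z ^ 2 + (ρ * z) ^ 3 * (1 / 8 - ρ * z / 64) := by
      simp only [hP]; ring
    have e : (1 + ρ * z) * (conj (P z) / P z)
        = ((1 + ρ ^ 2 / 4 + ρ ^ 4 / 64 : ℝ) : ℂ) + (G + conj G) / 2 + q / P z := by
      rw [← hPP, ← hnum, hsq]; field_simp
    have hre : ((1 + ρ * z) * (conj (P z) / P z)).re
        = (1 + ρ ^ 2 / 4 + ρ ^ 4 / 64) + (h z).re := by
      rw [e, Complex.add_conj]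
      simp only [hh, ← hG, ← hq, Complex.add_re, Complex.ofReal_re]
      rw [show ((2 * G.re : ℝ) : ℂ) / 2 = (G.re : ℂ) by push_cast; ring, Complex.ofReal_re]
      ring
    rw [← hre]
    refine (Complex.re_le_norm _).trans (le_of_eq ?_)
    rw [norm_mul, norm_div, RCLike.norm_conj, div_self (norm_ne_zero_iff.2 hPz), mul_one]
  have hint : Integrable (fun x => (h (pt x)).re) haarAddCircle :=
    (Complex.continuous_re.comp hc).integrable_of_hasCompactSupport
      (HasCompactSupport.of_compactSpace _)
  have := integral_mono ((integrable_const (1 + ρ ^ 2 / 4 + ρ ^ 4 / 64)).add hint)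
    (integrable_comp_pt (f := fun z => ‖1 + (ρ : ℂ) * z‖) (by fun_prop)) hle
  simp only [Pi.add_apply] at this
  rw [integral_add (integrable_const _) hint] at this
  rw [circ] at hz
  rw [hz] at this
  simpa [circ] using this

theorem circ_norm_add_mul (y : ℂ) {a : ℂ} (ha : a ≠ 0) :
    circ (fun z => ‖y + a * z‖) = ‖a‖ * circ (fun z => ‖1 + ((‖y‖ / ‖a‖ : ℝ) : ℂ) * z‖) := by
  have h1 := circ_comp_norm_sq Real.sqrt y a
  have h2 := circ_comp_norm_sq Real.sqrt 1 ((‖y‖ / ‖a‖ : ℝ) : ℂ)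
  simp only [Real.sqrt_sq (norm_nonneg _)] at h1 h2
  rw [h1, h2, ← mean_const_mul]
  have hn : 0 < ‖a‖ := norm_pos_iff.2 ha
  congr 1; ext θ
  rw [Complex.norm_real, Real.norm_of_nonneg (by positivity), norm_one]
  conv_rhs => rw [← Real.sqrt_sq hn.le, ← Real.sqrt_mul (by positivity)]
  congr 1
  field_simp
  rw [Real.sqrt_sq hn.le]
  ring

theorem circ_norm_one_add_inv {ρ : ℝ} (h0 : 0 < ρ) :
    circ (fun z => ‖1 + (ρ : ℂ) * z‖) = ρ * circ (fun z => ‖1 + ((ρ⁻¹ : ℝ) : ℂ) * z‖) := by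
  have := circ_norm_add_mul 1 (a := (ρ : ℂ)) (by exact_mod_cast h0.ne')
  rw [this, Complex.norm_real, Real.norm_of_nonneg h0.le, norm_one, one_div]

/-- This is the numerator that appears in `le_circ_norm_one_add_of_nonneg` for radii above 1, after
multiplication by 64w³; the coefficient 4/25 is 64/400. -/
theorem nonneg_poly {w : ℝ} (hw : 1 ≤ w) :
    0 ≤ 64 * w ^ 4 + 16 * w ^ 2 + 1 - 64 * w ^ 3 - 16 * w ^ 5 - w ^ 7 + 4 / 25 * w ^ 9 := by
  obtain ⟨v, rfl⟩ : ∃ v, w = 1 + v := ⟨w - 1, by ring⟩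
  have hv : 0 ≤ v := by linarith
  nlinarith [pow_nonneg hv 2, pow_nonneg hv 3, pow_nonneg hv 4, pow_nonneg hv 5, pow_nonneg hv 6,
   mul_nonneg hv (sq_nonneg (v-1)), mul_nonneg hv (sq_nonneg (v^2-v)), mul_nonneg hv (sq_nonneg (v^2-1)),
   mul_nonneg hv (sq_nonneg (v^3-v^2)), mul_nonneg hv (sq_nonneg (v^4-v^3)), mul_nonneg hv (sq_nonneg (v^4-v^2)), pow_nonneg hv 7, pow_nonneg hv 8, pow_nonneg hv 9]

/-- After conditioning, ρ is a random radius that may exceed 1, so a polynomial bound on all of [0,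
∞) is needed. For ρ > 1 the circle is inverted, ρ ↦ 1/ρ, and the small term −ρ⁶/400 makes the
polynomial weak enough to hold there. -/
theorem le_circ_norm_one_add_of_nonneg {ρ : ℝ} (h0 : 0 ≤ ρ) :
    1 + ρ ^ 2 / 4 + ρ ^ 4 / 64 - ρ ^ 6 / 400 ≤ circ (fun z => ‖1 + ρ * z‖) := by
  rcases le_or_gt ρ 1 with h1 | h1
  · linarith [le_circ_norm_one_add h0 h1, pow_nonneg h0 6]
  · have hρ : 0 < ρ := by linarith
    have h2 := le_circ_norm_one_add (inv_nonneg.2 h0) (inv_le_one_of_one_le₀ h1.le)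
    rw [circ_norm_one_add_inv hρ]
    refine le_trans ?_ (mul_le_mul_of_nonneg_left h2 h0)
    have h3 := nonneg_poly h1.le
    have h4 : ρ * (1 + ρ⁻¹ ^ 2 / 4 + ρ⁻¹ ^ 4 / 64) - (1 + ρ ^ 2 / 4 + ρ ^ 4 / 64 - ρ ^ 6 / 400)
        = (64 * ρ ^ 4 + 16 * ρ ^ 2 + 1 - 64 * ρ ^ 3 - 16 * ρ ^ 5 - ρ ^ 7 + 4 / 25 * ρ ^ 9)
          / (64 * ρ ^ 3) := by
      field_simp
      ring
    rw [← sub_nonneg, h4]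
    positivity

theorem gamma_three_halves : Real.Gamma (1 + 1 / 2) = Real.sqrt Real.pi / 2 := by
  rw [show (1 : ℝ) + 1 / 2 = 1 / 2 + 1 by norm_num, Real.Gamma_add_one (by norm_num),
    Real.Gamma_one_half_eq]
  ring

/-- Conditioning on the other variables and averaging the polynomial lower bound with ρ = |S'|/b,
where S' is the sum of the other terms and b = |a_j|, involves only the second, fourth and sixth
moments of S'. In terms of x = y/b² ≤ 1 the claim becomes a polynomial inequality on [0, 1]. -/
theorem gamma_le_first_moment_of_large (a : ℕ → ℂ) (s : Finset ℕ) (ha : ∑ j ∈ s, ‖a j‖ ^ 2 = 1)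
    {j : ℕ} (hj : j ∈ s) (h : 1 / 2 ≤ ‖a j‖ ^ 2) :
    Real.Gamma (1 + 1 / 2) ≤ ∫ x, ‖lin a s x‖ ∂haar := by
  obtain ⟨s, hs, rfl⟩ : ∃ t, j ∉ t ∧ s = insert j t :=
    ⟨s.erase j, by simp, (Finset.insert_erase hj).symm⟩
  rw [Finset.sum_insert hs] at ha
  rw [integral_lin_insert a hs (f := fun w => ‖w‖) (by fun_prop)]
  have h0 : a j ≠ 0 := fun h0 => by norm_num [h0] at h
  set b := ‖a j‖ with hb
  have hb0 : 0 < b := norm_pos_iff.2 h0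
  have hcirc : ∀ x, b * (1 + (b ^ 2)⁻¹ / 4 * ‖lin a s x‖ ^ 2 + (b ^ 4)⁻¹ / 64 * ‖lin a s x‖ ^ 4
      - (b ^ 6)⁻¹ / 400 * ‖lin a s x‖ ^ 6) ≤ circ (fun z => ‖lin a s x + a j * z‖) := fun x => by
    rw [circ_norm_add_mul _ h0]
    refine mul_le_mul_of_nonneg_left ?_ hb0.le
    refine le_trans (le_of_eq ?_) (le_circ_norm_one_add_of_nonneg (by positivity))
    rw [← hb]
    field_simp
  have h6 : Integrable (fun x => (b ^ 6)⁻¹ / 400 * ‖lin a s x‖ ^ 6) haar :=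
    integrable_of_continuous (by fun_prop)
  have h4 : Integrable (fun x => (b ^ 4)⁻¹ / 64 * ‖lin a s x‖ ^ 4) haar :=
    integrable_of_continuous (by fun_prop)
  have h2 : Integrable (fun x => (b ^ 2)⁻¹ / 4 * ‖lin a s x‖ ^ 2) haar :=
    integrable_of_continuous (by fun_prop)
  have hcc : Continuous fun x => circ (fun z => ‖lin a s x + a j * z‖) := by
    unfold circ
    exact continuous_parametric_integral_of_continuous (μ := haarAddCircle)
      (f := fun x t => ‖lin a s x + a j * pt t‖)
      (by fun_prop) (s := Set.univ) isCompact_univ |>.congr fun x => by simp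
  have hI := integral_mono (integrable_of_continuous (by fun_prop)) (integrable_of_continuous hcc)
    hcirc
  refine le_trans ?_ hI
  rw [integral_const_mul, integral_sub (f := fun x => 1 + (b ^ 2)⁻¹ / 4 * ‖lin a s x‖ ^ 2
    + (b ^ 4)⁻¹ / 64 * ‖lin a s x‖ ^ 4) (((integrable_const _).add h2).add h4) h6,
    integral_add (f := fun x => 1 + (b ^ 2)⁻¹ / 4 * ‖lin a s x‖ ^ 2)
    ((integrable_const _).add h2) h4, integral_add (integrable_const _) h2, integral_const_mul,
    integral_const_mul, integral_const_mul, integral_norm_lin_sq, integral_norm_lin_pow_four]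
  have h6' := integral_norm_lin_pow_six_le a s
  have h4' := sum_norm_pow_four_le a s
  set y := ∑ j ∈ s, ‖a j‖ ^ 2 with hy
  set A := ∑ j ∈ s, ‖a j‖ ^ 4
  set x := y / b ^ 2 with hx
  have hy0 : 0 ≤ y := Finset.sum_nonneg fun j _ => by positivity
  have hA0 : 0 ≤ A := Finset.sum_nonneg fun j _ => by positivity
  have hx0 : 0 ≤ x := by positivity
  have hx1 : x ≤ 1 := by
    rw [hx, div_le_one (by positivity)]; linarith
  have hyx : y = x * b ^ 2 := by rw [hx]; field_simp
  have hbx : b ^ 2 * (1 + x) = 1 := by linear_combination ha - hyx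
  set B := A / b ^ 4 with hB
  have hAB : A = B * b ^ 4 := by rw [hB]; field_simp
  have hBx : B ≤ x ^ 2 := by
    rw [hB, div_le_iff₀ (by positivity)]; rw [hyx] at h4'; linarith
  have hB0 : 0 ≤ B := by positivity
  have e6 : (b ^ 6)⁻¹ / 400 * ∫ x, ‖lin a s x‖ ^ 6 ∂haar ≤ (6 * x ^ 3 - 5 * x * B) / 400 := by
    have := mul_le_mul_of_nonneg_left h6' (by positivity : 0 ≤ (b ^ 6)⁻¹ / 400)
    refine this.trans (le_of_eq ?_)
    rw [hyx, hAB]; field_simp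
  have e4 : (b ^ 4)⁻¹ / 64 * (2 * y ^ 2 - A) = (2 * x ^ 2 - B) / 64 := by
    rw [hyx, hAB]; field_simp
  have e2 : (b ^ 2)⁻¹ / 4 * y = x / 4 := by
    rw [hyx]; field_simp
  rw [e4, e2]
  simp only [integral_const, probReal_univ, smul_eq_mul, one_mul]
  -- The bound decreases in B, since its coefficient is −1/64 + x/80 < 0 for x ≤ 1; the worst case
  -- is therefore B = x².
  have hlow : 1 + x / 4 + x ^ 2 / 64 - x ^ 3 / 400 ≤ 1 + x / 4 + (2 * x ^ 2 - B) / 64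
      - (b ^ 6)⁻¹ / 400 * ∫ x, ‖lin a s x‖ ^ 6 ∂haar := by
    nlinarith [mul_nonneg (sub_nonneg.2 hx1) (sub_nonneg.2 hBx),
      mul_nonneg hx0 (sub_nonneg.2 hBx)]
  refine le_trans ?_ (mul_le_mul_of_nonneg_left hlow hb0.le)
  rw [gamma_three_halves]
  have hQ : 0 ≤ 1 + x / 4 + x ^ 2 / 64 - x ^ 3 / 400 := by
    nlinarith [pow_nonneg hx0 2, pow_nonneg hx0 3, pow_le_one₀ hx0 hx1 (n := 3)]
  refine abs_le_of_sq_le_sq' ?_ (by positivity) |>.2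
  rw [div_pow, Real.sq_sqrt Real.pi_pos.le, mul_pow]
  -- Since b²(1+x) = 1, the claim is that the square of the polynomial is at least (π/4)(1+x); the
  -- constant 0.7855 lies just above π/4.
  have hQ2 : 7855 / 10000 * (1 + x) ≤ (1 + x / 4 + x ^ 2 / 64 - x ^ 3 / 400) ^ 2 := by
    have h3 : x ^ 3 ≤ x ^ 2 := by nlinarith [pow_nonneg hx0 2]
    have : 0 ≤ x ^ 2 := by positivity
    have h : 1 + x / 4 + x ^ 2 / 80 ≤ 1 + x / 4 + x ^ 2 / 64 - x ^ 3 / 400 := by linarith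
    refine le_trans ?_ (pow_le_pow_left₀ (by positivity) h 2)
    nlinarith [pow_nonneg hx0 3, pow_nonneg hx0 4]
  have : 7855 / 10000 ≤ b ^ 2 * (1 + x / 4 + x ^ 2 / 64 - x ^ 3 / 400) ^ 2 := by
    calc (7855 / 10000 : ℝ) = b ^ 2 * (7855 / 10000 * (1 + x)) := by linear_combination -(7855 / 10000) * hbx
      _ ≤ _ := mul_le_mul_of_nonneg_left hQ2 (by positivity)
  linarith [Real.pi_lt_d4]

theorem gamma_le_first_moment (a : ℕ → ℂ) (s : Finset ℕ) (ha : ∑ j ∈ s, ‖a j‖ ^ 2 = 1) :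
    Real.Gamma (1 + 1 / 2) ≤ ∫ x, ‖lin a s x‖ ∂haar := by
  by_cases h : ∃ j ∈ s, 1 / 2 ≤ ‖a j‖ ^ 2
  · obtain ⟨j, hj, h⟩ := h
    exact gamma_le_first_moment_of_large a s ha hj h
  · push Not at h
    exact gamma_le_first_moment_of_small a s ha fun j hj => (h j hj).le

end

section

open AddCircle Filter Topology

/-! ### Moments of order between one and four -/

theorem exp_neg_le_quadratic {y : ℝ} (hy : 0 ≤ y) : Real.exp (-y) ≤ 1 - y + y ^ 2 / 2 := by
  rw [Real.exp_neg, inv_le_comm₀ (Real.exp_pos _) (by nlinarith [sq_nonneg (y - 1)])]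
  refine le_trans ?_ (Real.quadratic_le_exp_of_nonneg hy)
  rw [inv_le_iff_one_le_mul₀ (by nlinarith [sq_nonneg (y - 1)])]
  nlinarith [pow_nonneg hy 4]

/-- Both functions lie between 1 − t²/4 and 1 − t²/4 + t⁴/32: they agree to second order. -/
theorem abs_exp_sub_bessel_le (t : ℝ) : |Real.exp (-t ^ 2 / 4) - bessel t| ≤ t ^ 4 / 32 := by
  have h1 := le_bessel_two t
  have h2 := bessel_le_four t
  have h3 := exp_neg_le_quadratic (y := t ^ 2 / 4) (by positivity)
  have h4 := Real.one_sub_le_exp_neg (t ^ 2 / 4)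
  have h5 : 0 ≤ t ^ 4 := by positivity
  rw [neg_div, abs_le]
  constructor <;> nlinarith

theorem abs_prod_sub_prod_le {ι : Type*} (s : Finset ι) {u v : ι → ℝ} (hu : ∀ j ∈ s, |u j| ≤ 1)
    (hv : ∀ j ∈ s, |v j| ≤ 1) :
    |∏ j ∈ s, u j - ∏ j ∈ s, v j| ≤ ∑ j ∈ s, |u j - v j| := by
  classical
  induction s using Finset.induction_on with
  | empty => simp
  | insert j s hj ih =>
    have ih := ih (fun i hi => hu i (Finset.mem_insert_of_mem hi))
      fun i hi => hv i (Finset.mem_insert_of_mem hi)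
    rw [Finset.prod_insert hj, Finset.prod_insert hj, Finset.sum_insert hj]
    have hU : |∏ i ∈ s, u i| ≤ 1 := by
      rw [Finset.abs_prod]
      exact Finset.prod_le_one (fun i _ => abs_nonneg _)
        fun i hi => hu i (Finset.mem_insert_of_mem hi)
    calc |u j * ∏ i ∈ s, u i - v j * ∏ i ∈ s, v i|
        = |(u j - v j) * ∏ i ∈ s, u i + v j * (∏ i ∈ s, u i - ∏ i ∈ s, v i)| := by ring_nf
      _ ≤ |u j - v j| * |∏ i ∈ s, u i| + |v j| * |∏ i ∈ s, u i - ∏ i ∈ s, v i| := by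
          rw [← abs_mul, ← abs_mul]; exact abs_add_le _ _
      _ ≤ |u j - v j| * 1 + 1 * |∏ i ∈ s, u i - ∏ i ∈ s, v i| := by
          gcongr
          exact hv j (Finset.mem_insert_self _ _)
      _ ≤ _ := by rw [mul_one, one_mul]; gcongr

theorem abs_besselProd_le_one (a : ℕ → ℂ) (s : Finset ℕ) (t : ℝ) : |besselProd a s t| ≤ 1 := by
  rw [besselProd, Finset.abs_prod]
  exact Finset.prod_le_one (fun i _ => abs_nonneg _) fun i _ => abs_bessel_le_one _

theorem exp_neg_sq_mem (c t : ℝ) (hc : 0 ≤ c) :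
    0 ≤ Real.exp (-(c * t ^ 2) / 4) ∧ Real.exp (-(c * t ^ 2) / 4) ≤ 1 :=
  ⟨(Real.exp_pos _).le, Real.exp_le_one_iff.2 (by have := mul_nonneg hc (sq_nonneg t); linarith)⟩

theorem abs_exp_sub_besselProd_le (a : ℕ → ℂ) (s : Finset ℕ) (t : ℝ) :
    |Real.exp (-((∑ j ∈ s, ‖a j‖ ^ 2) * t ^ 2) / 4) - besselProd a s t|
      ≤ (∑ j ∈ s, ‖a j‖ ^ 4) * t ^ 4 / 32 := by
  have h1 : Real.exp (-((∑ j ∈ s, ‖a j‖ ^ 2) * t ^ 2) / 4)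
      = ∏ j ∈ s, Real.exp (-(‖a j‖ * t) ^ 2 / 4) := by
    rw [← Real.exp_sum, Finset.sum_mul, ← Finset.sum_neg_distrib, Finset.sum_div]
    simp only [mul_pow]
  rw [h1, besselProd]
  refine (abs_prod_sub_prod_le s (fun j _ => ?_) fun j _ => abs_bessel_le_one _).trans ?_
  · have := exp_neg_sq_mem 1 (‖a j‖ * t) zero_le_one
    rw [one_mul] at this
    rw [abs_of_nonneg this.1]; exact this.2
  · rw [Finset.sum_mul, Finset.sum_div]
    refine Finset.sum_le_sum fun j _ => (abs_exp_sub_bessel_le _).trans_eq (by ring)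

theorem one_sub_besselProd_le (a : ℕ → ℂ) (s : Finset ℕ) (t : ℝ) :
    1 - besselProd a s t ≤ (∑ j ∈ s, ‖a j‖ ^ 2) * t ^ 2 / 4 := by
  have h := abs_prod_sub_prod_le s (u := fun _ => 1) (v := fun j => bessel (‖a j‖ * t))
    (fun j _ => by simp) fun j _ => abs_bessel_le_one _
  rw [Finset.prod_const_one] at h
  refine (le_abs_self _).trans (h.trans ?_)
  rw [Finset.sum_mul, Finset.sum_div]
  refine Finset.sum_le_sum fun j _ => ?_
  rw [abs_of_nonneg (by linarith [(abs_le.1 (abs_bessel_le_one (‖a j‖ * t))).2])]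
  have := le_bessel_two (‖a j‖ * t)
  rw [mul_pow] at this
  linarith

theorem abs_exp_sub_bessel_pow_le {N : ℕ} (hN : N ≠ 0) (u : ℝ) :
    |Real.exp (-u ^ 2 / 4) - bessel (u / Real.sqrt N) ^ N| ≤ u ^ 4 / (32 * N) := by
  have hN' : (0 : ℝ) < N := by exact_mod_cast Nat.pos_of_ne_zero hN
  have h := abs_exp_sub_besselProd_le (fun _ => ((Real.sqrt N)⁻¹ : ℝ)) (Finset.range N) u
  have hs : ‖(((Real.sqrt N)⁻¹ : ℝ) : ℂ)‖ = (Real.sqrt N)⁻¹ := by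
    rw [Complex.norm_real, Real.norm_of_nonneg (by positivity)]
  have h2 : (Real.sqrt N) ^ 2 = N := Real.sq_sqrt hN'.le
  have h4 : (Real.sqrt N) ^ 4 = N ^ 2 := by
    rw [show 4 = 2 * 2 by norm_num, pow_mul, h2]
  simp only [besselProd, hs, Finset.sum_const, Finset.prod_const, Finset.card_range, nsmul_eq_mul,
    inv_pow, h2, h4] at h
  rw [mul_inv_cancel₀ hN'.ne', one_mul] at h
  rw [show u / Real.sqrt N = (Real.sqrt N)⁻¹ * u by ring]
  refine h.trans_eq ?_
  field_simp

theorem tendsto_bessel_pow (u : ℝ) :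
    Tendsto (fun n : ℕ => bessel (u / Real.sqrt (n + 1 : ℕ)) ^ (n + 1)) atTop
      (𝓝 (Real.exp (-u ^ 2 / 4))) := by
  have h : Tendsto (fun n : ℕ => u ^ 4 / 32 * (1 / ((n : ℝ) + 1))) atTop (𝓝 (u ^ 4 / 32 * 0)) :=
    tendsto_one_div_add_atTop_nhds_zero_nat.const_mul _
  rw [mul_zero] at h
  rw [tendsto_iff_dist_tendsto_zero]
  refine squeeze_zero (fun n => dist_nonneg) (fun n => ?_) h
  rw [dist_comm, Real.dist_eq]
  refine (abs_exp_sub_bessel_pow_le n.succ_ne_zero u).trans_eq ?_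
  push_cast
  field_simp

/-- By the kernel formula at p = 1 the integral equals the first moment minus σ√π/2, so this is the
first moment inequality at arbitrary variance σ². -/
theorem exp_sub_besselProd_integral_nonneg (a : ℕ → ℂ) (s : Finset ℕ)
    (ha : 0 < ∑ j ∈ s, ‖a j‖ ^ 2) :
    0 ≤ ∫ t in Set.Ioi (0 : ℝ), (Real.exp (-((∑ j ∈ s, ‖a j‖ ^ 2) * t ^ 2) / 4)
      - besselProd a s t) * t ^ (-1 - 1 : ℝ) := by
  set σ := Real.sqrt (∑ j ∈ s, ‖a j‖ ^ 2) with hσ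
  have hσ0 : 0 < σ := Real.sqrt_pos.2 ha
  have hσ2 : σ ^ 2 = ∑ j ∈ s, ‖a j‖ ^ 2 := Real.sq_sqrt ha.le
  have h1 := kernel_moment_lin a s one_pos one_lt_two
  have h2 := integral_one_sub_exp_mul_rpow (b := σ ^ 2 / 4) (by positivity)
  simp only [kernelConst_one, one_mul, Real.rpow_one] at h1
  have h3 := gamma_le_first_moment (fun j => ((σ⁻¹ : ℝ) : ℂ) * a j) s (by
    simp only [norm_mul, mul_pow]
    rw [← Finset.mul_sum, ← hσ2, Complex.norm_real, Real.norm_of_nonneg (by positivity)]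
    field_simp)
  simp only [lin_mul_left, norm_mul] at h3
  rw [integral_const_mul, gamma_three_halves, Complex.norm_real,
    Real.norm_of_nonneg (by positivity)] at h3
  have h4 : ∫ t in Set.Ioi (0 : ℝ), (Real.exp (-((∑ j ∈ s, ‖a j‖ ^ 2) * t ^ 2) / 4)
      - besselProd a s t) * t ^ (-1 - 1 : ℝ) = (∫ x, ‖lin a s x‖ ∂haar)
        - Real.sqrt (Real.pi * (σ ^ 2 / 4)) := by
    rw [← h1.2, ← h2.2, ← integral_sub h1.1 h2.1]
    congr 1; ext t
    rw [← hσ2, show -(σ ^ 2 * t ^ 2) / 4 = -(σ ^ 2 / 4) * t ^ 2 by ring]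
    ring
  rw [h4, Real.sqrt_mul Real.pi_pos.le, show σ ^ 2 / 4 = (σ / 2) ^ 2 by ring,
    Real.sqrt_sq (by positivity)]
  have h5 := mul_le_mul_of_nonneg_left h3 hσ0.le
  rw [← mul_assoc, mul_inv_cancel₀ hσ0.ne', one_mul] at h5
  linarith

/-! ### From order one to orders below four, by adding a Gaussian component -/

theorem exists_extension (a : ℕ → ℂ) (s : Finset ℕ) (l : ℝ) (N : ℕ) :
    ∃ (a' : ℕ → ℂ) (s' : Finset ℕ),
      ∑ j ∈ s', ‖a' j‖ ^ 2 = ∑ j ∈ s, ‖a j‖ ^ 2 + N * l ^ 2 ∧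
      ∀ t, besselProd a' s' t = besselProd a s t * bessel (|l| * t) ^ N := by
  obtain ⟨M, hM⟩ := s.exists_nat_subset_range
  have hlt : ∀ j ∈ s, j < M := fun j hj => Finset.mem_range.1 (hM hj)
  have hd : Disjoint s (Finset.Ico M (M + N)) := Finset.disjoint_left.2 fun j h1 h2 =>
    absurd (hlt j h1) (not_lt.2 (Finset.mem_Ico.1 h2).1)
  set a' : ℕ → ℂ := fun j => if j < M then a j else (l : ℂ)
  have h1 : ∀ j ∈ s, a' j = a j := fun j hj => if_pos (hlt j hj)
  have h2 : ∀ j ∈ Finset.Ico M (M + N), a' j = l := fun j hj =>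
    if_neg (not_lt.2 (Finset.mem_Ico.1 hj).1)
  refine ⟨a', s ∪ Finset.Ico M (M + N), ?_, fun t => ?_⟩
  · rw [Finset.sum_union hd, Finset.sum_congr rfl fun j hj => by rw [h1 j hj],
      Finset.sum_congr (s₁ := Finset.Ico M (M + N)) rfl fun j hj => by rw [h2 j hj]]
    simp
  · rw [besselProd, Finset.prod_union hd, Finset.prod_congr rfl fun j hj => by rw [h1 j hj],
      Finset.prod_congr (s₁ := Finset.Ico M (M + N)) rfl fun j hj => by rw [h2 j hj]]
    simp [besselProd]

/-- The case p = 1 is applied to the sum extended by n + 1 new coefficients l/√(n+1). Their Bessel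
factors J₀(lt/√(n+1))^{n+1} tend to exp(−(lt)²/4), and the common variance 1 + l² makes both terms
of the difference acquire this factor in the limit. -/
theorem exp_sub_besselProd_mul_exp_integral_nonneg (a : ℕ → ℂ) (s : Finset ℕ)
    (ha : ∑ j ∈ s, ‖a j‖ ^ 2 = 1) {l : ℝ} (hl : 0 < l) :
    0 ≤ ∫ t in Set.Ioi (0 : ℝ), (Real.exp (-t ^ 2 / 4) - besselProd a s t)
      * Real.exp (-(l * t) ^ 2 / 4) * t ^ (-1 - 1 : ℝ) := by
  set c := 1 + l ^ 2 with hc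
  have hc0 : 0 < c := by positivity
  have hN : ∀ n : ℕ, ∃ (a' : ℕ → ℂ) (s' : Finset ℕ), ∑ j ∈ s', ‖a' j‖ ^ 2 = c ∧
      ∀ t, besselProd a' s' t
        = besselProd a s t * bessel (l * t / Real.sqrt (n + 1 : ℕ)) ^ (n + 1) := fun n => by
    obtain ⟨a', s', h1, h2⟩ := exists_extension a s (l / Real.sqrt (n + 1 : ℕ)) (n + 1)
    refine ⟨a', s', ?_, fun t => ?_⟩
    · rw [h1, ha, div_pow, Real.sq_sqrt (by positivity)]
      field_simp
      rfl
    · rw [h2, abs_of_nonneg (by positivity)]; congr 3; ring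
  choose a' s' h1 h2 using hN
  set F : ℕ → ℝ → ℝ := fun n t => (Real.exp (-(c * t ^ 2) / 4) - besselProd (a' n) (s' n) t)
    * t ^ (-1 - 1 : ℝ) with hF
  have hlim := tendsto_integral_of_dominated_convergence (F := F)
    (μ := volume.restrict (Set.Ioi (0 : ℝ)))
    (f := fun t => (Real.exp (-t ^ 2 / 4) - besselProd a s t)
      * Real.exp (-(l * t) ^ 2 / 4) * t ^ (-1 - 1 : ℝ))
    (fun t => min 2 (c * t ^ 2 / 2) * t ^ (-1 - 1 : ℝ)) (fun n => ?_) ?_ (fun n => ?_) ?_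
  · refine ge_of_tendsto' hlim fun n => ?_
    have := exp_sub_besselProd_integral_nonneg (a' n) (s' n) (by rw [h1]; exact hc0)
    rwa [h1] at this
  · have := (continuous_besselProd (a' n) (s' n)).measurable
    exact (((by fun_prop : Measurable fun t : ℝ => Real.exp (-(c * t ^ 2) / 4)).sub this).mul
      (by fun_prop)).aestronglyMeasurable
  · refine integrableOn_Ioi_mul_rpow (α := 2) (β := 0) (C := c + 2) (by fun_prop) (by norm_num)
      (by norm_num) (fun t h0 h1 => ?_) fun t h1 => ?_
    · rw [abs_of_nonneg (by positivity), Real.rpow_two]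
      refine (min_le_right _ _).trans ?_
      nlinarith [sq_nonneg t]
    · rw [abs_of_nonneg (by positivity), Real.rpow_zero]
      exact (min_le_left _ _).trans (by linarith)
  · refine (ae_restrict_mem measurableSet_Ioi).mono fun t ht => ?_
    have ht0 : 0 < t := ht
    simp only [hF, norm_mul, Real.norm_eq_abs]
    rw [abs_of_nonneg (Real.rpow_nonneg ht0.le _)]
    refine mul_le_mul_of_nonneg_right ?_ (Real.rpow_nonneg ht0.le _)
    have e1 := exp_neg_sq_mem c t hc0.le
    have e2 := abs_le.1 (abs_besselProd_le_one (a' n) (s' n) t)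
    have e3 := one_sub_besselProd_le (a' n) (s' n) t
    rw [h1] at e3
    have e4 := Real.one_sub_le_exp_neg (c * t ^ 2 / 4)
    rw [← neg_div] at e4
    rw [abs_le]
    constructor
    · rw [neg_le]
      exact le_min (by linarith) (by nlinarith [mul_pos hc0 (pow_pos ht0 2)])
    · exact le_min (by linarith) (by nlinarith [mul_pos hc0 (pow_pos ht0 2)])
  · refine Eventually.of_forall fun t => ?_
    refine Tendsto.mul_const _ ?_
    have e : Real.exp (-(c * t ^ 2) / 4) = Real.exp (-t ^ 2 / 4) * Real.exp (-(l * t) ^ 2 / 4) := by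
      rw [← Real.exp_add]; congr 1; rw [hc]; ring
    simp only [h2, e, sub_mul]
    exact ((tendsto_bessel_pow (l * t)).const_mul _).const_sub _

theorem exp_sub_besselProd_integrableOn (a : ℕ → ℂ) (s : Finset ℕ)
    (ha : ∑ j ∈ s, ‖a j‖ ^ 2 = 1) {p : ℝ} (hp : 0 < p) (hp4 : p < 4) :
    IntegrableOn (fun t => (Real.exp (-t ^ 2 / 4) - besselProd a s t) * t ^ (-1 - p))
      (Set.Ioi 0) := by
  have hm := (continuous_besselProd a s).measurable
  refine integrableOn_Ioi_mul_rpow (α := 4) (β := 0) (C := 2) (by fun_prop) hp4 hp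
    (fun t h0 h1 => ?_) fun t h1 => ?_
  · have h := abs_exp_sub_besselProd_le a s t
    have h4 := sum_norm_pow_four_le a s
    rw [ha, one_mul] at h
    rw [ha, one_pow] at h4
    have : t ^ (4 : ℝ) = t ^ 4 := by exact_mod_cast Real.rpow_natCast t 4
    rw [this]
    refine h.trans ?_
    nlinarith [pow_pos h0 4]
  · have e1 := exp_neg_sq_mem 1 t zero_le_one
    have e2 := abs_le.1 (abs_besselProd_le_one a s t)
    rw [one_mul] at e1
    rw [Real.rpow_zero, abs_le]
    constructor <;> linarith

theorem integral_rpow_mul_exp_sq {p : ℝ} (hp : 1 < p) {t : ℝ} (ht : 0 < t) :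
    IntegrableOn (fun l : ℝ => l ^ (p - 2) * Real.exp (-(l * t) ^ 2 / 4)) (Set.Ioi 0) ∧
    ∫ l in Set.Ioi (0 : ℝ), l ^ (p - 2) * Real.exp (-(l * t) ^ 2 / 4)
      = (∫ l in Set.Ioi (0 : ℝ), l ^ (p - 2) * Real.exp (-l ^ 2 / 4)) * t ^ (1 - p) := by
  have hb : 0 < t ^ 2 / 4 := by positivity
  have e : ∀ t : ℝ, (fun l : ℝ => l ^ (p - 2) * Real.exp (-(l * t) ^ 2 / 4))
      = fun l : ℝ => l ^ (p - 2) * Real.exp (-(t ^ 2 / 4) * l ^ (2 : ℝ)) := fun t => by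
    ext l; rw [Real.rpow_two]; congr 2; ring
  have e1 : (fun l : ℝ => l ^ (p - 2) * Real.exp (-l ^ 2 / 4))
      = fun l : ℝ => l ^ (p - 2) * Real.exp (-(1 ^ 2 / 4) * l ^ (2 : ℝ)) := by
    rw [← e 1]; simp
  rw [e, e1]
  refine ⟨integrableOn_rpow_mul_exp_neg_mul_rpow (by linarith) two_pos hb, ?_⟩
  rw [integral_rpow_mul_exp_neg_mul_rpow two_pos (by linarith) hb,
    integral_rpow_mul_exp_neg_mul_rpow two_pos (by linarith) (by norm_num),
    show t ^ 2 / 4 = 1 ^ 2 / 4 * t ^ 2 by ring,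
    Real.mul_rpow (by norm_num) (by positivity), ← Real.rpow_natCast t 2, ← Real.rpow_mul ht.le,
    show ((2 : ℕ) : ℝ) * (-(p - 2 + 1) / 2) = 1 - p by push_cast; ring]
  ring

/-- Integrating the previous inequality against l^{p−2} dl turns exp(−(lt)²/4) t^{-2} into a
positive multiple of t^{-1-p}. The weight is integrable at l = 0 because p > 1; the result is
integrable at t = 0 because p < 4 and the difference is O(t⁴). -/
theorem exp_sub_besselProd_integral_rpow_nonneg (a : ℕ → ℂ) (s : Finset ℕ)
    (ha : ∑ j ∈ s, ‖a j‖ ^ 2 = 1) {p : ℝ} (hp : 1 < p) (hp4 : p < 4) :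
    0 ≤ ∫ t in Set.Ioi (0 : ℝ), (Real.exp (-t ^ 2 / 4) - besselProd a s t) * t ^ (-1 - p) := by
  set g : ℝ → ℝ := fun t => Real.exp (-t ^ 2 / 4) - besselProd a s t with hg
  have hgm : Measurable g := by
    have hm := (continuous_besselProd a s).measurable
    fun_prop
  have hgi := exp_sub_besselProd_integrableOn a s ha (by linarith) hp4
  set c := ∫ l in Set.Ioi (0 : ℝ), l ^ (p - 2) * Real.exp (-l ^ 2 / 4) with hc
  have hc0 : 0 < c := by
    have h := integral_rpow_mul_exp_sq hp one_pos
    simp only [mul_one] at h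
    refine integral_pos_of_pos_Ioo h.1 (fun t ht => ?_) fun t ht _ => ?_ <;> positivity
  set ν := volume.restrict (Set.Ioi (0 : ℝ)) with hν
  set F : ℝ → ℝ → ℝ := fun t l => g t * t ^ (-1 - 1 : ℝ) * (l ^ (p - 2)
    * Real.exp (-(l * t) ^ 2 / 4)) with hF
  have hFm : Measurable (Function.uncurry F) := by
    simp only [hF, Function.uncurry_def]
    fun_prop
  have hpow : ∀ t : ℝ, 0 < t → t ^ (-1 - 1 : ℝ) * (c * t ^ (1 - p)) = c * t ^ (-1 - p) :=
    fun t ht => by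
      rw [mul_left_comm, ← Real.rpow_add ht]; ring_nf
  have hFi : Integrable (Function.uncurry F) (ν.prod ν) := by
    rw [integrable_prod_iff hFm.aestronglyMeasurable]
    constructor
    · refine (ae_restrict_mem measurableSet_Ioi).mono fun t ht => ?_
      exact (((integral_rpow_mul_exp_sq hp ht).1).const_mul (g t * t ^ (-1 - 1 : ℝ))).congr
        (Eventually.of_forall fun _ => rfl)
    · refine ((hgi.norm.const_mul c).congr ?_)
      refine (ae_restrict_mem measurableSet_Ioi).mono fun t ht => ?_
      have ht0 : 0 < t := ht
      have : ∫ l, ‖F t l‖ ∂ν = |g t| * t ^ (-1 - 1 : ℝ) * (c * t ^ (1 - p)) := by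
        rw [hc, ← (integral_rpow_mul_exp_sq hp ht0).2, ← integral_const_mul]
        refine integral_congr_ae ((ae_restrict_mem measurableSet_Ioi).mono fun l hl => ?_)
        have hl0 : 0 < l := hl
        simp only [hF, norm_mul, Real.norm_eq_abs, Real.abs_exp]
        rw [abs_of_nonneg (Real.rpow_nonneg ht0.le _), abs_of_nonneg (Real.rpow_nonneg hl0.le _)]
      simp only [Function.uncurry_apply_pair]
      rw [this, mul_assoc, hpow t ht0, norm_mul, Real.norm_eq_abs, Real.norm_eq_abs,
        abs_of_nonneg (Real.rpow_nonneg ht0.le _)]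
      ring
  have hswap := integral_integral_swap hFi
  have h1 : ∫ t, ∫ l, F t l ∂ν ∂ν = c * ∫ t in Set.Ioi (0 : ℝ), g t * t ^ (-1 - p) := by
    rw [← integral_const_mul]
    refine integral_congr_ae ((ae_restrict_mem measurableSet_Ioi).mono fun t ht => ?_)
    simp only [hF]
    rw [integral_const_mul, (integral_rpow_mul_exp_sq hp ht).2, mul_assoc, hpow t ht]
    ring
  have h2 : 0 ≤ ∫ l, ∫ t, F t l ∂ν ∂ν := by
    refine integral_nonneg_of_ae ((ae_restrict_mem measurableSet_Ioi).mono fun l hl => ?_)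
    have hl0 : 0 < l := hl
    have h := exp_sub_besselProd_mul_exp_integral_nonneg a s ha hl0
    have e : ∫ t, F t l ∂ν = l ^ (p - 2) * ∫ t in Set.Ioi (0 : ℝ),
        (Real.exp (-t ^ 2 / 4) - besselProd a s t)
          * Real.exp (-(l * t) ^ 2 / 4) * t ^ (-1 - 1 : ℝ) := by
      rw [← integral_const_mul]
      congr 1; ext t
      simp only [hF, hg]; ring
    change 0 ≤ ∫ t, F t l ∂ν
    rw [e]
    exact mul_nonneg (Real.rpow_nonneg hl0.le _) h
  rw [← hswap, h1] at h2
  exact nonneg_of_mul_nonneg_right h2 hc0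

theorem gamma_le_moment (a : ℕ → ℂ) (s : Finset ℕ) (ha : ∑ j ∈ s, ‖a j‖ ^ 2 = 1) {p : ℝ}
    (hp : 1 ≤ p) (hp2 : p < 2) : Real.Gamma (1 + p / 2) ≤ ∫ x, ‖lin a s x‖ ^ p ∂haar := by
  rcases hp.eq_or_lt with rfl | hp
  · simpa using gamma_le_first_moment a s ha
  have hp0 : 0 < p := by linarith
  have h := exp_sub_besselProd_integral_rpow_nonneg a s ha hp (by linarith)
  have h1 := kernel_moment_lin a s hp0 hp2
  have h2 := kernel_moment_gauss hp0 hp2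
  refine le_of_mul_le_mul_left ?_ (kernelConst_pos hp0 hp2)
  rw [← h1.2, ← h2.2, ← sub_nonneg, ← integral_sub h1.1 h2.1]
  refine h.trans_eq ?_
  congr 1; ext t; ring

/-- The corrections −1 + t²/4 cancel, and the same integral as for p < 2 appears; but J₀ enters this
kernel with the opposite sign, which reverses the inequality between the moments. At p = 2 there is
equality. -/
theorem moment_le_gamma_of_lt_four (a : ℕ → ℂ) (s : Finset ℕ) (ha : ∑ j ∈ s, ‖a j‖ ^ 2 = 1)
    {p : ℝ} (hp : 2 ≤ p) (hp4 : p < 4) :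
    ∫ x, ‖lin a s x‖ ^ p ∂haar ≤ Real.Gamma (1 + p / 2) := by
  rcases hp.eq_or_lt with rfl | hp
  · simp_rw [Real.rpow_two]
    rw [integral_norm_lin_sq, ha]
    norm_num
  have h := exp_sub_besselProd_integral_rpow_nonneg a s ha (by linarith) hp4
  have h1 := kernel_moment_lin' a s ha hp hp4
  have h2 := kernel_moment_gauss' hp hp4
  refine le_of_mul_le_mul_left ?_ (kernelConst'_pos hp hp4)
  rw [← h1.2, ← h2.2, ← sub_nonneg, ← integral_sub h2.1 h1.1]
  refine h.trans_eq ?_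
  congr 1; ext t; ring

/-- For p < 2 convergence of moments follows directly from dominated convergence in the kernel
formula, the transforms being bounded by min(2, t²/4). -/
theorem tendsto_moment {a : ℕ → ℕ → ℂ} {s : ℕ → Finset ℕ}
    (ha : ∀ n, ∑ j ∈ s n, ‖a n j‖ ^ 2 = 1)
    (hlim : ∀ t, Tendsto (fun n => besselProd (a n) (s n) t) atTop (𝓝 (Real.exp (-t ^ 2 / 4))))
    {p : ℝ} (hp : 1 ≤ p) (hp2 : p < 2) :
    Tendsto (fun n => ∫ x, ‖lin (a n) (s n) x‖ ^ p ∂haar) atTop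
      (𝓝 (Real.Gamma (1 + p / 2))) := by
  have hp0 : 0 < p := by linarith
  have hk := kernelConst_pos hp0 hp2
  have hκ : Tendsto (fun n => ∫ t in Set.Ioi (0 : ℝ), (1 - besselProd (a n) (s n) t) * t ^ (-1 - p))
      atTop (𝓝 (∫ t in Set.Ioi (0 : ℝ), (1 - Real.exp (-t ^ 2 / 4)) * t ^ (-1 - p))) := by
    refine tendsto_integral_of_dominated_convergence
      (fun t => min 2 (t ^ 2 / 4) * t ^ (-1 - p)) (fun n => ?_) ?_ (fun n => ?_) ?_
    · exact (kernel_moment_lin (a n) (s n) hp0 hp2).1.aestronglyMeasurable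
    · refine integrableOn_Ioi_mul_rpow (α := 2) (β := 0) (C := 2) (by fun_prop) hp2 hp0
        (fun t h0 h1 => ?_) fun t h1 => ?_
      · rw [abs_of_nonneg (by positivity), Real.rpow_two]
        refine (min_le_right _ _).trans ?_
        nlinarith [sq_nonneg t]
      · rw [abs_of_nonneg (by positivity), Real.rpow_zero, mul_one]
        exact min_le_left _ _
    · refine (ae_restrict_mem measurableSet_Ioi).mono fun t ht => ?_
      have ht0 : 0 < t := ht
      have e2 := abs_le.1 (abs_besselProd_le_one (a n) (s n) t)
      have e3 := one_sub_besselProd_le (a n) (s n) t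
      rw [ha, one_mul] at e3
      rw [norm_mul, Real.norm_eq_abs, Real.norm_eq_abs,
        abs_of_nonneg (Real.rpow_nonneg ht0.le _), abs_of_nonneg (by linarith)]
      exact mul_le_mul_of_nonneg_right (le_min (by linarith) e3) (Real.rpow_nonneg ht0.le _)
    · exact Eventually.of_forall fun t => ((hlim t).const_sub _).mul_const _
  have h := hκ.const_mul (kernelConst p)⁻¹
  rw [(kernel_moment_gauss hp0 hp2).2, ← mul_assoc, inv_mul_cancel₀ hk.ne', one_mul] at h
  refine h.congr fun n => ?_
  rw [(kernel_moment_lin (a n) (s n) hp0 hp2).2, ← mul_assoc, inv_mul_cancel₀ hk.ne', one_mul]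

end

section

open AddCircle Filter Topology

/-! ### Moments of order at least two -/

theorem norm_rpow_eq_sq_rpow (w : ℂ) (p : ℝ) : ‖w‖ ^ p = (‖w‖ ^ 2) ^ (p / 2) := by
  rw [← Real.rpow_natCast ‖w‖ 2, ← Real.rpow_mul (norm_nonneg w)]
  congr 1; push_cast; ring

theorem circ_neg {E : Type*} [NormedAddCommGroup E] [NormedSpace ℝ E] (f : ℂ → E) :
    circ (fun z => f (-z)) = circ f := by
  simpa using circ_mul_left (c := -1) (by simp) f

/-- Circular means of convex functions increase with the radius: u + tz is a convex combination of u
+ rz and u − rz, and these two have the same mean by the symmetry z ↦ −z. -/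
theorem circ_norm_rpow_le_of_le (u : ℂ) {p : ℝ} (hp : 1 ≤ p) {t r : ℝ} (ht : 0 ≤ t) (htr : t ≤ r) :
    circ (fun z => ‖u + t * z‖ ^ p) ≤ circ (fun z => ‖u + r * z‖ ^ p) := by
  rcases ht.trans htr |>.eq_or_lt with hr | hr
  · have : t = r := by linarith
    rw [this]
  have hp0 : 0 ≤ p := by linarith
  set l := (1 + t / r) / 2 with hl
  have h1 : t / r ≤ 1 := (div_le_one hr).2 htr
  have h0 : 0 ≤ t / r := by positivity
  have hi : ∀ c : ℝ, Integrable (fun x => ‖u + c * pt x‖ ^ p) haarAddCircle := fun c =>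
    integrable_comp_pt (f := fun z => ‖u + c * z‖ ^ p)
      ((by fun_prop : Continuous fun z : ℂ => ‖u + c * z‖).rpow_const fun _ => Or.inr hp0)
  have key : ∀ x, ‖u + t * pt x‖ ^ p
      ≤ l * ‖u + r * pt x‖ ^ p + (1 - l) * ‖u + (-r : ℝ) * pt x‖ ^ p := fun x => by
    have e : u + t * pt x = l * (u + r * pt x) + (1 - l : ℝ) * (u + (-r : ℝ) * pt x) := by
      have : t = (2 * l - 1) * r := by rw [hl]; field_simp; ring
      rw [this]; push_cast; ring
    have h2 : ‖u + t * pt x‖ ≤ l * ‖u + r * pt x‖ + (1 - l) * ‖u + (-r : ℝ) * pt x‖ := by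
      rw [e]
      refine (norm_add_le _ _).trans (le_of_eq ?_)
      rw [norm_mul, norm_mul, Complex.norm_real, Complex.norm_real,
        Real.norm_of_nonneg (by linarith), Real.norm_of_nonneg (by linarith)]
    refine (Real.rpow_le_rpow (norm_nonneg _) h2 hp0).trans ?_
    have := (convexOn_rpow hp).2 (Set.mem_Ici.2 (norm_nonneg (u + r * pt x)))
      (Set.mem_Ici.2 (norm_nonneg (u + (-r : ℝ) * pt x))) (show 0 ≤ l by linarith)
      (show 0 ≤ 1 - l by linarith) (by ring)
    simpa only [smul_eq_mul] using this
  have hneg : ∫ x, ‖u + (-r : ℝ) * pt x‖ ^ p ∂haarAddCircle = circ (fun z => ‖u + r * z‖ ^ p) := by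
    rw [← circ_neg (fun z => ‖u + r * z‖ ^ p), circ]
    congr 1; ext x; congr 2; push_cast; ring
  calc circ (fun z => ‖u + t * z‖ ^ p)
      ≤ ∫ x, l * ‖u + r * pt x‖ ^ p + (1 - l) * ‖u + (-r : ℝ) * pt x‖ ^ p ∂haarAddCircle :=
        integral_mono (hi t) (((hi r).const_mul _).add ((hi (-r)).const_mul _)) key
    _ = _ := by
        rw [integral_add ((hi r).const_mul _) ((hi (-r)).const_mul _), integral_const_mul,
          integral_const_mul, hneg, circ]
        ring

/-- The squared norm of `u + r * exp (i θ)`. -/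
def chordSq (u r θ : ℝ) : ℝ := u ^ 2 + r ^ 2 + 2 * (u * r * Real.cos θ)

theorem chordSq_nonneg (u r θ : ℝ) : 0 ≤ chordSq u r θ := by
  have h := Real.sin_sq_add_cos_sq θ
  have : chordSq u r θ = (r + u * Real.cos θ) ^ 2 + (u * Real.sin θ) ^ 2 := by
    rw [chordSq]; linear_combination -u ^ 2 * h
  rw [this]; positivity

theorem hasDerivAt_chordSq_rpow_radius (u r θ : ℝ) {q : ℝ} (hq : 1 ≤ q) :
    HasDerivAt (fun s => chordSq u s θ ^ q)
      ((2 * r + 2 * (u * Real.cos θ)) * q * chordSq u r θ ^ (q - 1)) r := by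
  refine HasDerivAt.rpow_const ?_ (Or.inr hq)
  unfold chordSq
  have := (((hasDerivAt_id r).pow 2).const_add (u ^ 2)).add
    ((((hasDerivAt_id r).const_mul u).mul_const (Real.cos θ)).const_mul 2)
  refine this.congr_deriv ?_
  simp

theorem hasDerivAt_chordSq_rpow_angle (u r θ : ℝ) {q : ℝ} (hq : 1 ≤ q) :
    HasDerivAt (fun θ => chordSq u r θ ^ q)
      ((-(2 * (u * r * Real.sin θ))) * q * chordSq u r θ ^ (q - 1)) θ := by
  refine HasDerivAt.rpow_const ?_ (Or.inr hq)
  unfold chordSq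
  have := ((((Real.hasDerivAt_cos θ).const_mul (u * r))).const_mul 2).const_add (u ^ 2 + r ^ 2)
  refine this.congr_deriv ?_
  ring

theorem continuous_chordSq_rpow (u : ℝ) {q : ℝ} (hq : 0 ≤ q) :
    Continuous fun v : ℝ × ℝ => chordSq u v.1 v.2 ^ q :=
  (by unfold chordSq; fun_prop : Continuous fun v : ℝ × ℝ => chordSq u v.1 v.2).rpow_const
    fun _ => Or.inr hq

theorem mean_eq_zero_of_hasDerivAt {f f' : ℝ → ℝ} (hf : ∀ θ, HasDerivAt f (f' θ) θ)
    (hc : Continuous f') (h : f (2 * Real.pi) = f 0) : mean f' = 0 := by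
  rw [mean, intervalIntegral.integral_eq_sub_of_hasDerivAt (fun θ _ => hf θ)
    (hc.intervalIntegrable _ _), h, sub_self, mul_zero]

/-- This is the divergence theorem for the planar field w|w|^{2q}, whose divergence is
(2q+2)|w|^{2q}: the left-hand mean is the normalized flux through the circle of centre u and radius
s. Concretely, the r-derivative of the integrand differs from (2q+2) r |w|^{2q} by the θ-derivative
of u sin θ |w|^{2q}, which has mean 0. -/
theorem hasDerivAt_mean_chordSq (u r : ℝ) {q : ℝ} (hq : 1 ≤ q) :
    HasDerivAt (fun s => mean fun θ => (s ^ 2 + u * s * Real.cos θ) * chordSq u s θ ^ q)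
      ((2 * q + 2) * r * mean fun θ => chordSq u r θ ^ q) r := by
  have hc := continuous_chordSq_rpow u (q := q) (by linarith)
  have hc1 := continuous_chordSq_rpow u (q := q - 1) (by linarith)
  have hcr : Continuous fun θ => chordSq u r θ ^ q :=
    hc.comp (by fun_prop : Continuous fun θ : ℝ => (r, θ))
  have hcr1 : Continuous fun θ => chordSq u r θ ^ (q - 1) :=
    hc1.comp (by fun_prop : Continuous fun θ : ℝ => (r, θ))
  have h1 := hasDerivAt_mean
    (f := fun s θ => (s ^ 2 + u * s * Real.cos θ) * chordSq u s θ ^ q)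
    (f' := fun s θ => (2 * s + u * Real.cos θ) * chordSq u s θ ^ q
      + (s ^ 2 + u * s * Real.cos θ)
        * ((2 * s + 2 * (u * Real.cos θ)) * q * chordSq u s θ ^ (q - 1)))
    (by
      simp only [Function.uncurry_def]
      exact (by fun_prop : Continuous fun v : ℝ × ℝ => v.1 ^ 2 + u * v.1 * Real.cos v.2).mul hc)
    (by
      simp only [Function.uncurry_def]
      exact ((by fun_prop : Continuous fun v : ℝ × ℝ => 2 * v.1 + u * Real.cos v.2).mul hc).add
          ((by fun_prop : Continuous fun v : ℝ × ℝ => v.1 ^ 2 + u * v.1 * Real.cos v.2).mul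
            ((by fun_prop : Continuous fun v : ℝ × ℝ => (2 * v.1 + 2 * (u * Real.cos v.2)) * q).mul
              hc1)))
    (fun s θ => by
      have h2 := (((hasDerivAt_id s).pow 2).add
        (((hasDerivAt_id s).const_mul u).mul_const (Real.cos θ))).mul
        (hasDerivAt_chordSq_rpow_radius u s θ hq)
      refine h2.congr_deriv ?_
      simp) r
  refine h1.congr_deriv ?_
  set D : ℝ → ℝ := fun θ => u * (Real.cos θ * chordSq u r θ ^ q
    + Real.sin θ * ((-(2 * (u * r * Real.sin θ))) * q * chordSq u r θ ^ (q - 1))) with hD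
  have hDc : Continuous D := by
    simp only [hD]
    fun_prop
  have hD0 : mean D = 0 := by
    refine mean_eq_zero_of_hasDerivAt (f := fun θ => u * (Real.sin θ * chordSq u r θ ^ q))
      (fun θ => ?_) hDc (by simp)
    exact ((Real.hasDerivAt_sin θ).mul (hasDerivAt_chordSq_rpow_angle u r θ hq)).const_mul u
  have e : (fun θ => (2 * r + u * Real.cos θ) * chordSq u r θ ^ q
      + (r ^ 2 + u * r * Real.cos θ)
        * ((2 * r + 2 * (u * Real.cos θ)) * q * chordSq u r θ ^ (q - 1)))
      = fun θ => (2 * q + 2) * r * chordSq u r θ ^ q + D θ := by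
    ext θ
    have hpow : chordSq u r θ ^ q = chordSq u r θ * chordSq u r θ ^ (q - 1) := by
      rcases (chordSq_nonneg u r θ).eq_or_lt with h0 | h0
      · rw [← h0, Real.zero_rpow (by linarith), zero_mul]
      · rw [Real.rpow_sub_one h0.ne']; field_simp
    have h := Real.sin_sq_add_cos_sq θ
    simp only [hD]
    have h3 : chordSq u r θ = u ^ 2 + r ^ 2 + 2 * (u * r * Real.cos θ) := rfl
    set P := chordSq u r θ ^ (q - 1)
    rw [hpow, h3]
    linear_combination (2 * r * q * P * u ^ 2) * h
  rw [e, mean_add (by fun_prop) hDc, hD0, add_zero, mean_const_mul]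

theorem circ_norm_rpow_eq_mean (y a : ℂ) (p : ℝ) :
    circ (fun z => ‖y + a * z‖ ^ p) = mean fun θ => chordSq ‖y‖ ‖a‖ θ ^ (p / 2) := by
  simp_rw [norm_rpow_eq_sq_rpow _ p]
  exact circ_comp_norm_sq (fun R => R ^ (p / 2)) y a

theorem mean_chordSq_le_of_le {u : ℝ} (hu : 0 ≤ u) {q : ℝ} (hq : 1 ≤ q) {t r : ℝ} (ht : 0 ≤ t)
    (htr : t ≤ r) :
    mean (fun θ => chordSq u t θ ^ q) ≤ mean (fun θ => chordSq u r θ ^ q) := by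
  have h := circ_norm_rpow_le_of_le u (p := 2 * q) (by linarith) ht htr
  rw [circ_norm_rpow_eq_mean, circ_norm_rpow_eq_mean] at h
  simpa [abs_of_nonneg, hu, ht, ht.trans htr] using h

/-- The flux formula is integrated over radii in [0, r], and each circular mean is bounded by the
one at radius r; the factor is ∫₀^r (2q+2) t dt = (1+q) r². -/
theorem mean_chordSq_mul_le {u : ℝ} (hu : 0 ≤ u) {q : ℝ} (hq : 1 ≤ q) {r : ℝ} (hr : 0 ≤ r) :
    mean (fun θ => (r ^ 2 + u * r * Real.cos θ) * chordSq u r θ ^ q)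
      ≤ (1 + q) * r ^ 2 * mean (fun θ => chordSq u r θ ^ q) := by
  set M := mean (fun θ => chordSq u r θ ^ q) with hM
  set f : ℝ → ℝ := fun t => (1 + q) * M * t ^ 2
    - mean (fun θ => (t ^ 2 + u * t * Real.cos θ) * chordSq u t θ ^ q) with hf
  have hd : ∀ t, HasDerivAt f ((2 * q + 2) * t * (M - mean fun θ => chordSq u t θ ^ q)) t :=
    fun t => by
      refine ((((hasDerivAt_id t).pow 2).const_mul ((1 + q) * M)).sub
        (hasDerivAt_mean_chordSq u t hq)).congr_deriv ?_
      simp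
      ring
  have hmono : MonotoneOn f (Set.Icc 0 r) := by
    refine monotoneOn_of_deriv_nonneg (convex_Icc 0 r)
      (fun t _ => (hd t).continuousAt.continuousWithinAt)
      (fun t _ => (hd t).differentiableAt.differentiableWithinAt) fun t ht => ?_
    rw [interior_Icc] at ht
    rw [(hd t).deriv]
    have := mean_chordSq_le_of_le hu hq ht.1.le ht.2.le
    exact mul_nonneg (mul_nonneg (by linarith) ht.1.le) (by linarith)
  have h := hmono (Set.left_mem_Icc.2 hr) (Set.right_mem_Icc.2 hr) hr
  have h0 : f 0 = 0 := by simp [hf, mean_const]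
  rw [h0] at h
  simp only [hf] at h
  linarith

theorem re_mul_conj_add (y w : ℂ) :
    (w * conj (y + w)).re = (‖y + w‖ ^ 2 + ‖w‖ ^ 2 - ‖y‖ ^ 2) / 2 := by
  simp only [← Complex.normSq_eq_norm_sq, Complex.normSq_apply, Complex.mul_re, Complex.add_re,
    Complex.add_im, Complex.conj_re, Complex.conj_im]
  ring

theorem circ_re_mul_norm_rpow_le (y a : ℂ) {p : ℝ} (hp : 2 ≤ p) :
    circ (fun z => (a * z * conj (y + a * z)).re * ‖y + a * z‖ ^ p)
      ≤ (1 + p / 2) * ‖a‖ ^ 2 * circ (fun z => ‖y + a * z‖ ^ p) := by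
  rw [circ_norm_rpow_eq_mean]
  refine le_trans (le_of_eq ?_)
    (mean_chordSq_mul_le (norm_nonneg y) (q := p / 2) (by linarith) (norm_nonneg a))
  have h := circ_comp_norm_sq (fun R => (R + ‖a‖ ^ 2 - ‖y‖ ^ 2) / 2 * R ^ (p / 2)) y a
  have e : circ (fun z => (a * z * conj (y + a * z)).re * ‖y + a * z‖ ^ p)
      = circ (fun z => (‖y + a * z‖ ^ 2 + ‖a‖ ^ 2 - ‖y‖ ^ 2) / 2
        * (‖y + a * z‖ ^ 2) ^ (p / 2)) := by
    unfold circ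
    congr 1; ext x
    beta_reduce
    rw [re_mul_conj_add, norm_mul, norm_pt, mul_one, norm_rpow_eq_sq_rpow _ p]
  rw [e, h]
  congr 1; ext θ
  rw [chordSq]
  ring

theorem integral_lin_pair {E : Type*} [NormedAddCommGroup E] [NormedSpace ℝ E] [CompleteSpace E]
    (a : ℕ → ℂ) {s : Finset ℕ} {j : ℕ} (hj : j ∉ s) {f : ℂ → ℂ → E}
    (hf : Continuous (Function.uncurry f)) :
    ∫ x, f (lin a s x) (a j * pt (x j)) ∂haar
      = ∫ x, circ (fun z => f (lin a s x) (a j * z)) ∂haar := by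
  have hc : Continuous fun x : InfTorus => f (lin a s x) (a j * pt (x j)) :=
    hf.comp (by fun_prop : Continuous fun x : InfTorus => (lin a s x, a j * pt (x j)))
  rw [integral_coord j hc]
  congr 1; ext x
  rw [← circ_mul_left (norm_pt (x j)) (fun z => f (lin a s x) (a j * z))]
  unfold circ
  congr 1; ext t
  simp only [lin_add_single a s hj, Pi.add_apply, Pi.single_eq_same, pt_add]

/-- A substitute for Gaussian integration by parts, where equality would hold. One factor of |S|² =
∑ Re(a_j z_j conj S) is expanded, and each term is bounded by conditioning on the variables other
than z_j. -/
theorem moment_add_two_le (a : ℕ → ℂ) (s : Finset ℕ) {p : ℝ} (hp : 2 ≤ p) :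
    ∫ x, ‖lin a s x‖ ^ (p + 2) ∂haar
      ≤ (1 + p / 2) * (∑ j ∈ s, ‖a j‖ ^ 2) * ∫ x, ‖lin a s x‖ ^ p ∂haar := by
  have hp0 : 0 ≤ p := by linarith
  have hn : Continuous fun w : ℂ => ‖w‖ ^ p := continuous_norm.rpow_const fun _ => Or.inr hp0
  have hcj : ∀ j, Continuous fun x : InfTorus =>
      (a j * pt (x j) * conj (lin a s x)).re * ‖lin a s x‖ ^ p := fun j =>
    (Complex.continuous_re.comp (by fun_prop)).mul (hn.comp (continuous_lin a s))
  have h1 : ∀ x, ‖lin a s x‖ ^ (p + 2)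
      = ∑ j ∈ s, (a j * pt (x j) * conj (lin a s x)).re * ‖lin a s x‖ ^ p := fun x => by
    rw [← Finset.sum_mul, ← Complex.re_sum, ← Finset.sum_mul]
    change _ = (lin a s x * conj (lin a s x)).re * _
    rw [Complex.mul_conj, Complex.ofReal_re, Complex.normSq_eq_norm_sq, mul_comm,
      Real.rpow_add_of_nonneg (norm_nonneg _) hp0 two_pos.le, Real.rpow_two]
  simp_rw [h1]
  rw [integral_finsetSum _ fun j _ => integrable_of_continuous (hcj j), Finset.mul_sum,
    Finset.sum_mul]
  refine Finset.sum_le_sum fun j hj => ?_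
  have hj' : j ∉ s.erase j := Finset.notMem_erase j s
  have hlin : ∀ x, lin a s x = lin a (s.erase j) x + a j * pt (x j) := fun x => by
    rw [← lin_insert a hj', Finset.insert_erase hj]
  have hf1 : Continuous (Function.uncurry fun y w : ℂ => (w * conj (y + w)).re * ‖y + w‖ ^ p) := by
    simp only [Function.uncurry_def]
    exact (Complex.continuous_re.comp (by fun_prop)).mul (hn.comp (by fun_prop))
  have hf2 : Continuous (Function.uncurry fun y w : ℂ => ‖y + w‖ ^ p) := by
    simp only [Function.uncurry_def]
    exact hn.comp (by fun_prop)
  have e1 := integral_lin_pair a hj' hf1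
  have e2 := integral_lin_pair a hj' hf2
  simp only [← hlin] at e1 e2
  have hcont : ∀ {f : ℂ → ℂ → ℝ}, Continuous (Function.uncurry f) →
      Continuous fun x => circ (fun z => f (lin a (s.erase j) x) (a j * z)) := fun {f} hf => by
    unfold circ
    have := continuous_parametric_integral_of_continuous (μ := haarAddCircle)
      (f := fun (x : InfTorus) t => f (lin a (s.erase j) x) (a j * pt t))
      (hf.comp (by fun_prop : Continuous fun v : InfTorus × UnitAddCircle =>
        (lin a (s.erase j) v.1, a j * pt v.2))) (s := Set.univ) isCompact_univ
    exact this.congr fun x => by simp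
  rw [e1, e2, ← integral_const_mul]
  refine integral_mono (integrable_of_continuous (hcont hf1))
    ((integrable_of_continuous (hcont hf2)).const_mul _) fun x => ?_
  exact circ_re_mul_norm_rpow_le (lin a (s.erase j) x) (a j) hp

theorem moment_le_gamma (a : ℕ → ℂ) (s : Finset ℕ) (ha : ∑ j ∈ s, ‖a j‖ ^ 2 = 1)
    {p : ℝ} (hp : 2 ≤ p) : ∫ x, ‖lin a s x‖ ^ p ∂haar ≤ Real.Gamma (1 + p / 2) := by
  -- Induction in steps of two down to orders in [2, 4); the factor 1 + (p − 2)/2 of the recursion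
  -- is that of the functional equation of Γ.
  obtain ⟨n, hn⟩ : ∃ n : ℕ, p < 4 + 2 * n := by
    obtain ⟨n, hn⟩ := exists_nat_gt p
    exact ⟨n, by have : (0 : ℝ) ≤ n := n.cast_nonneg
                 linarith⟩
  induction n generalizing p with
  | zero => exact moment_le_gamma_of_lt_four a s ha hp (by simpa using hn)
  | succ n ih =>
    rcases lt_or_ge p 4 with h4 | h4
    · exact moment_le_gamma_of_lt_four a s ha hp h4
    · have h1 := ih (p := p - 2) (by linarith) (by push_cast at hn; linarith)
      have h2 := moment_add_two_le a s (p := p - 2) (by linarith)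
      rw [ha, mul_one, sub_add_cancel] at h2
      refine h2.trans ?_
      rw [show 1 + p / 2 = (1 + (p - 2) / 2) + 1 by ring, Real.Gamma_add_one (by linarith)]
      exact mul_le_mul_of_nonneg_left h1 (by linarith)

end

section

open AddCircle Filter Topology

/-! ### Khinchine's inequality for Steinhaus sums -/

/-- This integrates the tangent line at 1 of s ↦ s^{p/2}. With Bernoulli's inequality it gives
Jensen's inequality on both sides of p = 2. -/
theorem integral_affine_norm_lin_sq (a : ℕ → ℂ) (s : Finset ℕ) (ha : ∑ j ∈ s, ‖a j‖ ^ 2 = 1)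
    (c : ℝ) : Integrable (fun x => 1 + c * (‖lin a s x‖ ^ 2 - 1)) haar ∧
    ∫ x, 1 + c * (‖lin a s x‖ ^ 2 - 1) ∂haar = 1 := by
  have h2 : Integrable (fun x => ‖lin a s x‖ ^ 2) haar := integrable_of_continuous (by fun_prop)
  have h3 : Integrable (fun x => c * (‖lin a s x‖ ^ 2 - 1)) haar :=
    integrable_of_continuous (by fun_prop)
  refine ⟨(integrable_const _).add h3, ?_⟩
  rw [integral_add (integrable_const _) h3, integral_const_mul,
    integral_sub h2 (integrable_const _), integral_norm_lin_sq, ha]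
  simp

theorem one_le_moment (a : ℕ → ℂ) (s : Finset ℕ) (ha : ∑ j ∈ s, ‖a j‖ ^ 2 = 1)
    {p : ℝ} (hp : 2 ≤ p) : 1 ≤ ∫ x, ‖lin a s x‖ ^ p ∂haar := by
  obtain ⟨hi, h1⟩ := integral_affine_norm_lin_sq a s ha (p / 2)
  refine h1.symm.trans_le (integral_mono hi (integrable_norm_lin_rpow a s (by linarith))
    fun x => ?_)
  have := one_add_mul_self_le_rpow_one_add (s := ‖lin a s x‖ ^ 2 - 1)
    (by linarith [sq_nonneg ‖lin a s x‖]) (p := p / 2) (by linarith)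
  rwa [add_sub_cancel, ← norm_rpow_eq_sq_rpow] at this

theorem moment_le_one (a : ℕ → ℂ) (s : Finset ℕ) (ha : ∑ j ∈ s, ‖a j‖ ^ 2 = 1)
    {p : ℝ} (hp : 1 ≤ p) (hp2 : p < 2) : ∫ x, ‖lin a s x‖ ^ p ∂haar ≤ 1 := by
  obtain ⟨hi, h1⟩ := integral_affine_norm_lin_sq a s ha (p / 2)
  refine (integral_mono (integrable_norm_lin_rpow a s (by linarith)) hi fun x => ?_).trans_eq h1
  have := rpow_one_add_le_one_add_mul_self (s := ‖lin a s x‖ ^ 2 - 1)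
    (by linarith [sq_nonneg ‖lin a s x‖]) (p := p / 2) (by linarith) (by linarith)
  rwa [add_sub_cancel, ← norm_rpow_eq_sq_rpow] at this

/-- No analysis of Γ is needed: the moment bounds for a single coordinate already place the Gaussian
moment on the correct side of 1. -/
theorem gamma_le_one {p : ℝ} (hp : 1 ≤ p) (hp2 : p < 2) : Real.Gamma (1 + p / 2) ≤ 1 :=
  (gamma_le_moment 1 {0} (by simp) hp hp2).trans (moment_le_one 1 {0} (by simp) hp hp2)

theorem one_le_gamma {p : ℝ} (hp : 2 ≤ p) : 1 ≤ Real.Gamma (1 + p / 2) :=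
  (one_le_moment 1 {0} (by simp) hp).trans (moment_le_gamma 1 {0} (by simp) hp)

theorem gamma_pos {p : ℝ} (hp : 1 ≤ p) : 0 < Real.Gamma (1 + p / 2) :=
  Real.Gamma_pos_of_pos (by linarith)

theorem lowerConst_of_lt {p : ℝ} (hp : 1 ≤ p) (hp2 : p < 2) :
    lowerConst p = Real.Gamma (1 + p / 2) ^ (1 / p) :=
  min_eq_right (Real.rpow_le_one (gamma_pos hp).le (gamma_le_one hp hp2) (by positivity))

theorem upperConst_of_lt {p : ℝ} (hp : 1 ≤ p) (hp2 : p < 2) : upperConst p = 1 :=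
  max_eq_left (Real.rpow_le_one (gamma_pos hp).le (gamma_le_one hp hp2) (by positivity))

theorem lowerConst_of_le {p : ℝ} (hp2 : 2 ≤ p) : lowerConst p = 1 :=
  min_eq_left (Real.one_le_rpow (one_le_gamma hp2) (by positivity))

theorem upperConst_of_le {p : ℝ} (hp2 : 2 ≤ p) :
    upperConst p = Real.Gamma (1 + p / 2) ^ (1 / p) :=
  max_eq_right (Real.one_le_rpow (one_le_gamma hp2) (by positivity))

theorem lowerConst_pos {p : ℝ} (hp : 1 ≤ p) : 0 < lowerConst p :=
  lt_min one_pos (Real.rpow_pos_of_pos (gamma_pos hp) _)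

theorem upperConst_pos (p : ℝ) : 0 < upperConst p := lt_max_of_lt_left one_pos

theorem khinchine_of_norm_one (a : ℕ → ℂ) (s : Finset ℕ) (ha : ∑ j ∈ s, ‖a j‖ ^ 2 = 1)
    {p : ℝ} (hp : 1 ≤ p) :
    lowerConst p ≤ (∫ x, ‖lin a s x‖ ^ p ∂haar) ^ (1 / p) ∧
    (∫ x, ‖lin a s x‖ ^ p ∂haar) ^ (1 / p) ≤ upperConst p := by
  have h0 : 0 ≤ ∫ x, ‖lin a s x‖ ^ p ∂haar := integral_nonneg fun x => by positivity
  rcases lt_or_ge p 2 with h | h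
  · rw [lowerConst_of_lt hp h, upperConst_of_lt hp h]
    exact ⟨Real.rpow_le_rpow (gamma_pos hp).le (gamma_le_moment a s ha hp h) (by positivity),
      Real.rpow_le_one h0 (moment_le_one a s ha hp h) (by positivity)⟩
  · rw [lowerConst_of_le h, upperConst_of_le h]
    exact ⟨Real.one_le_rpow (one_le_moment a s ha h) (by positivity),
      Real.rpow_le_rpow h0 (moment_le_gamma a s ha h) (by positivity)⟩

theorem khinchine (a : ℕ → ℂ) (s : Finset ℕ) {p : ℝ} (hp : 1 ≤ p) :
    lowerConst p * Real.sqrt (∑ j ∈ s, ‖a j‖ ^ 2) ≤ (∫ x, ‖lin a s x‖ ^ p ∂haar) ^ (1 / p) ∧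
    (∫ x, ‖lin a s x‖ ^ p ∂haar) ^ (1 / p) ≤ upperConst p * Real.sqrt (∑ j ∈ s, ‖a j‖ ^ 2) := by
  have hS : 0 ≤ ∑ j ∈ s, ‖a j‖ ^ 2 := Finset.sum_nonneg fun j _ => by positivity
  have hp0 : p ≠ 0 := by linarith
  rcases hS.eq_or_lt with h | h
  · have h1 : ∀ x, lin a s x = 0 := fun x => Finset.sum_eq_zero fun j hj => by
      have := (Finset.sum_eq_zero_iff_of_nonneg fun j _ => by positivity).1 h.symm j hj
      rw [norm_eq_zero.1 (pow_eq_zero_iff two_ne_zero |>.1 this), zero_mul]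
    simp [← h, h1, Real.zero_rpow, hp0]
  · set σ := Real.sqrt (∑ j ∈ s, ‖a j‖ ^ 2) with hσ
    have hσ0 : 0 < σ := Real.sqrt_pos.2 h
    have hσ2 : σ ^ 2 = ∑ j ∈ s, ‖a j‖ ^ 2 := Real.sq_sqrt hS
    set b : ℕ → ℂ := fun j => ((σ⁻¹ : ℝ) : ℂ) * a j with hb
    have h1 := khinchine_of_norm_one b s (by
      simp only [hb, norm_mul, mul_pow]
      rw [← Finset.mul_sum, ← hσ2, Complex.norm_real, Real.norm_of_nonneg (by positivity)]
      field_simp) hp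
    have h2 : ∀ x, ‖lin a s x‖ ^ p = σ ^ p * ‖lin b s x‖ ^ p := fun x => by
      rw [hb, lin_mul_left, ← Real.mul_rpow hσ0.le (norm_nonneg _), norm_mul, Complex.norm_real,
        Real.norm_of_nonneg (by positivity)]
      congr 1
      field_simp
    have h3 : (∫ x, ‖lin a s x‖ ^ p ∂haar) ^ (1 / p)
        = (∫ x, ‖lin b s x‖ ^ p ∂haar) ^ (1 / p) * σ := by
      simp_rw [h2]
      rw [integral_const_mul, Real.mul_rpow (by positivity)
        (integral_nonneg fun x => by positivity), ← Real.rpow_mul hσ0.le, mul_one_div_cancel hp0,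
        Real.rpow_one, mul_comm]
    rw [h3]
    exact ⟨mul_le_mul_of_nonneg_right h1.1 hσ0.le, mul_le_mul_of_nonneg_right h1.2 hσ0.le⟩

/-! ### The central limit theorem for Steinhaus sums -/

/-- The normalized sum of the first `n + 1` coordinates. -/
def stdSum (n : ℕ) : InfTorus → ℂ :=
  lin (fun _ => ((Real.sqrt (n + 1 : ℕ))⁻¹ : ℝ)) (Finset.range (n + 1))

theorem norm_inv_sqrt (n : ℕ) :
    ‖(((Real.sqrt (n + 1 : ℕ))⁻¹ : ℝ) : ℂ)‖ = (Real.sqrt (n + 1 : ℕ))⁻¹ := by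
  rw [Complex.norm_real, Real.norm_of_nonneg (by positivity)]

theorem sum_norm_sq_stdSum (n : ℕ) :
    ∑ _j ∈ Finset.range (n + 1), ‖(((Real.sqrt (n + 1 : ℕ))⁻¹ : ℝ) : ℂ)‖ ^ 2 = 1 := by
  rw [norm_inv_sqrt, inv_pow, Real.sq_sqrt (by positivity), Finset.sum_const, Finset.card_range,
    nsmul_eq_mul, mul_inv_cancel₀ (by positivity)]

theorem tendsto_besselProd_stdSum (t : ℝ) :
    Tendsto (fun n : ℕ => besselProd (fun _ => ((Real.sqrt (n + 1 : ℕ))⁻¹ : ℝ))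
      (Finset.range (n + 1)) t) atTop (𝓝 (Real.exp (-t ^ 2 / 4))) := by
  refine (tendsto_bessel_pow t).congr fun n => ?_
  rw [besselProd, norm_inv_sqrt, Finset.prod_const, Finset.card_range]
  congr 2
  ring

theorem tendsto_moment_stdSum {p : ℝ} (hp : 1 ≤ p) (hp2 : p < 2) :
    Tendsto (fun n => ∫ x, ‖stdSum n x‖ ^ p ∂haar) atTop (𝓝 (Real.Gamma (1 + p / 2))) :=
  tendsto_moment sum_norm_sq_stdSum tendsto_besselProd_stdSum hp hp2

theorem continuous_stdSum (n : ℕ) : Continuous (stdSum n) := continuous_lin _ _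

/-- Lévy's continuity theorem: the characteristic function is a product of Bessel functions and
tends to exp(−|t|²/4), that of the Gaussian. -/
theorem tendsto_integral_comp_stdSum (f : BoundedContinuousFunction ℂ ℝ) :
    Tendsto (fun n => ∫ x, f (stdSum n x) ∂haar) atTop (𝓝 (∫ w, f w ∂gauss)) := by
  have hm : ∀ n, AEMeasurable (stdSum n) haar := fun n => (measurable_lin _ _).aemeasurable
  set μ : ℕ → ProbabilityMeasure ℂ := fun n =>
    ⟨haar.map (stdSum n), Measure.isProbabilityMeasure_map (hm n)⟩ with hμ
  set γ : ProbabilityMeasure ℂ := ⟨gauss, inferInstance⟩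
  have h : Tendsto μ atTop (𝓝 γ) := by
    refine ProbabilityMeasure.tendsto_of_tendsto_charFun fun t => ?_
    have h1 : ∀ n, charFun (μ n : Measure ℂ) t = (besselProd
        (fun _ => ((Real.sqrt (n + 1 : ℕ))⁻¹ : ℝ)) (Finset.range (n + 1)) ‖t‖ : ℝ) := fun n => by
      rw [charFun_apply]
      change ∫ x, _ ∂(haar.map (stdSum n)) = _
      rw [integral_map (hm n) (by fun_prop)]
      have := integral_exp_lin_mul (fun _ => ((Real.sqrt (n + 1 : ℕ))⁻¹ : ℝ))
        (Finset.range (n + 1)) (conj t)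
      rw [RCLike.norm_conj] at this
      rw [← this]
      congr 1; ext x
      rw [real_inner_comm, Complex.inner, mul_comm (conj t)]
      rfl
    have h2 : charFun (γ : Measure ℂ) t = (Real.exp (-‖t‖ ^ 2 / 4) : ℝ) := by
      rw [charFun_apply]
      have := integral_exp_re_gauss (conj t)
      rw [RCLike.norm_conj] at this
      rw [← this]
      change ∫ x, _ ∂gauss = _
      congr 1; ext x
      rw [real_inner_comm, Complex.inner, mul_comm (conj t)]
    simp only [h1, h2]
    exact (Complex.continuous_ofReal.tendsto _).comp (tendsto_besselProd_stdSum ‖t‖)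
  rw [ProbabilityMeasure.tendsto_iff_forall_integral_tendsto] at h
  refine (h f).congr fun n => ?_
  change ∫ x, _ ∂(haar.map (stdSum n)) = _
  rw [integral_map (hm n) f.continuous.aestronglyMeasurable]

/-- A Fatou argument: weak convergence is applied to the truncations min(|w|^p, K), and then K → ∞.
Optimality for p ≥ 2 needs only this one-sided bound, so no uniform integrability enters. -/
theorem gamma_le_of_moment_stdSum_le {p : ℝ} (hp : 0 ≤ p) {c : ℝ}
    (h : ∀ n, ∫ x, ‖stdSum n x‖ ^ p ∂haar ≤ c) : Real.Gamma (1 + p / 2) ≤ c := by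
  have hn : Continuous fun w : ℂ => ‖w‖ ^ p := continuous_norm.rpow_const fun _ => Or.inr hp
  have hK : ∀ K : ℕ, ∫ w, min (‖w‖ ^ p) K ∂gauss ≤ c := fun K => by
    set f : BoundedContinuousFunction ℂ ℝ := BoundedContinuousFunction.ofNormedAddCommGroup
      (fun w : ℂ => min (‖w‖ ^ p) K) (hn.min continuous_const) K (fun w => by
        rw [Real.norm_of_nonneg (by positivity)]; exact min_le_right _ _)
    refine le_of_tendsto' (tendsto_integral_comp_stdSum f) fun n => le_trans ?_ (h n)
    have hc := continuous_stdSum n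
    exact integral_mono (integrable_of_continuous (f.continuous.comp hc))
      (integrable_of_continuous (hn.comp hc)) fun x => min_le_left _ _
  have hlim : Tendsto (fun K : ℕ => ∫ w, min (‖w‖ ^ p) (K : ℝ) ∂gauss) atTop
      (𝓝 (∫ w, ‖w‖ ^ p ∂gauss)) := by
    refine tendsto_integral_of_dominated_convergence (fun w => ‖w‖ ^ p)
      (fun K => (hn.min continuous_const).aestronglyMeasurable) (integrable_norm_rpow_gauss hp)
      (fun K => .of_forall fun w => ?_) (.of_forall fun w => ?_)
    · rw [Real.norm_of_nonneg (by positivity)]; exact min_le_left _ _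
    · refine tendsto_const_nhds.congr' ?_
      obtain ⟨N, hN⟩ := exists_nat_ge (‖w‖ ^ p)
      filter_upwards [eventually_ge_atTop N] with K hK
      rw [min_eq_left (hN.trans (by exact_mod_cast hK))]
  rw [← integral_norm_rpow_gauss hp]
  exact le_of_tendsto' hlim hK

end

section

open AddCircle Filter Topology

/-! ### Monomials and Fourier coefficients -/

theorem monomial_eq_prod (α : ℕ →₀ ℤ) (x : InfTorus) :
    monomial α x = α.prod fun j k => (fourier k (x j) : ℂ) := rfl

theorem monomial_zero (x : InfTorus) : monomial 0 x = 1 := by simp [monomial]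

theorem monomial_add (α β : ℕ →₀ ℤ) (x : InfTorus) :
    monomial (α + β) x = monomial α x * monomial β x := by
  classical
  rw [monomial_eq_prod, Finsupp.prod_add_index']
  · rfl
  · intro j; exact fourier_zero
  · intro j m n; exact fourier_add

theorem monomial_neg (α : ℕ →₀ ℤ) (x : InfTorus) : monomial (-α) x = conj (monomial α x) := by
  simp only [monomial, Finsupp.support_neg, Finsupp.neg_apply, fourier_neg, map_prod]

theorem monomial_single (j : ℕ) (x : InfTorus) : monomial (Finsupp.single j 1) x = pt (x j) := by
  rw [monomial_eq_prod, Finsupp.prod_single_index (h := fun j k => (fourier k (x j) : ℂ))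
    fourier_zero, pt]

theorem monomial_add_point (α : ℕ →₀ ℤ) (x y : InfTorus) :
    monomial α (x + y) = monomial α x * monomial α y := by
  rw [monomial, monomial, monomial, ← Finset.prod_mul_distrib]
  refine Finset.prod_congr rfl fun j _ => ?_
  rw [Pi.add_apply, fourier_apply, fourier_apply, fourier_apply, zsmul_add, toCircle_add,
    Circle.coe_mul]

theorem integral_monomial {α : ℕ →₀ ℤ} (hα : α ≠ 0) : ∫ x, monomial α x ∂haar = 0 := by
  obtain ⟨j, hj⟩ := Finsupp.ne_iff.1 hα
  rw [Finsupp.zero_apply] at hj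
  -- A half period of the j-th factor: translation by y changes the sign of the monomial but not its
  -- integral.
  set y : InfTorus := Pi.single j (((1 : ℝ) / 2 / (α j : ℝ) : ℝ) : UnitAddCircle) with hy
  have h1 : monomial α y = -1 := by
    rw [monomial, Finset.prod_eq_single j]
    · have := fourier_add_half_inv_index (T := 1) hj one_pos 0
      rw [zero_add, fourier_eval_zero] at this
      rw [hy, Pi.single_eq_same]
      exact this
    · intro i _ hi
      rw [hy, Pi.single_eq_of_ne hi, fourier_eval_zero]
    · intro h
      exact absurd (Finsupp.mem_support_iff.2 hj) h
  have h2 := integral_add_left y (monomial α)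
  simp only [monomial_add_point, h1] at h2
  rw [integral_const_mul] at h2
  linear_combination (-1 / 2) * h2

theorem coeff_monomial (α β : ℕ →₀ ℤ) : coeff (monomial β) α = if β = α then 1 else 0 := by
  have h : coeff (monomial β) α = ∫ x, monomial (β - α) x ∂haar := by
    refine integral_congr_ae (.of_forall fun x => ?_)
    beta_reduce
    rw [sub_eq_add_neg, monomial_add, monomial_neg]
  rw [h]
  split_ifs with hαβ
  · simp [hαβ, monomial_zero]
  · exact integral_monomial (sub_ne_zero.2 hαβ)

theorem lin_eq_sum_monomial (a : ℕ → ℂ) (s : Finset ℕ) (x : InfTorus) :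
    lin a s x = ∑ j ∈ s, a j * monomial (Finsupp.single j 1) x := by
  simp only [monomial_single, lin]

theorem integrable_mul_continuous {f u : InfTorus → ℂ} (hf : Integrable f haar)
    (hu : Continuous u) : Integrable (fun x => f x * u x) haar := by
  obtain ⟨C, hC⟩ := isCompact_univ.exists_bound_of_continuousOn hu.continuousOn
  exact hf.mul_bdd (c := C) hu.aestronglyMeasurable (.of_forall fun x => hC x trivial)

theorem continuous_conj_monomial (α : ℕ →₀ ℤ) : Continuous fun x => conj (monomial α x) :=
  Complex.continuous_conj.comp (continuous_monomial α)

theorem coeff_lin (a : ℕ → ℂ) (s : Finset ℕ) (α : ℕ →₀ ℤ) :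
    coeff (lin a s) α = ∑ j ∈ s, a j * if Finsupp.single j 1 = α then 1 else 0 := by
  have h : coeff (lin a s) α
      = ∫ x, ∑ j ∈ s, a j * (monomial (Finsupp.single j 1) x * conj (monomial α x)) ∂haar := by
    refine integral_congr_ae (.of_forall fun x => ?_)
    beta_reduce
    rw [lin_eq_sum_monomial, Finset.sum_mul]
    exact Finset.sum_congr rfl fun j _ => mul_assoc _ _ _
  have hc : ∀ j, Continuous fun x => monomial (Finsupp.single j 1) x * conj (monomial α x) :=
    fun j => (continuous_monomial _).mul (continuous_conj_monomial α)
  rw [h, integral_finsetSum _ fun j _ => (integrable_of_continuous (hc j)).const_mul _]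
  refine Finset.sum_congr rfl fun j _ => ?_
  rw [integral_const_mul, ← coeff_monomial]
  rfl

theorem single_one_injective : Function.Injective fun j : ℕ => Finsupp.single j (1 : ℤ) :=
  Finsupp.single_left_injective one_ne_zero

theorem coeff_lin_single (a : ℕ → ℂ) (s : Finset ℕ) (j : ℕ) :
    coeff (lin a s) (Finsupp.single j 1) = if j ∈ s then a j else 0 := by
  rw [coeff_lin]
  simp [single_one_injective.eq_iff' rfl]

theorem coeff_lin_of_ne (a : ℕ → ℂ) (s : Finset ℕ) {α : ℕ →₀ ℤ}
    (hα : ∀ j, α ≠ Finsupp.single j 1) : coeff (lin a s) α = 0 := by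
  rw [coeff_lin]
  exact Finset.sum_eq_zero fun j _ => by rw [if_neg (hα j).symm, mul_zero]

/-! ### The projection onto linear functions is a contraction -/

/-- The span of the monomials of total degree `n` in the variables indexed by `s`. -/
def homogeneous (s : Finset ℕ) (n : ℤ) : Submodule ℂ (InfTorus → ℂ) :=
  Submodule.span ℂ {u | ∃ α : ℕ →₀ ℤ, α.support ⊆ s ∧ α.degree = n ∧ u = monomial α}

theorem mul_mem_homogeneous {s : Finset ℕ} {m n : ℤ} {u v : InfTorus → ℂ}
    (hu : u ∈ homogeneous s m) (hv : v ∈ homogeneous s n) : u * v ∈ homogeneous s (m + n) := by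
  classical
  have h := Submodule.mul_mem_mul hu hv
  rw [homogeneous, homogeneous, Submodule.span_mul_span] at h
  refine Submodule.span_mono ?_ h
  rintro _ ⟨_, ⟨α, hα, hm, rfl⟩, _, ⟨β, hβ, hn, rfl⟩, rfl⟩
  refine ⟨α + β, Finsupp.support_add.trans (Finset.union_subset hα hβ), ?_, ?_⟩
  · rw [map_add, hm, hn]
  · ext x; rw [monomial_add]; rfl

theorem one_mem_homogeneous (s : Finset ℕ) : (1 : InfTorus → ℂ) ∈ homogeneous s 0 :=
  Submodule.subset_span ⟨0, by simp, by simp, by ext x; simp [monomial_zero]⟩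

theorem pow_mem_homogeneous {s : Finset ℕ} {u : InfTorus → ℂ} (hu : u ∈ homogeneous s 0) (k : ℕ) :
    u ^ k ∈ homogeneous s 0 := by
  induction k with
  | zero => rw [pow_zero]; exact one_mem_homogeneous s
  | succ k ih => rw [pow_succ]; simpa using mul_mem_homogeneous ih hu

theorem lin_mem_homogeneous (a : ℕ → ℂ) (s : Finset ℕ) : lin a s ∈ homogeneous s 1 := by
  have : lin a s = ∑ j ∈ s, a j • monomial (Finsupp.single j 1) := by
    ext x; rw [lin_eq_sum_monomial]; simp
  rw [this]
  refine Submodule.sum_mem _ fun j hj => Submodule.smul_mem _ _ (Submodule.subset_span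
    ⟨_, ?_, ?_, rfl⟩)
  · exact Finsupp.support_single_subset.trans (Finset.singleton_subset_iff.2 hj)
  · simp

theorem conj_lin_mem_homogeneous (a : ℕ → ℂ) (s : Finset ℕ) :
    (fun x => conj (lin a s x)) ∈ homogeneous s (-1) := by
  have : (fun x => conj (lin a s x)) = ∑ j ∈ s, conj (a j) • monomial (-Finsupp.single j 1) := by
    ext x; rw [lin_eq_sum_monomial]; simp [monomial_neg]
  rw [this]
  refine Submodule.sum_mem _ fun j hj => Submodule.smul_mem _ _ (Submodule.subset_span
    ⟨_, ?_, ?_, rfl⟩)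
  · rw [Finsupp.support_neg]
    exact Finsupp.support_single_subset.trans (Finset.singleton_subset_iff.2 hj)
  · simp

/-- Since |g|² = g conj(g) on the torus, polynomials in |g|² have degree 0, and the factor conj(g)
brings the degree to −1. -/
theorem conj_lin_mul_eval_mem_homogeneous (a : ℕ → ℂ) (s : Finset ℕ) (P : Polynomial ℝ) :
    (fun x => conj (lin a s x) * (P.eval (‖lin a s x‖ ^ 2) : ℝ)) ∈ homogeneous s (-1) := by
  have h1 := conj_lin_mem_homogeneous a s
  have h0 : lin a s * (fun x => conj (lin a s x)) ∈ homogeneous s 0 := by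
    simpa using mul_mem_homogeneous (lin_mem_homogeneous a s) h1
  have : (fun x => conj (lin a s x) * (P.eval (‖lin a s x‖ ^ 2) : ℝ))
      = ∑ k ∈ Finset.range (P.natDegree + 1), (P.coeff k : ℂ) •
        ((fun x => conj (lin a s x)) * (lin a s * fun x => conj (lin a s x)) ^ k) := by
    ext x
    rw [Polynomial.eval_eq_sum_range]
    simp only [Finset.sum_apply, Pi.smul_apply, Pi.mul_apply, Pi.pow_apply, smul_eq_mul,
      Complex.mul_conj, Complex.normSq_eq_norm_sq]
    push_cast
    rw [Finset.mul_sum]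
    exact Finset.sum_congr rfl fun k _ => by ring
  rw [this]
  refine Submodule.sum_mem _ fun k _ => Submodule.smul_mem _ _ ?_
  simpa using mul_mem_homogeneous h1 (pow_mem_homogeneous h0 k)

theorem continuous_of_mem_homogeneous {s : Finset ℕ} {n : ℤ} {u : InfTorus → ℂ}
    (hu : u ∈ homogeneous s n) : Continuous u := by
  refine Submodule.span_induction (p := fun u _ => Continuous u) ?_ continuous_const
    (fun _ _ _ _ h1 h2 => h1.add h2) (fun c _ _ h => h.const_smul c) hu
  rintro _ ⟨α, -, -, rfl⟩
  exact continuous_monomial α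

theorem exists_eq_single_of_degree_eq_one {α : ℕ →₀ ℤ} (h0 : ∀ j, 0 ≤ α j)
    (h1 : α.degree = 1) : ∃ j, α = Finsupp.single j 1 := by
  classical
  have hne : α ≠ 0 := fun h => by simp [h] at h1
  obtain ⟨j, hj⟩ := Finsupp.ne_iff.1 hne
  rw [Finsupp.zero_apply] at hj
  have hj' : j ∈ α.support := Finsupp.mem_support_iff.2 hj
  rw [Finsupp.degree_apply, ← Finset.add_sum_erase _ _ hj'] at h1
  have hs : 0 ≤ ∑ i ∈ α.support.erase j, α i := Finset.sum_nonneg fun i _ => h0 i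
  have hj1 : 0 < α j := lt_of_le_of_ne (h0 j) (Ne.symm hj)
  have hz : ∑ i ∈ α.support.erase j, α i = 0 := by omega
  refine ⟨j, Finsupp.ext fun i => ?_⟩
  rcases eq_or_ne i j with rfl | hi
  · rw [Finsupp.single_eq_same]; omega
  · rw [Finsupp.single_eq_of_ne hi]
    by_contra hi0
    exact hi0 ((Finset.sum_eq_zero_iff_of_nonneg fun i _ => h0 i).1 hz i
      (Finset.mem_erase.2 ⟨hi, Finsupp.mem_support_iff.2 hi0⟩))

/-- Pairing D with a monomial of degree −1 gives the coefficient of D at a multi-index of degree 1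
supported in s. Such an index has a negative component or is some e_j with j ∈ s, and the
coefficient vanishes in either case. -/
theorem integral_mul_eq_zero_of_mem_homogeneous {s : Finset ℕ} {D : InfTorus → ℂ}
    (hD : Integrable D haar) (hneg : ∀ α : ℕ →₀ ℤ, (∃ j, α j < 0) → coeff D α = 0)
    (hs : ∀ j ∈ s, coeff D (Finsupp.single j 1) = 0) {u : InfTorus → ℂ}
    (hu : u ∈ homogeneous s (-1)) : ∫ x, D x * u x ∂haar = 0 := by
  refine (Submodule.span_induction
    (p := fun u _ => Continuous u ∧ ∫ x, D x * u x ∂haar = 0) ?_ ?_ ?_ ?_ hu).2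
  · rintro _ ⟨α, hα, hd, rfl⟩
    refine ⟨continuous_monomial α, ?_⟩
    have h : ∫ x, D x * monomial α x ∂haar = coeff D (-α) := by
      rw [coeff]; simp only [monomial_neg, Complex.conj_conj]
    rw [h]
    by_cases h0 : ∃ j, (-α) j < 0
    · exact hneg _ h0
    · push Not at h0
      obtain ⟨j, hj⟩ := exists_eq_single_of_degree_eq_one h0 (by rw [map_neg, hd, neg_neg])
      rw [hj]
      refine hs j (hα ?_)
      rw [← Finsupp.support_neg, hj]
      simp
  · exact ⟨continuous_const, by simp⟩
  · rintro u v _ _ ⟨hu, hu0⟩ ⟨hv, hv0⟩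
    refine ⟨hu.add hv, ?_⟩
    simp only [Pi.add_apply, mul_add]
    rw [integral_add (integrable_mul_continuous hD hu) (integrable_mul_continuous hD hv), hu0,
      hv0, add_zero]
  · rintro c u _ ⟨hu, hu0⟩
    refine ⟨hu.const_smul c, ?_⟩
    simp only [Pi.smul_apply, smul_eq_mul, mul_left_comm _ c]
    rw [integral_const_mul, hu0, mul_zero]

/-- Weierstrass approximation of h on the bounded range of |g|² reduces the claim to polynomials. -/
theorem integral_mul_conj_lin_eq_zero {s : Finset ℕ} {D : InfTorus → ℂ}
    (hD : Integrable D haar) (hneg : ∀ α : ℕ →₀ ℤ, (∃ j, α j < 0) → coeff D α = 0)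
    (hs : ∀ j ∈ s, coeff D (Finsupp.single j 1) = 0) (a : ℕ → ℂ) {h : ℝ → ℝ}
    (hh : ContinuousOn h (Set.Ici 0)) :
    ∫ x, D x * (conj (lin a s x) * (h (‖lin a s x‖ ^ 2) : ℝ)) ∂haar = 0 := by
  set g := lin a s with hg
  have hgc : Continuous g := continuous_lin a s
  obtain ⟨C, hC⟩ := isCompact_univ.exists_bound_of_continuousOn hgc.continuousOn
  have hC0 : 0 ≤ C := (norm_nonneg _).trans (hC 0 trivial)
  have hmem : ∀ x, ‖g x‖ ^ 2 ∈ Set.Icc 0 (C ^ 2) := fun x =>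
    ⟨by positivity, pow_le_pow_left₀ (norm_nonneg _) (hC x trivial) 2⟩
  have hhc : Continuous fun x => h (‖g x‖ ^ 2) :=
    hh.comp_continuous (by fun_prop) fun x => (hmem x).1
  have hu : Continuous fun x => conj (g x) * (h (‖g x‖ ^ 2) : ℝ) :=
    (Complex.continuous_conj.comp hgc).mul (Complex.continuous_ofReal.comp hhc)
  set N := ∫ x, ‖D x‖ * ‖g x‖ ∂haar with hN
  have hNi : Integrable (fun x => ‖D x‖ * ‖g x‖) haar := by
    simpa only [norm_mul] using (integrable_mul_continuous hD hgc).norm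
  have hN0 : 0 ≤ N := integral_nonneg fun x => by positivity
  rw [← norm_le_zero_iff]
  refine le_of_forall_pos_le_add fun ε hε => ?_
  obtain ⟨P, hP⟩ := exists_polynomial_near_of_continuousOn 0 (C ^ 2) h
    (hh.mono fun x hx => hx.1) (ε / (N + 1)) (by positivity)
  have hPm := conj_lin_mul_eval_mem_homogeneous a s P
  have hPc := continuous_of_mem_homogeneous hPm
  have hP0 := integral_mul_eq_zero_of_mem_homogeneous hD hneg hs hPm
  rw [← sub_zero (∫ x, D x * (conj (g x) * (h (‖g x‖ ^ 2) : ℝ)) ∂haar), ← hP0,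
    ← integral_sub (integrable_mul_continuous hD hu) (integrable_mul_continuous hD hPc)]
  calc ‖∫ x, D x * (conj (g x) * (h (‖g x‖ ^ 2) : ℝ))
        - D x * (conj (g x) * (P.eval (‖g x‖ ^ 2) : ℝ)) ∂haar‖
      ≤ ∫ x, ε / (N + 1) * (‖D x‖ * ‖g x‖) ∂haar := by
        refine norm_integral_le_of_norm_le (hNi.const_mul _) (.of_forall fun x => ?_)
        rw [← mul_sub, ← mul_sub, ← Complex.ofReal_sub, norm_mul, norm_mul, RCLike.norm_conj,
          Complex.norm_real, Real.norm_eq_abs, abs_sub_comm, ← mul_assoc,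
          mul_comm (ε / (N + 1))]
        exact mul_le_mul_of_nonneg_left (hP _ (hmem x)).le (by positivity)
    _ = ε / (N + 1) * N := by rw [integral_const_mul]
    _ ≤ 0 + ε := by
        rw [zero_add, div_mul_eq_mul_div, div_le_iff₀ (by positivity)]
        nlinarith

/-- The tangent inequality for the convex function (|u|² + ε)^{r/2}. The regularization by ε keeps
the gradient continuous at v = 0, which matters when r < 2. The proof combines Cauchy–Schwarz for
the vectors (u, √ε) and (v, √ε) with Bernoulli's inequality for the quotient of their lengths. -/
theorem tangent_le_rpow {r : ℝ} (hr : 1 ≤ r) {ε : ℝ} (hε : 0 < ε) (u v : ℂ) :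
    (‖v‖ ^ 2 + ε) ^ (r / 2) + r * ((u - v) * conj v).re * (‖v‖ ^ 2 + ε) ^ (r / 2 - 1)
      ≤ (‖u‖ ^ 2 + ε) ^ (r / 2) := by
  set α := Real.sqrt (‖v‖ ^ 2 + ε) with hα
  set β := Real.sqrt (‖u‖ ^ 2 + ε) with hβ
  have hα2 : α ^ 2 = ‖v‖ ^ 2 + ε := Real.sq_sqrt (by positivity)
  have hβ2 : β ^ 2 = ‖u‖ ^ 2 + ε := Real.sq_sqrt (by positivity)
  have hα0 : 0 < α := Real.sqrt_pos.2 (by positivity)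
  have hβ0 : 0 < β := Real.sqrt_pos.2 (by positivity)
  have hpow : ∀ γ : ℝ, 0 < γ → ∀ s : ℝ, (γ ^ 2) ^ s = γ ^ (2 * s) := fun γ hγ s => by
    rw [← Real.rpow_natCast γ 2, ← Real.rpow_mul hγ.le]; norm_num
  have hre : ((u - v) * conj v).re ≤ α * β - α ^ 2 := by
    have h1 : ((u - v) * conj v).re = (u * conj v).re - ‖v‖ ^ 2 := by
      rw [sub_mul, Complex.sub_re, Complex.mul_conj, Complex.ofReal_re, Complex.normSq_eq_norm_sq]
    have h2 : (u * conj v).re ≤ ‖u‖ * ‖v‖ := by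
      refine (Complex.re_le_norm _).trans_eq ?_
      rw [norm_mul, RCLike.norm_conj]
    have h3 : ‖u‖ * ‖v‖ + ε ≤ α * β := by
      refine abs_le_of_sq_le_sq' ?_ (by positivity) |>.2
      rw [mul_pow, hα2, hβ2]
      nlinarith [mul_nonneg hε.le (sq_nonneg (‖u‖ - ‖v‖))]
    rw [h1, hα2]; linarith
  rw [← hα2, ← hβ2, hpow α hα0, hpow α hα0, hpow β hβ0, show 2 * (r / 2) = r by ring,
    show 2 * (r / 2 - 1) = r - 2 by ring]
  have hP : 0 < α ^ (r - 2) := Real.rpow_pos_of_pos hα0 _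
  have hαr : α ^ r = α ^ 2 * α ^ (r - 2) := by
    rw [← Real.rpow_two, ← Real.rpow_add hα0]; ring_nf
  have hb := one_add_mul_self_le_rpow_one_add (s := β / α - 1)
    (by linarith [div_nonneg hβ0.le hα0.le]) hr
  rw [add_sub_cancel, Real.div_rpow hβ0.le hα0.le, le_div_iff₀ (Real.rpow_pos_of_pos hα0 _),
    hαr] at hb
  have e : (1 + r * (β / α - 1)) * (α ^ 2 * α ^ (r - 2))
      = (α ^ 2 + r * (α * β - α ^ 2)) * α ^ (r - 2) := by field_simp
  rw [e] at hb
  rw [hαr]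
  refine le_trans ?_ hb
  rw [add_mul]
  gcongr

/-- The tangent inequality at g in the direction f − g is integrated; the linear term vanishes
because f − g is orthogonal to g h(|g|²) with h(R) = (R+ε)^{r/2−1}. Finally ε → 0 with majorant (|f|
+ 1)^r. -/
theorem integral_norm_rpow_lin_le {r : ℝ} (hr : 1 ≤ r) {f : InfTorus → ℂ}
    (hfm : AEStronglyMeasurable f haar) (hf : Integrable (fun x => (‖f x‖ + 1) ^ r) haar)
    (hfi : Integrable f haar)
    (hneg : ∀ α : ℕ →₀ ℤ, (∃ j, α j < 0) → coeff f α = 0) (s : Finset ℕ) :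
    ∫ x, ‖lin (fun j => coeff f (Finsupp.single j 1)) s x‖ ^ r ∂haar
      ≤ ∫ x, ‖f x‖ ^ r ∂haar := by
  set a : ℕ → ℂ := fun j => coeff f (Finsupp.single j 1) with ha
  set g := lin a s with hg
  have hgc : Continuous g := continuous_lin a s
  have hgi : Integrable g haar := integrable_of_continuous hgc
  have hr0 : 0 ≤ r := by linarith
  have hcD : ∀ α, coeff (fun x => f x - g x) α = coeff f α - coeff g α := fun α => by
    rw [coeff, coeff, coeff, ← integral_sub
      (integrable_mul_continuous hfi (continuous_conj_monomial α))
      (integrable_mul_continuous hgi (continuous_conj_monomial α))]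
    simp only [sub_mul]
  have hD : Integrable (fun x => f x - g x) haar := hfi.sub hgi
  have hbound : ∀ ε : ℝ, 0 < ε → ε ≤ 1 → ∀ x, (‖f x‖ ^ 2 + ε) ^ (r / 2) ≤ (‖f x‖ + 1) ^ r :=
    fun ε hε hε1 x => by
      calc (‖f x‖ ^ 2 + ε) ^ (r / 2) ≤ ((‖f x‖ + 1) ^ 2) ^ (r / 2) :=
            Real.rpow_le_rpow (by positivity) (by nlinarith [norm_nonneg (f x)]) (by positivity)
        _ = (‖f x‖ + 1) ^ r := by
            rw [← Real.rpow_natCast _ 2, ← Real.rpow_mul (by positivity)]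
            congr 1; push_cast; ring
  have hmeas : ∀ ε : ℝ, AEStronglyMeasurable (fun x => (‖f x‖ ^ 2 + ε) ^ (r / 2)) haar := fun ε =>
    ((((by fun_prop : Continuous fun w : ℂ => ‖w‖ ^ 2 + ε).rpow_const
      fun _ => Or.inr (by linarith)).comp_aestronglyMeasurable hfm))
  have hint : ∀ ε : ℝ, 0 < ε → ε ≤ 1 →
      Integrable (fun x => (‖f x‖ ^ 2 + ε) ^ (r / 2)) haar := fun ε hε hε1 =>
    hf.mono' (hmeas ε) (.of_forall fun x => by
      rw [Real.norm_of_nonneg (by positivity)]; exact hbound ε hε hε1 x)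
  have hmain : ∀ ε : ℝ, 0 < ε → ε ≤ 1 →
      ∫ x, ‖g x‖ ^ r ∂haar ≤ ∫ x, (‖f x‖ ^ 2 + ε) ^ (r / 2) ∂haar := fun ε hε hε1 => by
    set h : ℝ → ℝ := fun R => (R + ε) ^ (r / 2 - 1) with hh
    have hhc : ContinuousOn h (Set.Ici 0) := fun R hR =>
      ((continuousAt_id.add continuousAt_const).rpow_const
        (Or.inl (add_pos_of_nonneg_of_pos (Set.mem_Ici.1 hR) hε).ne')).continuousWithinAt
    have h0 := integral_mul_conj_lin_eq_zero hD
      (fun α hα => by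
        rw [hcD, hneg α hα, coeff_lin_of_ne, sub_zero]
        rintro j rfl
        obtain ⟨i, hi⟩ := hα
        rw [Finsupp.single_apply] at hi
        split_ifs at hi <;> omega)
      (s := s) (fun j hj => by rw [hcD, hg, coeff_lin_single, if_pos hj, sub_self]) a hhc
    have hhc' : Continuous fun x => h (‖g x‖ ^ 2) :=
      hhc.comp_continuous (by fun_prop) fun x => by
        rw [Set.mem_Ici]; positivity
    have hI : Integrable (fun x => (f x - g x) * (conj (g x) * (h (‖g x‖ ^ 2) : ℝ))) haar :=
      integrable_mul_continuous hD
        ((Complex.continuous_conj.comp hgc).mul (Complex.continuous_ofReal.comp hhc'))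
    have hre : ∫ x, ((f x - g x) * (conj (g x) * (h (‖g x‖ ^ 2) : ℝ))).re ∂haar = 0 := by
      have := integral_re (𝕜 := ℂ) hI
      simp only [RCLike.re_to_complex] at this
      rw [this, h0, Complex.zero_re]
    have hge : Integrable (fun x => (‖g x‖ ^ 2 + ε) ^ (r / 2)) haar :=
      integrable_of_continuous ((by fun_prop : Continuous fun x => ‖g x‖ ^ 2 + ε).rpow_const
        fun _ => Or.inr (by linarith))
    have hIr := hI.re.const_mul r
    simp only [RCLike.re_to_complex] at hIr
    calc ∫ x, ‖g x‖ ^ r ∂haar ≤ ∫ x, (‖g x‖ ^ 2 + ε) ^ (r / 2) ∂haar :=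
          integral_mono (integrable_norm_lin_rpow a s hr0) hge fun x => by
            beta_reduce
            rw [norm_rpow_eq_sq_rpow]
            exact Real.rpow_le_rpow (by positivity) (by linarith) (by linarith)
      _ = ∫ x, (‖g x‖ ^ 2 + ε) ^ (r / 2)
            + r * ((f x - g x) * (conj (g x) * (h (‖g x‖ ^ 2) : ℝ))).re ∂haar := by
          rw [integral_add hge hIr, integral_const_mul, hre, mul_zero, add_zero]
      _ ≤ _ := by
          refine integral_mono (hge.add hIr) (hint ε hε hε1) fun x => ?_
          have := tangent_le_rpow hr hε (f x) (g x)
          beta_reduce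
          rw [← mul_assoc (f x - g x), Complex.re_mul_ofReal, ← mul_assoc]
          exact this
  have hlim : Tendsto (fun n : ℕ => ∫ x, (‖f x‖ ^ 2 + 1 / ((n : ℝ) + 1)) ^ (r / 2) ∂haar) atTop
      (𝓝 (∫ x, ‖f x‖ ^ r ∂haar)) := by
    refine tendsto_integral_of_dominated_convergence (fun x => (‖f x‖ + 1) ^ r)
      (fun n => hmeas _) hf (fun n => .of_forall fun x => ?_) (.of_forall fun x => ?_)
    · rw [Real.norm_of_nonneg (by positivity)]
      exact hbound _ (by positivity) (by
        rw [div_le_one (by positivity)]; linarith [(n.cast_nonneg : (0 : ℝ) ≤ n)]) x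
    · have h1 := (tendsto_one_div_add_atTop_nhds_zero_nat (𝕜 := ℝ)).const_add (‖f x‖ ^ 2)
      rw [add_zero] at h1
      rw [norm_rpow_eq_sq_rpow]
      exact h1.rpow_const (Or.inr (by linarith))
  refine ge_of_tendsto' hlim fun n => hmain _ (by positivity) ?_
  rw [div_le_one (by positivity)]; linarith [(n.cast_nonneg : (0 : ℝ) ≤ n)]

end

section

open AddCircle Filter Topology

/-! ### The orthonormal basis of monomials -/

/-- A monomial as an element of the algebra of continuous functions. -/
def monomialC (α : ℕ →₀ ℤ) : C(InfTorus, ℂ) := ⟨monomial α, continuous_monomial α⟩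

/-- The star subalgebra of continuous functions generated by the monomials. -/
def monomialSubalgebra : StarSubalgebra ℂ C(InfTorus, ℂ) where
  toSubalgebra := Algebra.adjoin ℂ (Set.range monomialC)
  star_mem' := by
    change Algebra.adjoin ℂ (Set.range monomialC) ≤ star (Algebra.adjoin ℂ (Set.range monomialC))
    refine Algebra.adjoin_le ?_
    rintro - ⟨α, rfl⟩
    exact Algebra.subset_adjoin ⟨-α, ContinuousMap.ext fun x => monomial_neg α x⟩

theorem monomialSubalgebra_coe : Subalgebra.toSubmodule monomialSubalgebra.toSubalgebra
    = Submodule.span ℂ (Set.range monomialC) := by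
  apply Algebra.adjoin_eq_span_of_subset
  refine Set.Subset.trans ?_ Submodule.subset_span
  intro x hx
  refine Submonoid.closure_induction (fun _ => id) ⟨0, ?_⟩ ?_ hx
  · ext1 z; exact monomial_zero z
  · rintro - - - - ⟨α, rfl⟩ ⟨β, rfl⟩
    exact ⟨α + β, ContinuousMap.ext fun x => monomial_add α β x⟩

theorem pt_injective : Function.Injective pt := fun x y h => by
  rw [pt, pt, fourier_one, fourier_one] at h
  exact injective_toCircle one_ne_zero (Circle.ext h)

theorem monomialSubalgebra_separatesPoints : monomialSubalgebra.SeparatesPoints := by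
  intro x y hxy
  obtain ⟨j, hj⟩ := Function.ne_iff.1 hxy
  refine ⟨_, ⟨monomialC (Finsupp.single j 1), Algebra.subset_adjoin ⟨_, rfl⟩, rfl⟩, ?_⟩
  change monomial _ x ≠ monomial _ y
  rw [monomial_single, monomial_single]
  exact pt_injective.ne hj

theorem span_monomialC_closure_eq_top :
    (Submodule.span ℂ (Set.range monomialC)).topologicalClosure = ⊤ := by
  rw [← monomialSubalgebra_coe]
  exact congr_arg (Subalgebra.toSubmodule <| StarSubalgebra.toSubalgebra ·)
    (ContinuousMap.starSubalgebra_topologicalClosure_eq_top_of_separatesPoints monomialSubalgebra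
      monomialSubalgebra_separatesPoints)

/-- A monomial as an element of `L²`. -/
def monomialLp (α : ℕ →₀ ℤ) : Lp ℂ 2 haar := ContinuousMap.toLp (E := ℂ) 2 haar ℂ (monomialC α)

theorem coeFn_monomialLp (α : ℕ →₀ ℤ) : monomialLp α =ᵐ[haar] monomial α :=
  ContinuousMap.coeFn_toLp haar (monomialC α)

theorem span_monomialLp_closure_eq_top :
    (Submodule.span ℂ (Set.range monomialLp)).topologicalClosure = ⊤ := by
  convert!
    (ContinuousMap.toLp_denseRange ℂ haar ℂ (p := 2) (by simp)).topologicalClosure_map_submodule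
      span_monomialC_closure_eq_top
  rw [Submodule.map_span, ← Set.range_comp]
  rfl

theorem inner_monomialLp (α : ℕ →₀ ℤ) (f : Lp ℂ 2 haar) :
    inner ℂ (monomialLp α) f = coeff f α := by
  rw [L2.inner_def]
  refine integral_congr_ae ?_
  filter_upwards [coeFn_monomialLp α] with x hx
  rw [hx, RCLike.inner_apply]

theorem coeff_congr {f g : InfTorus → ℂ} (h : f =ᵐ[haar] g) (α : ℕ →₀ ℤ) :
    coeff f α = coeff g α := by
  refine integral_congr_ae ?_
  filter_upwards [h] with x hx
  rw [hx]

theorem orthonormal_monomialLp : Orthonormal ℂ monomialLp := by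
  rw [orthonormal_iff_ite]
  intro α β
  rw [inner_monomialLp, coeff_congr (coeFn_monomialLp β), coeff_monomial]
  simp only [eq_comm]

/-- The Hilbert basis of `L²` that consists of the monomials. -/
def monomialBasis : HilbertBasis (ℕ →₀ ℤ) ℂ (Lp ℂ 2 haar) :=
  HilbertBasis.mk orthonormal_monomialLp span_monomialLp_closure_eq_top.ge

theorem monomialBasis_repr (f : Lp ℂ 2 haar) (α : ℕ →₀ ℤ) :
    monomialBasis.repr f α = coeff f α := by
  rw [monomialBasis.repr_apply_apply, ← inner_monomialLp, monomialBasis, HilbertBasis.coe_mk]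

theorem hasSum_coeff_mul_conj_coeff (f φ : Lp ℂ 2 haar) :
    HasSum (fun α => coeff f α * conj (coeff φ α)) (∫ x, f x * conj (φ x) ∂haar) := by
  have h := monomialBasis.hasSum_inner_mul_inner φ f
  have h1 : inner ℂ φ f = ∫ x, f x * conj (φ x) ∂haar := by
    rw [L2.inner_def]; rfl
  rw [h1] at h
  refine h.congr_fun fun α => ?_
  rw [monomialBasis, HilbertBasis.coe_mk, inner_monomialLp, ← inner_conj_symm, inner_monomialLp]
  ring

theorem hasSum_norm_coeff_sq (φ : Lp ℂ 2 haar) :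
    HasSum (fun α => ‖coeff φ α‖ ^ 2) (‖φ‖ ^ 2) := by
  have h : HasSum (fun α => ‖monomialBasis.repr φ α‖ ^ 2) (‖monomialBasis.repr φ‖ ^ 2) := by
    apply_mod_cast lp.hasSum_norm ?_ (monomialBasis.repr φ)
    simp
  simpa only [monomialBasis_repr, LinearIsometryEquiv.norm_map] using h

theorem exists_coeff_eq {a : (ℕ →₀ ℤ) → ℂ} (ha : Summable fun α => ‖a α‖ ^ 2) :
    ∃ φ : Lp ℂ 2 haar, coeff φ = a := by
  have hm : Memℓp a 2 := memℓp_gen (by simpa using ha)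
  refine ⟨monomialBasis.repr.symm ⟨a, hm⟩, ?_⟩
  ext α
  rw [← monomialBasis_repr, LinearIsometryEquiv.apply_symm_apply]

/-! ### Symmetrization of linear functions -/

/-- The coordinates are identically distributed, so relabelling the variables does not change the
law of the sum; the induction integrates out one variable at a time. -/
theorem integral_lin_image {e : ℕ → ℕ} (a : ℕ → ℂ) (s : Finset ℕ) (he : Set.InjOn e s)
    {f : ℂ → ℝ} (hf : Continuous f) :
    ∫ x, f (lin a (s.image e) x) ∂haar = ∫ x, f (lin (fun j => a (e j)) s x) ∂haar := by
  induction s using Finset.induction_on generalizing f with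
  | empty => simp [lin]
  | insert j s hj ih =>
    have hs : Set.InjOn e s := he.mono (by simp)
    have hj' : e j ∉ s.image e := fun h => by
      obtain ⟨i, hi, hij⟩ := Finset.mem_image.1 h
      have := he (by simp [hi]) (by simp) hij
      exact hj (this ▸ hi)
    have hc : Continuous fun w => circ (fun z => f (w + a (e j) * z)) := by
      unfold circ
      have := continuous_parametric_integral_of_continuous (μ := haarAddCircle)
        (f := fun (w : ℂ) t => f (w + a (e j) * pt t)) (by fun_prop) (s := Set.univ) isCompact_univ
      exact this.congr fun x => by simp
    rw [Finset.image_insert, integral_lin_insert a hj' hf,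
      integral_lin_insert (fun j => a (e j)) hj hf]
    exact ih hs hc

/-- Replacing all coefficients by their mean is the same as averaging the sum over cyclic shifts of
the coefficients. All shifts have the same law, so convexity of the r-th power gives the bound. -/
theorem integral_norm_rpow_lin_mean_le (b : ℕ → ℂ) (n : ℕ) {r : ℝ} (hr : 1 ≤ r) :
    ∫ x, ‖lin (fun _ => (∑ j ∈ Finset.range (n + 1), b j) / (n + 1 : ℕ))
        (Finset.range (n + 1)) x‖ ^ r ∂haar
      ≤ ∫ x, ‖lin b (Finset.range (n + 1)) x‖ ^ r ∂haar := by
  set N := n + 1 with hN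
  have hr0 : 0 ≤ r := by linarith
  have hN0 : (N : ℂ) ≠ 0 := by exact_mod_cast n.succ_ne_zero
  have hNr : (0 : ℝ) < N := by exact_mod_cast n.succ_pos
  -- Cyclic shift by k. Its symmetry in j and k lets the sum over shifts be computed as a sum over
  -- positions.
  set e : ℕ → ℕ → ℕ := fun k j => (j + k) % N with he
  have hinj : ∀ k, Set.InjOn (e k) (Finset.range N) := fun k i hi j hj hij => by
    have h1 := Finset.mem_range.1 (Finset.mem_coe.1 hi)
    have h2 := Finset.mem_range.1 (Finset.mem_coe.1 hj)
    have h3 : i ≡ j [MOD N] := Nat.ModEq.add_right_cancel' k hij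
    rwa [Nat.ModEq, Nat.mod_eq_of_lt h1, Nat.mod_eq_of_lt h2] at h3
  have himage : ∀ k, (Finset.range N).image (e k) = Finset.range N := fun k => by
    refine Finset.eq_of_subset_of_card_le (fun i hi => ?_) ?_
    · obtain ⟨j, _, rfl⟩ := Finset.mem_image.1 hi
      exact Finset.mem_range.2 (Nat.mod_lt _ n.succ_pos)
    · rw [Finset.card_image_of_injOn (hinj k)]
  have hsum : ∀ k, ∑ j ∈ Finset.range N, b (e k j) = ∑ j ∈ Finset.range N, b j := fun k => by
    rw [← Finset.sum_image (f := b) (hinj k), himage]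
  have hmean : ∀ x, lin (fun _ => (∑ j ∈ Finset.range N, b j) / (N : ℕ)) (Finset.range N) x
      = ∑ k ∈ Finset.range N, (N : ℂ)⁻¹ * lin (fun j => b (e k j)) (Finset.range N) x := fun x => by
    simp only [lin]
    rw [← Finset.mul_sum, ← Finset.mul_sum, Finset.sum_comm]
    simp_rw [← Finset.sum_mul]
    have : ∀ j, ∑ k ∈ Finset.range N, b (e k j) = ∑ j ∈ Finset.range N, b j := fun j => by
      rw [← hsum j]
      exact Finset.sum_congr rfl fun k _ => by simp only [he, add_comm]
    simp only [this]
    rw [← Finset.mul_sum]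
    ring
  have hlaw : ∀ k, ∫ x, ‖lin (fun j => b (e k j)) (Finset.range N) x‖ ^ r ∂haar
      = ∫ x, ‖lin b (Finset.range N) x‖ ^ r ∂haar := fun k => by
    have := integral_lin_image b (Finset.range N) (hinj k) (f := fun w => ‖w‖ ^ r)
      (continuous_norm.rpow_const fun _ => Or.inr hr0)
    rw [himage] at this
    exact this.symm
  have hi : ∀ k, Integrable (fun x => (N : ℝ)⁻¹
      * ‖lin (fun j => b (e k j)) (Finset.range N) x‖ ^ r) haar := fun k =>
    (integrable_norm_lin_rpow _ _ hr0).const_mul _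
  calc _ ≤ ∫ x, ∑ k ∈ Finset.range N, (N : ℝ)⁻¹
        * ‖lin (fun j => b (e k j)) (Finset.range N) x‖ ^ r ∂haar := by
        refine integral_mono (integrable_norm_lin_rpow _ _ hr0)
          (integrable_finsetSum _ fun k _ => hi k) fun x => ?_
        beta_reduce
        refine le_trans (Real.rpow_le_rpow (norm_nonneg _)
          (show _ ≤ ∑ k ∈ Finset.range N, (N : ℝ)⁻¹
            * ‖lin (fun j => b (e k j)) (Finset.range N) x‖ from ?_) hr0)
          (Real.rpow_arith_mean_le_arith_mean_rpow _ _ _ (fun _ _ => by positivity) ?_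
            (fun _ _ => norm_nonneg _) hr)
        · rw [hmean]
          refine (norm_sum_le _ _).trans_eq (Finset.sum_congr rfl fun k _ => ?_)
          rw [norm_mul, norm_inv, Complex.norm_natCast]
        · rw [Finset.sum_const, Finset.card_range, nsmul_eq_mul, mul_inv_cancel₀ hNr.ne']
    _ = _ := by
        rw [integral_finsetSum _ fun k _ => hi k]
        simp_rw [integral_const_mul, hlaw]
        rw [Finset.sum_const, Finset.card_range, nsmul_eq_mul, ← mul_assoc,
          mul_inv_cancel₀ hNr.ne', one_mul]

end

section

open AddCircle Filter Topology

/-! ### Linear functions as elements of Hardy spaces and their duals -/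

theorem one_le_toReal {p : ℝ≥0∞} [Fact (1 ≤ p)] (hp : p ≠ ∞) : 1 ≤ p.toReal :=
  (ENNReal.dichotomy p).resolve_left hp

theorem norm_Lp_eq {p : ℝ≥0∞} [Fact (1 ≤ p)] (hp : p ≠ ∞) (f : Lp ℂ p haar) :
    ‖f‖ = (∫ x, ‖f x‖ ^ p.toReal ∂haar) ^ (1 / p.toReal) := by
  have h0 : p ≠ 0 := (zero_lt_one.trans_le (Fact.out : 1 ≤ p)).ne'
  rw [Lp.norm_def, (Lp.memLp f).eLpNorm_eq_integral_rpow_norm h0 hp, ENNReal.toReal_ofReal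
    (Real.rpow_nonneg (integral_nonneg fun x => by positivity) _), one_div]

theorem memLp_lin (a : ℕ → ℂ) (s : Finset ℕ) (p : ℝ≥0∞) : MemLp (lin a s) p haar := by
  obtain ⟨C, hC⟩ := isCompact_univ.exists_bound_of_continuousOn (continuous_lin a s).continuousOn
  exact MemLp.of_bound (continuous_lin a s).aestronglyMeasurable C
    (.of_forall fun x => hC x trivial)

theorem coeff_lin_of_neg (a : ℕ → ℂ) (s : Finset ℕ) {α : ℕ →₀ ℤ} (hα : ∃ j, α j < 0) :
    coeff (lin a s) α = 0 := by
  refine coeff_lin_of_ne a s ?_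
  rintro j rfl
  obtain ⟨i, hi⟩ := hα
  rw [Finsupp.single_apply] at hi
  split_ifs at hi <;> omega

/-- A finite linear function as an element of a Hardy space. -/
def linHardy (p : ℝ≥0∞) [Fact (1 ≤ p)] (a : ℕ → ℂ) (s : Finset ℕ) : Hardy p :=
  ⟨(memLp_lin a s p).toLp, fun _ hα =>
    (coeff_congr (MemLp.coeFn_toLp _) _).trans (coeff_lin_of_neg a s hα)⟩

theorem coeff_linHardy (p : ℝ≥0∞) [Fact (1 ≤ p)] (a : ℕ → ℂ) (s : Finset ℕ) (α : ℕ →₀ ℤ) :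
    coeff (linHardy p a s).1 α = coeff (lin a s) α :=
  coeff_congr (memLp_lin a s p).coeFn_toLp _

theorem isLinearSeries_coeff_linHardy (p : ℝ≥0∞) [Fact (1 ≤ p)] (a : ℕ → ℂ) (s : Finset ℕ) :
    IsLinearSeries (coeff (linHardy p a s).1) := fun α hα => by
  rw [coeff_linHardy, coeff_lin_of_ne a s hα]

theorem norm_linHardy {p : ℝ≥0∞} [Fact (1 ≤ p)] (hp : p ≠ ∞) (a : ℕ → ℂ) (s : Finset ℕ) :
    ‖linHardy p a s‖ = (∫ x, ‖lin a s x‖ ^ p.toReal ∂haar) ^ (1 / p.toReal) := by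
  rw [Submodule.coe_norm, norm_Lp_eq hp]
  congr 1
  refine integral_congr_ae ?_
  filter_upwards [(memLp_lin a s p).coeFn_toLp] with x hx
  rw [linHardy, hx]

theorem norm_linHardy_two (a : ℕ → ℂ) (s : Finset ℕ) :
    ‖linHardy 2 a s‖ = Real.sqrt (∑ j ∈ s, ‖a j‖ ^ 2) := by
  rw [norm_linHardy (by simp), ENNReal.toReal_ofNat, Real.sqrt_eq_rpow, ← integral_norm_lin_sq]
  simp only [Real.rpow_two]

theorem norm_lin_coeff_le {p : ℝ≥0∞} [Fact (1 ≤ p)] (hp : p ≠ ∞) (f : Hardy p) (s : Finset ℕ) :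
    (∫ x, ‖lin (fun j => coeff f.1 (Finsupp.single j 1)) s x‖ ^ p.toReal ∂haar) ^ (1 / p.toReal)
      ≤ ‖f‖ := by
  have h1 := one_le_toReal hp
  have h0 : p ≠ 0 := (zero_lt_one.trans_le (Fact.out : 1 ≤ p)).ne'
  have hm := Lp.memLp f.1
  have hi : Integrable (fun x => (‖f.1 x‖ + 1) ^ p.toReal) haar := by
    refine ((hm.norm.add (memLp_const (1 : ℝ))).integrable_norm_rpow h0 hp).congr
      (.of_forall fun x => ?_)
    simp only [Pi.add_apply]
    rw [Real.norm_of_nonneg (by positivity)]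
  rw [Submodule.coe_norm, norm_Lp_eq hp]
  exact Real.rpow_le_rpow (integral_nonneg fun x => by positivity)
    (integral_norm_rpow_lin_le h1 hm.1 hi (hm.integrable Fact.out) f.2 s) (by positivity)

/-- Khinchine's lower bound applied to the truncated linear part, whose L^p norm is at most that of
f by contractivity. -/
theorem sqrt_sum_coeff_le {p : ℝ≥0∞} [Fact (1 ≤ p)] (hp : p ≠ ∞) (f : Hardy p) (s : Finset ℕ) :
    Real.sqrt (∑ j ∈ s, ‖coeff f.1 (Finsupp.single j 1)‖ ^ 2)
      ≤ (lowerConst p.toReal)⁻¹ * ‖f‖ := by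
  have h1 := one_le_toReal hp
  rw [le_inv_mul_iff₀ (lowerConst_pos h1)]
  exact (khinchine _ s h1).1.trans (norm_lin_coeff_le hp f s)

theorem IsLinearSeries.hasSum_iff {E : Type*} [AddCommMonoid E] [TopologicalSpace E]
    {a : (ℕ →₀ ℤ) → ℂ} (ha : IsLinearSeries a) {g : (ℕ →₀ ℤ) → E} (hg : ∀ α, a α = 0 → g α = 0)
    {c : E} : HasSum (fun j : ℕ => g (Finsupp.single j 1)) c ↔ HasSum g c :=
  single_one_injective.hasSum_iff (f := g) fun α hα => hg α (ha α fun j h => hα ⟨j, h.symm⟩)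

theorem IsLinearSeries.represents_iff {p : ℝ≥0∞} [Fact (1 ≤ p)] {a : (ℕ →₀ ℤ) → ℂ}
    (ha : IsLinearSeries a) {Λ : StrongDual ℂ (Hardy p)} :
    Represents a Λ ↔ ∀ f : Hardy p, HasSum
      (fun j : ℕ => coeff f.1 (Finsupp.single j 1) * conj (a (Finsupp.single j 1))) (Λ f) :=
  forall_congr' fun f =>
    (ha.hasSum_iff (g := fun α => coeff f.1 α * conj (a α)) fun α h => by simp [h]).symm

theorem Represents.apply_linHardy {p : ℝ≥0∞} [Fact (1 ≤ p)] {a : (ℕ →₀ ℤ) → ℂ}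
    (ha : IsLinearSeries a) {Λ : StrongDual ℂ (Hardy p)} (h : Represents a Λ) (b : ℕ → ℂ)
    (s : Finset ℕ) : Λ (linHardy p b s) = ∑ j ∈ s, b j * conj (a (Finsupp.single j 1)) := by
  have h1 := ha.represents_iff.1 h (linHardy p b s)
  simp only [coeff_linHardy, coeff_lin_single] at h1
  rw [h1.unique (hasSum_sum_of_ne_finset_zero (s := s) fun j hj => by rw [if_neg hj, zero_mul])]
  exact Finset.sum_congr rfl fun j hj => by rw [if_pos hj]

/-- The functional is tested on the truncation of the series itself, where it takes the value S²,
and Khinchine's upper bound controls the norm of the truncation. The bound is uniform in s without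
assuming square-summability, so it serves the converse direction as well. -/
theorem Represents.sqrt_sum_le {p : ℝ≥0∞} [Fact (1 ≤ p)] (hp : p ≠ ∞) {a : (ℕ →₀ ℤ) → ℂ}
    (ha : IsLinearSeries a) {Λ : StrongDual ℂ (Hardy p)} (h : Represents a Λ) (s : Finset ℕ) :
    Real.sqrt (∑ j ∈ s, ‖a (Finsupp.single j 1)‖ ^ 2) ≤ upperConst p.toReal * ‖Λ‖ := by
  set b : ℕ → ℂ := fun j => a (Finsupp.single j 1) with hb
  set S := Real.sqrt (∑ j ∈ s, ‖b j‖ ^ 2) with hS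
  have hS2 : S ^ 2 = ∑ j ∈ s, ‖b j‖ ^ 2 :=
    Real.sq_sqrt (Finset.sum_nonneg fun j _ => by positivity)
  have h1 : Λ (linHardy p b s) = ((S ^ 2 : ℝ) : ℂ) := by
    rw [h.apply_linHardy ha, hS2]
    push_cast
    exact Finset.sum_congr rfl fun j _ => by
      rw [Complex.mul_conj, Complex.normSq_eq_norm_sq]; push_cast; rfl
  have h2 := Λ.le_opNorm (linHardy p b s)
  rw [h1, Complex.norm_real, Real.norm_of_nonneg (by positivity), norm_linHardy hp] at h2
  have h3 := (khinchine b s (one_le_toReal hp)).2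
  rcases (Real.sqrt_nonneg _ : 0 ≤ S).eq_or_lt with h0 | h0
  · exact h0.symm.le.trans (mul_nonneg (upperConst_pos _).le (ContinuousLinearMap.opNorm_nonneg Λ))
  · refine le_of_mul_le_mul_right ?_ h0
    calc S * S = S ^ 2 := by ring
      _ ≤ ‖Λ‖ * (upperConst p.toReal * S) := h2.trans (by gcongr)
      _ = upperConst p.toReal * ‖Λ‖ * S := by ring

theorem coeff_Lp_add {p : ℝ≥0∞} [Fact (1 ≤ p)] (f g : Lp ℂ p haar) (α : ℕ →₀ ℤ) :
    coeff (f + g : Lp ℂ p haar) α = coeff f α + coeff g α := by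
  rw [coeff_congr (Lp.coeFn_add f g)]
  unfold coeff
  rw [← integral_add (integrable_mul_conj_monomial f α) (integrable_mul_conj_monomial g α)]
  simp only [Pi.add_apply, add_mul]

theorem coeff_Lp_smul {p : ℝ≥0∞} [Fact (1 ≤ p)] (c : ℂ) (f : Lp ℂ p haar) (α : ℕ →₀ ℤ) :
    coeff (c • f : Lp ℂ p haar) α = c * coeff f α := by
  rw [coeff_congr (Lp.coeFn_smul c f)]
  unfold coeff
  rw [← integral_const_mul]
  simp only [Pi.smul_apply, smul_eq_mul, mul_assoc]

/-- Cauchy–Schwarz with the ℓ² bound on the coefficients f̂(e_j) bounds all finite sums of absolute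
values at once. Absolute convergence then gives linearity and the norm estimate. -/
theorem IsLinearSeries.exists_represents {p : ℝ≥0∞} [Fact (1 ≤ p)] (hp : p ≠ ∞)
    {a : (ℕ →₀ ℤ) → ℂ} (ha : IsLinearSeries a) {S : ℝ} (hS : 0 ≤ S)
    (hsum : HasSum (fun j : ℕ => ‖a (Finsupp.single j 1)‖ ^ 2) (S ^ 2)) :
    ∃ Λ : StrongDual ℂ (Hardy p), Represents a Λ ∧ ‖Λ‖ ≤ (lowerConst p.toReal)⁻¹ * S := by
  have hl := lowerConst_pos (one_le_toReal hp)
  set t : Hardy p → ℕ → ℂ := fun f j =>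
    coeff f.1 (Finsupp.single j 1) * conj (a (Finsupp.single j 1)) with ht
  have hbound : ∀ (f : Hardy p) (s : Finset ℕ),
      ∑ j ∈ s, ‖t f j‖ ≤ (lowerConst p.toReal)⁻¹ * S * ‖f‖ := fun f s => by
    have h1 : Real.sqrt (∑ j ∈ s, ‖a (Finsupp.single j 1)‖ ^ 2) ≤ S := by
      rw [Real.sqrt_le_left hS]
      exact sum_le_hasSum s (fun j _ => by positivity) hsum
    calc ∑ j ∈ s, ‖t f j‖
        = ∑ j ∈ s, ‖coeff f.1 (Finsupp.single j 1)‖ * ‖a (Finsupp.single j 1)‖ := by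
          simp only [ht, norm_mul, RCLike.norm_conj]
      _ ≤ Real.sqrt (∑ j ∈ s, ‖coeff f.1 (Finsupp.single j 1)‖ ^ 2)
            * Real.sqrt (∑ j ∈ s, ‖a (Finsupp.single j 1)‖ ^ 2) :=
          Real.sum_mul_le_sqrt_mul_sqrt _ _ _
      _ ≤ ((lowerConst p.toReal)⁻¹ * ‖f‖) * S :=
          mul_le_mul (sqrt_sum_coeff_le hp f s) h1 (Real.sqrt_nonneg _) (by positivity)
      _ = _ := by ring
  have hsn : ∀ f, Summable fun j => ‖t f j‖ := fun f =>
    summable_of_sum_le (fun j => norm_nonneg _) (hbound f)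
  have hs : ∀ f, Summable (t f) := fun f => (hsn f).of_norm
  set L : Hardy p →ₗ[ℂ] ℂ :=
    { toFun := fun f => ∑' j, t f j
      map_add' := fun f g => by
        rw [← (hs f).tsum_add (hs g)]
        congr 1; ext j
        simp only [ht, Submodule.coe_add, coeff_Lp_add, add_mul]
      map_smul' := fun c f => by
        rw [RingHom.id_apply, smul_eq_mul, ← tsum_mul_left]
        congr 1; ext j
        simp only [ht, Submodule.coe_smul, coeff_Lp_smul, mul_assoc] } with hL
  have hLb : ∀ f, ‖L f‖ ≤ (lowerConst p.toReal)⁻¹ * S * ‖f‖ := fun f =>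
    (norm_tsum_le_tsum_norm (hsn f)).trans ((hsn f).tsum_le_of_sum_le (hbound f))
  refine ⟨L.mkContinuous _ hLb, ha.represents_iff.2 fun f => (hs f).hasSum,
    L.mkContinuous_norm_le (by positivity) hLb⟩

theorem IsLinearSeries.hasSum_norm_sq {φ : Hardy 2} (h : IsLinearSeries (coeff φ.1)) :
    HasSum (fun j : ℕ => ‖coeff φ.1 (Finsupp.single j 1)‖ ^ 2) (‖φ‖ ^ 2) :=
  (h.hasSum_iff (g := fun α => ‖coeff φ.1 α‖ ^ 2) fun α h => by simp [h]).2
    (hasSum_norm_coeff_sq φ.1)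

theorem Represents.inv_upperConst_mul_norm_le {p : ℝ≥0∞} [Fact (1 ≤ p)] (hp : p ≠ ∞) {φ : Hardy 2}
    (hφ : IsLinearSeries (coeff φ.1)) {Λ : StrongDual ℂ (Hardy p)}
    (h : Represents (coeff φ.1) Λ) : (upperConst p.toReal)⁻¹ * ‖φ‖ ≤ ‖Λ‖ := by
  have hu := upperConst_pos p.toReal
  rw [inv_mul_le_iff₀ hu]
  refine abs_le_of_sq_le_sq' ?_ (by positivity) |>.2
  refine hasSum_le_of_sum_le hφ.hasSum_norm_sq fun s => ?_
  rw [← Real.sqrt_le_left (by positivity)]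
  exact h.sqrt_sum_le hp hφ s

theorem Represents.apply_eq_integral {p : ℝ≥0∞} [Fact (1 ≤ p)] {φ : Hardy 2}
    {Λ : StrongDual ℂ (Hardy p)} (h : Represents (coeff φ.1) Λ) (f : Hardy p)
    (hf : MemLp f.1 2 haar) : Λ f = ∫ x, f.1 x * conj (φ.1 x) ∂haar := by
  have h1 := hasSum_coeff_mul_conj_coeff (hf.toLp _) φ.1
  have h2 : ∫ x, hf.toLp _ x * conj (φ.1 x) ∂haar = ∫ x, f.1 x * conj (φ.1 x) ∂haar := by
    refine integral_congr_ae ?_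
    filter_upwards [hf.coeFn_toLp] with x hx
    rw [hx]
  rw [h2] at h1
  simp only [coeff_congr hf.coeFn_toLp] at h1
  exact (h f).unique h1

/-- The uniform bound on partial sums gives square-summability, and the Riesz–Fischer theorem
produces φ. -/
theorem Represents.exists_coeff_eq {p : ℝ≥0∞} [Fact (1 ≤ p)] (hp : p ≠ ∞) {a : (ℕ →₀ ℤ) → ℂ}
    (ha : IsLinearSeries a) {Λ : StrongDual ℂ (Hardy p)} (h : Represents a Λ) :
    ∃ φ : Hardy 2, coeff φ.1 = a := by
  have hu := upperConst_pos p.toReal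
  have hs : Summable fun j : ℕ => ‖a (Finsupp.single j 1)‖ ^ 2 :=
    summable_of_sum_le (c := (upperConst p.toReal * ‖Λ‖) ^ 2) (fun j => by positivity) fun s => by
      rw [← Real.sqrt_le_left (by positivity)]
      exact h.sqrt_sum_le hp ha s
  have hs' : Summable fun α => ‖a α‖ ^ 2 :=
    ((ha.hasSum_iff (g := fun α => ‖a α‖ ^ 2) fun α h => by simp [h]).1 hs.hasSum).summable
  obtain ⟨φ, hφ⟩ := Polytorus.exists_coeff_eq hs'
  refine ⟨⟨φ, fun α hα => ?_⟩, hφ⟩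
  rw [hφ]
  refine ha α ?_
  rintro j rfl
  obtain ⟨i, hi⟩ := hα
  rw [Finsupp.single_apply] at hi
  split_ifs at hi <;> omega

/-! ### Optimality of the constants -/

theorem exists_represents_linHardy {p : ℝ≥0∞} [Fact (1 ≤ p)] (hp : p ≠ ∞) (a : ℕ → ℂ)
    (s : Finset ℕ) : ∃ Λ : StrongDual ℂ (Hardy p), Represents (coeff (linHardy 2 a s).1) Λ := by
  have h := isLinearSeries_coeff_linHardy 2 a s
  obtain ⟨Λ, hΛ, -⟩ := h.exists_represents hp (norm_nonneg _) h.hasSum_norm_sq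
  exact ⟨Λ, hΛ⟩

theorem Represents.apply_eq_sum {p : ℝ≥0∞} [Fact (1 ≤ p)] {a : ℕ → ℂ} {s : Finset ℕ}
    {Λ : StrongDual ℂ (Hardy p)} (h : Represents (coeff (linHardy 2 a s).1) Λ) (f : Hardy p) :
    Λ f = ∑ j ∈ s, coeff f.1 (Finsupp.single j 1) * conj (a j) := by
  have h1 := (isLinearSeries_coeff_linHardy 2 a s).represents_iff.1 h f
  simp only [coeff_linHardy, coeff_lin_single] at h1
  rw [h1.unique (hasSum_sum_of_ne_finset_zero (s := s) fun j hj => by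
    rw [if_neg hj, map_zero, mul_zero])]
  exact Finset.sum_congr rfl fun j hj => by rw [if_pos hj]

/-- The first coordinate function. -/
abbrev coordHardy (p : ℝ≥0∞) [Fact (1 ≤ p)] : Hardy p := linHardy p 1 {0}

theorem norm_coordHardy {p : ℝ≥0∞} [Fact (1 ≤ p)] (hp : p ≠ ∞) : ‖coordHardy p‖ = 1 := by
  rw [norm_linHardy hp]
  simp [lin]

theorem norm_eq_one_of_represents_coordHardy {p : ℝ≥0∞} [Fact (1 ≤ p)] (hp : p ≠ ∞)
    {Λ : StrongDual ℂ (Hardy p)} (h : Represents (coeff (coordHardy 2).1) Λ) : ‖Λ‖ = 1 := by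
  have h1 := one_le_toReal hp
  refine le_antisymm (Λ.opNorm_le_bound zero_le_one fun f => ?_) ?_
  · have h2 := norm_lin_coeff_le hp f {0}
    have h3 : ∀ x, ‖lin (fun j => coeff f.1 (Finsupp.single j 1)) {0} x‖
        = ‖coeff f.1 (Finsupp.single 0 1)‖ := fun x => by simp [lin]
    simp only [h3, integral_const, probReal_univ, smul_eq_mul, one_mul] at h2
    rw [← Real.rpow_mul (norm_nonneg _), mul_one_div_cancel (by linarith), Real.rpow_one] at h2
    rw [h.apply_eq_sum]
    simpa using h2
  · have h2 := Λ.le_opNorm (coordHardy p)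
    rw [norm_coordHardy hp, mul_one, h.apply_eq_sum] at h2
    simpa [coeff_linHardy, coeff_lin_single] using h2

/-- The normalized sum of the first `n + 1` coordinate functions. -/
abbrev stdHardy (p : ℝ≥0∞) [Fact (1 ≤ p)] (n : ℕ) : Hardy p :=
  linHardy p (fun _ => ((Real.sqrt (n + 1 : ℕ))⁻¹ : ℝ)) (Finset.range (n + 1))

theorem norm_stdHardy {p : ℝ≥0∞} [Fact (1 ≤ p)] (hp : p ≠ ∞) (n : ℕ) :
    ‖stdHardy p n‖ = (∫ x, ‖stdSum n x‖ ^ p.toReal ∂haar) ^ (1 / p.toReal) :=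
  norm_linHardy hp _ _

theorem norm_stdHardy_two (n : ℕ) : ‖stdHardy 2 n‖ = 1 := by
  rw [norm_linHardy_two, sum_norm_sq_stdSum, Real.sqrt_one]

/-- Testing on S = c ∑ z_j gives ‖Λ‖ ‖S‖ ≥ 1. Conversely, for any f, averaging the coefficients of
its linear part over the N variables gives Λ(f) S; contractivity and symmetrization then yield |Λ f|
‖S‖ ≤ ‖f‖. -/
theorem norm_mul_norm_eq_one_of_represents_const {p : ℝ≥0∞} [Fact (1 ≤ p)] (hp : p ≠ ∞) {n : ℕ}
    {c : ℝ} (hc : c * c * (n + 1 : ℕ) = 1) {Λ : StrongDual ℂ (Hardy p)}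
    (h : Represents (coeff (linHardy 2 (fun _ => (c : ℂ)) (Finset.range (n + 1))).1) Λ) :
    ‖Λ‖ * ‖linHardy p (fun _ => (c : ℂ)) (Finset.range (n + 1))‖ = 1 := by
  have h1 := one_le_toReal hp
  set N := n + 1 with hN
  set S := linHardy p (fun _ => (c : ℂ)) (Finset.range N) with hS
  have hcc : (c : ℂ) * c * N = 1 := by exact_mod_cast hc
  have hN0 : (N : ℂ) ≠ 0 := by exact_mod_cast n.succ_ne_zero
  have hge : 1 ≤ ‖Λ‖ * ‖S‖ := by
    refine le_trans (le_of_eq ?_) (Λ.le_opNorm S)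
    have h2 : ∀ j ∈ Finset.range N, coeff S.1 (Finsupp.single j 1) * conj (c : ℂ) = c * c :=
      fun j hj => by rw [hS, coeff_linHardy, coeff_lin_single, if_pos hj, Complex.conj_ofReal]
    rw [h.apply_eq_sum, Finset.sum_congr rfl h2, Finset.sum_const, Finset.card_range, nsmul_eq_mul,
      mul_comm, hcc, norm_one]
  have hpos : 0 < ‖S‖ := by
    by_contra h0
    rw [le_antisymm (not_lt.1 h0) (norm_nonneg S), mul_zero] at hge
    linarith
  refine le_antisymm ?_ hge
  rw [← le_div_iff₀ hpos]
  refine Λ.opNorm_le_bound (by positivity) fun f => ?_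
  set b : ℕ → ℂ := fun j => coeff f.1 (Finsupp.single j 1) with hb
  set m := (∑ j ∈ Finset.range N, b j) / (N : ℕ) with hm
  -- Because c²N = 1, the mean of the coefficients equals c² times their sum.
  have h2 : m = Λ f * c := by
    rw [h.apply_eq_sum, ← Finset.sum_mul, Complex.conj_ofReal, hm, div_eq_iff hN0]
    linear_combination -(∑ j ∈ Finset.range N, b j) * hcc
  have h3 : ∀ x, ‖lin (fun _ => m) (Finset.range N) x‖
      = ‖Λ f‖ * ‖lin (fun _ => (c : ℂ)) (Finset.range N) x‖ := fun x => by
    rw [← norm_mul, ← lin_mul_left, h2]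
  have h4 := Real.rpow_le_rpow (integral_nonneg fun x => by positivity)
    (integral_norm_rpow_lin_mean_le b n h1) (z := 1 / p.toReal) (by positivity)
  have h5 := h4.trans (norm_lin_coeff_le hp f (Finset.range N))
  simp only [← hN, ← hm, h3, Real.mul_rpow (norm_nonneg _) (norm_nonneg _)] at h5
  rw [integral_const_mul, Real.mul_rpow (by positivity)
    (integral_nonneg fun x => by positivity), ← Real.rpow_mul (norm_nonneg _),
    mul_one_div_cancel (by linarith), Real.rpow_one, ← norm_linHardy hp, ← hS] at h5
  rw [div_mul_eq_mul_div, le_div_iff₀ hpos, one_mul]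
  exact h5

theorem norm_mul_norm_eq_one_of_represents_stdHardy {p : ℝ≥0∞} [Fact (1 ≤ p)] (hp : p ≠ ∞) {n : ℕ}
    {Λ : StrongDual ℂ (Hardy p)} (h : Represents (coeff (stdHardy 2 n).1) Λ) :
    ‖Λ‖ * ‖stdHardy p n‖ = 1 := by
  refine norm_mul_norm_eq_one_of_represents_const hp ?_ h
  rw [← mul_inv, Real.mul_self_sqrt (by positivity), inv_mul_cancel₀ (by positivity)]

/-- A single coordinate is extremal for p < 2. For p ≥ 2 a positive admissible A bounds the p-th
moments of all normalized sums by A^{-p}, and the Gaussian limit inherits the bound. -/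
theorem le_inv_upperConst {p : ℝ≥0∞} [Fact (1 ≤ p)] (hp : p ≠ ∞) {A : ℝ}
    (hA : ∀ (φ : Hardy 2) (Λ : StrongDual ℂ (Hardy p)), IsLinearSeries (coeff φ.1) →
      Represents (coeff φ.1) Λ → A * ‖φ‖ ≤ ‖Λ‖) : A ≤ (upperConst p.toReal)⁻¹ := by
  have h1 := one_le_toReal hp
  have hp0 : 0 < p.toReal := by linarith
  rcases lt_or_ge p.toReal 2 with h2 | h2
  · obtain ⟨Λ, hΛ⟩ := exists_represents_linHardy hp 1 {0}
    have := hA _ Λ (isLinearSeries_coeff_linHardy 2 1 {0}) hΛ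
    rw [norm_coordHardy (by simp), norm_eq_one_of_represents_coordHardy hp hΛ, mul_one] at this
    rwa [upperConst_of_lt h1 h2, inv_one]
  · rcases le_or_gt A 0 with h0 | h0
    · exact h0.trans (inv_nonneg.2 (upperConst_pos _).le)
    rw [upperConst_of_le h2, le_inv_comm₀ h0 (Real.rpow_pos_of_pos (gamma_pos h1) _)]
    have h3 : ∀ n, ∫ x, ‖stdSum n x‖ ^ p.toReal ∂haar ≤ A⁻¹ ^ p.toReal := fun n => by
      obtain ⟨Λ, hΛ⟩ := exists_represents_linHardy hp
        (fun _ => ((Real.sqrt (n + 1 : ℕ))⁻¹ : ℝ)) (Finset.range (n + 1))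
      have h4 := hA _ Λ (isLinearSeries_coeff_linHardy 2 _ _) hΛ
      rw [norm_stdHardy_two, mul_one] at h4
      have h5 := norm_mul_norm_eq_one_of_represents_stdHardy hp hΛ
      have h6 : ‖stdHardy p n‖ ≤ A⁻¹ := by
        rw [← one_div, le_div_iff₀ h0, mul_comm]
        exact (mul_le_mul_of_nonneg_right h4 (norm_nonneg _)).trans_eq h5
      have h7 := Real.rpow_le_rpow (norm_nonneg _) h6 hp0.le
      rwa [norm_stdHardy hp, ← Real.rpow_mul (integral_nonneg fun x => by positivity),
        one_div_mul_cancel hp0.ne', Real.rpow_one] at h7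
    have h8 := gamma_le_of_moment_stdSum_le hp0.le h3
    have h9 := Real.rpow_le_rpow (gamma_pos h1).le h8 (one_div_nonneg.2 hp0.le)
    rwa [← Real.rpow_mul (by positivity), mul_one_div_cancel hp0.ne', Real.rpow_one] at h9

/-- The roles are exchanged: for p < 2 the normalized sums are extremal in the limit, by convergence
of their p-th moments, and for p ≥ 2 a single coordinate suffices. -/
theorem inv_lowerConst_le {p : ℝ≥0∞} [Fact (1 ≤ p)] (hp : p ≠ ∞) {B : ℝ}
    (hB : ∀ (φ : Hardy 2) (Λ : StrongDual ℂ (Hardy p)), IsLinearSeries (coeff φ.1) →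
      Represents (coeff φ.1) Λ → ‖Λ‖ ≤ B * ‖φ‖) : (lowerConst p.toReal)⁻¹ ≤ B := by
  have h1 := one_le_toReal hp
  have hp0 : 0 < p.toReal := by linarith
  rcases lt_or_ge p.toReal 2 with h2 | h2
  · have hG : 0 < Real.Gamma (1 + p.toReal / 2) ^ (1 / p.toReal) :=
      Real.rpow_pos_of_pos (gamma_pos h1) _
    rw [lowerConst_of_lt h1 h2, inv_le_iff_one_le_mul₀ hG]
    have hlim := (((tendsto_moment_stdSum h1 h2).rpow_const (p := 1 / p.toReal)
      (Or.inr (one_div_nonneg.2 hp0.le))).const_mul B)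
    refine ge_of_tendsto' hlim fun n => ?_
    obtain ⟨Λ, hΛ⟩ := exists_represents_linHardy hp
      (fun _ => ((Real.sqrt (n + 1 : ℕ))⁻¹ : ℝ)) (Finset.range (n + 1))
    have h4 := hB _ Λ (isLinearSeries_coeff_linHardy 2 _ _) hΛ
    rw [norm_stdHardy_two, mul_one] at h4
    rw [← norm_stdHardy hp]
    exact (norm_mul_norm_eq_one_of_represents_stdHardy hp hΛ).symm.trans_le
      (mul_le_mul_of_nonneg_right h4 (norm_nonneg _))
  · obtain ⟨Λ, hΛ⟩ := exists_represents_linHardy hp 1 {0}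
    have := hB _ Λ (isLinearSeries_coeff_linHardy 2 1 {0}) hΛ
    rw [norm_coordHardy (by simp), norm_eq_one_of_represents_coordHardy hp hΛ, mul_one] at this
    rwa [lowerConst_of_le h2, inv_one]

end

end Polytorus

end

/-! ### Duality theorem for linear functions with optimal constants -/

theorem theorem2 (p : ℝ≥0∞) [Fact (1 ≤ p)] (hp : p ≠ ∞) :
    -- every linear function in `H^2` is an element of `(H^p)^*`, and the norm estimates hold
    (∀ φ : Polytorus.Hardy 2, Polytorus.IsLinearSeries (Polytorus.coeff φ.1) →
      ∃ Λ : StrongDual ℂ (Polytorus.Hardy p),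
        Polytorus.Represents (Polytorus.coeff φ.1) Λ ∧
        (∀ f : Polytorus.Hardy p, MemLp f.1 2 Polytorus.haar →
          Λ f = ∫ x, f.1 x * conj (φ.1 x) ∂Polytorus.haar) ∧
        (Polytorus.upperConst p.toReal)⁻¹ * ‖φ‖ ≤ ‖Λ‖ ∧
        ‖Λ‖ ≤ (Polytorus.lowerConst p.toReal)⁻¹ * ‖φ‖) ∧
    -- conversely, a linear function that is an element of `(H^p)^*` is in `H^2`
    (∀ (a : (ℕ →₀ ℤ) → ℂ) (Λ : StrongDual ℂ (Polytorus.Hardy p)),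
      Polytorus.IsLinearSeries a → Polytorus.Represents a Λ →
      ∃ φ : Polytorus.Hardy 2, Polytorus.coeff φ.1 = a) ∧
    -- the constant in the lower estimate is optimal
    (∀ A : ℝ,
      (∀ (φ : Polytorus.Hardy 2) (Λ : StrongDual ℂ (Polytorus.Hardy p)),
        Polytorus.IsLinearSeries (Polytorus.coeff φ.1) →
        Polytorus.Represents (Polytorus.coeff φ.1) Λ → A * ‖φ‖ ≤ ‖Λ‖) →
      A ≤ (Polytorus.upperConst p.toReal)⁻¹) ∧
    -- the constant in the upper estimate is optimal
    (∀ B : ℝ,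
      (∀ (φ : Polytorus.Hardy 2) (Λ : StrongDual ℂ (Polytorus.Hardy p)),
        Polytorus.IsLinearSeries (Polytorus.coeff φ.1) →
        Polytorus.Represents (Polytorus.coeff φ.1) Λ → ‖Λ‖ ≤ B * ‖φ‖) →
      (Polytorus.lowerConst p.toReal)⁻¹ ≤ B) := by
  refine ⟨fun φ hφ => ?_, fun a Λ ha h => h.exists_coeff_eq hp ha,
    fun A hA => Polytorus.le_inv_upperConst hp hA, fun B hB => Polytorus.inv_lowerConst_le hp hB⟩
  obtain ⟨Λ, hΛ, hle⟩ := hφ.exists_represents hp (norm_nonneg φ) hφ.hasSum_norm_sq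
  exact ⟨Λ, hΛ, hΛ.apply_eq_integral, hΛ.inv_upperConst_mul_norm_le hp hφ, hle⟩
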